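/- Let $Q(x,y)=x^{T}ax+x^{T}by+y^{T}cy$ ($x,y\in\mathbf{Z}^4$) be a quadratic form with $a,b,c\in \mathrm{Mat}_4(\mathbf{Z})$ and $a,c$ symmetric. Suppose that $Q$ is generic, i.e. $\det(ab)\neq 0$ and the matrix $\Delta=4b^{-1}ab^{-T}c-I\in\mathrm{Mat}_4(\mathbf{Q})$ has four distinct eigenvalues in $\overline{\mathbf{Q}}$, none of which is $0$ or $-1$. For $q$ odd, let $\mathrm{Sp}_8(\mathbf{Z}/q\mathbf{Z})$ be the group of block matrices $\begin{pmatrix}A&B\\C&D\end{pmatrix}$ over $\mathbf{Z}/q\mathbf{Z}$, with $4\times4$ blocks, such that $A^TC=C^TA$, $B^TD=D^TB$ and $A^TD-C^TB=I$. For $r\in(\mathbf{Z}/q\mathbf{Z})^*$ the dilate of $h=\begin{pmatrix}A&B\\C&D\end{pmatrix}$ is $h^{(r)}=\begin{pmatrix}A&r^{-1}B\\rC&D\end{pmatrix}$. If moreover $q$ is coprime to $\det b$, let $$g=\begin{pmatrix}-2b^{-T}c&b^{-T}\\4ab^{-T}c-b&-2ab^{-T}\end{pmatrix}\in\mathrm{Sp}_8(\mathbf{Z}/q\mathbf{Z}),$$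 and let $\Gamma_q\leq \mathrm{Sp}_8(\mathbf{Z}/q\mathbf{Z})$ be the subgroup generated by the elements $(g^{(r)})^{-1}g^{(s)}$, $r,s\in(\mathbf{Z}/q\mathbf{Z})^*$. Let $\ell^2((\mathbf{Z}/q\mathbf{Z})^4)$ be the space of all functions $(\mathbf{Z}/q\mathbf{Z})^4\to\mathbf{C}$ with inner product $\langle f_1,f_2\rangle=\mathbb{E}_x f_1(x)\overline{f_2(x)}$, where $\mathbb{E}$ denotes the average, and write $e_q(t)=e^{2\pi i t/q}$. By a Weil representation $\rho$ of $\mathrm{Sp}_8(\mathbf{Z}/q\mathbf{Z})$ we mean a unitary representation on $\ell^2((\mathbf{Z}/q\mathbf{Z})^4)$ for which there is a function $\xi:\mathrm{Sp}_8(\mathbf{Z}/q\mathbf{Z})\to\{z\in\mathbf{C}:|z|=1\}$ such that, for all $f$ and $x$, * $\rho(h)f(x)=\xi(h)f(E^{-1}x)$ if $h=\begin{pmatrix}E&0\\0&E^{-T}\end{pmatrix}$ with $E$ invertible; * $\rho(h)f(x)=\xi(h)\,q^2\,\mathbb{E}_{y\in(\mathbf{Z}/q\mathbf{Z})^4}f(y)e_q(x^Ty)$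 if $h=\begin{pmatrix}0&I\\-I&0\end{pmatrix}$; * $\rho(h)f(x)=\xi(h)\,e_q(-\tfrac12x^TWx)f(x)$ if $h=\begin{pmatrix}I&0\\W&I\end{pmatrix}$ with $W$ symmetric. Then there are a number $p_0=p_0(Q)$ and a function $\eta=\eta_Q:\mathbf{N}\to\mathbf{R}$ with $\eta(q)\to0$ as $q\to\infty$ such that the following is true. Let $q$ be squarefree with all prime factors greater than $p_0$. Then $q$ is odd and coprime to $\det b$, and, for every Weil representation $\rho$ of $\mathrm{Sp}_8(\mathbf{Z}/q\mathbf{Z})$, the restriction $\rho|_{\Gamma_q}$ is a direct sum of finitely many irreducible subrepresentations, and every irreducible subrepresentation of $\rho|_{\Gamma_q}$ has dimension at least $q^{1-\eta(q)}$. -/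

import Mathlib

open Filter Topology Matrix
open scoped BigOperators

/-! ### The symplectic group `Sp₈(R)` and the quadratic form -/

/-- `Sp₈(R)`, in `4 + 4` block form: by `SymplecticGroup.fromBlocks_mem_iff` the block matrix
`(A B; C D)` belongs to it iff `Aᵀ C = Cᵀ A`, `Bᵀ D = Dᵀ B` and `Aᵀ D - Cᵀ B = 1`. -/
abbrev Sp8 (R : Type*) [CommRing R] : Type _ := Matrix.symplecticGroup (Fin 4) R

namespace Sp8

variable {R : Type*} [CommRing R]

/-- The diagonal element `s(E) = (E 0; 0 E⁻ᵀ)`. -/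
def s (E : GL (Fin 4) R) : Sp8 R :=
  ⟨fromBlocks (E : Matrix (Fin 4) (Fin 4) R) 0 0
      ((E⁻¹ : GL (Fin 4) R) : Matrix (Fin 4) (Fin 4) R)ᵀ, by
    rw [SymplecticGroup.fromBlocks_mem_iff]
    refine ⟨by simp, by simp, ?_⟩
    rw [← transpose_mul, ← Units.val_mul]
    simp⟩

/-- The element `J = (0 I; -I 0)`. -/
def J (R : Type*) [CommRing R] : Sp8 R :=
  ⟨fromBlocks 0 1 (-1) 0, by
    rw [SymplecticGroup.fromBlocks_mem_iff]
    simp⟩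

/-- The lower triangular element `l(W) = (I 0; W I)`, for symmetric `W`. -/
def l (W : Matrix (Fin 4) (Fin 4) R) (hW : W.IsSymm) : Sp8 R :=
  ⟨fromBlocks 1 0 W 1, by
    rw [SymplecticGroup.fromBlocks_mem_iff]
    simp [hW.eq]⟩

/-- The dilate `g^(r) = (A r⁻¹B; rC D)` of `g = (A B; C D)` by a unit `r`. -/
def dilate (r : Rˣ) (g : Sp8 R) : Sp8 R :=
  ⟨fromBlocks g.1.toBlocks₁₁ (((r⁻¹ : Rˣ) : R) • g.1.toBlocks₁₂)
      ((r : R) • g.1.toBlocks₂₁) g.1.toBlocks₂₂, by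
    have hg := g.2
    rw [← fromBlocks_toBlocks g.1, SymplecticGroup.fromBlocks_mem_iff] at hg
    rw [SymplecticGroup.fromBlocks_mem_iff]
    obtain ⟨h1, h2, h3⟩ := hg
    refine ⟨?_, ?_, ?_⟩
    · simp [h1]
    · simp [h2]
    · simpa [smul_smul] using h3⟩

end Sp8

/-- The quadratic form `Q(x, y) = xᵀ a x + xᵀ b y + yᵀ c y` on `ℤ⁴ × ℤ⁴`, given by its
coefficient matrices, where `a` and `c` are symmetric. -/
structure QuadForm8 where
  a : Matrix (Fin 4) (Fin 4) ℤ
  b : Matrix (Fin 4) (Fin 4) ℤ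
  c : Matrix (Fin 4) (Fin 4) ℤ
  a_symm : a.IsSymm
  c_symm : c.IsSymm

namespace QuadForm8

/-- The value `Q(x, y)`. -/
def eval (Q : QuadForm8) (x y : Fin 4 → ℤ) : ℤ :=
  x ⬝ᵥ (Q.a *ᵥ x) + x ⬝ᵥ (Q.b *ᵥ y) + y ⬝ᵥ (Q.c *ᵥ y)

/-- The coefficient matrix `a` over `R`; similarly `bOver`, `cOver`. -/
abbrev aOver (Q : QuadForm8) (R : Type*) [CommRing R] : Matrix (Fin 4) (Fin 4) R :=
  Q.a.map (Int.cast : ℤ → R)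

abbrev bOver (Q : QuadForm8) (R : Type*) [CommRing R] : Matrix (Fin 4) (Fin 4) R :=
  Q.b.map (Int.cast : ℤ → R)

abbrev cOver (Q : QuadForm8) (R : Type*) [CommRing R] : Matrix (Fin 4) (Fin 4) R :=
  Q.c.map (Int.cast : ℤ → R)

/-- The matrix discriminant `Δ = 4 b⁻¹ a b⁻ᵀ c - I` over `ℚ` (used when `det b ≠ 0`). -/
noncomputable def disc (Q : QuadForm8) : Matrix (Fin 4) (Fin 4) ℚ :=
  (4 : ℚ) • ((Q.bOver ℚ)⁻¹ * Q.aOver ℚ * ((Q.bOver ℚ)⁻¹)ᵀ * Q.cOver ℚ) - 1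

/-- `Q` is generic: `det (ab) ≠ 0`, and `Δ` has four distinct eigenvalues in the algebraic
closure of `ℚ`, none of which is `0` or `-1`. -/
def IsGeneric (Q : QuadForm8) : Prop :=
  (Q.a * Q.b).det ≠ 0 ∧
    ∃ μ : Fin 4 → AlgebraicClosure ℚ, Function.Injective μ ∧
      ∀ i, Module.End.HasEigenvalue
          (Matrix.toLin' (Q.disc.map (algebraMap ℚ (AlgebraicClosure ℚ)))) (μ i) ∧
        μ i ≠ 0 ∧ μ i ≠ -1

/-- The symplectic element `g = (-2b⁻ᵀc  b⁻ᵀ; 4ab⁻ᵀc - b  -2ab⁻ᵀ)` of `Q`, over any commutative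
ring in which `det b` is invertible. -/
noncomputable def symplecticElement (Q : QuadForm8) (R : Type*) [CommRing R]
    (hb : IsUnit ((Q.b.det : ℤ) : R)) : Sp8 R :=
  ⟨fromBlocks (-((2 : R) • (((Q.bOver R)⁻¹)ᵀ * Q.cOver R))) ((Q.bOver R)⁻¹)ᵀ
      ((4 : R) • (Q.aOver R * ((Q.bOver R)⁻¹)ᵀ * Q.cOver R) - Q.bOver R)
      (-((2 : R) • (Q.aOver R * ((Q.bOver R)⁻¹)ᵀ))), by
    have hdet : IsUnit (Q.bOver R).det := by
      have h : (Q.bOver R).det = ((Q.b.det : ℤ) : R) := by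
        simpa using ((Int.castRingHom R).map_det Q.b).symm
      rwa [h]
    have ha : (Q.aOver R)ᵀ = Q.aOver R := by
      rw [aOver, ← Matrix.transpose_map, Q.a_symm.eq]
    have hc : (Q.cOver R)ᵀ = Q.cOver R := by
      rw [cOver, ← Matrix.transpose_map, Q.c_symm.eq]
    have h1 : (Q.bOver R)ᵀ * ((Q.bOver R)⁻¹)ᵀ = 1 := by
      rw [← transpose_mul, Matrix.nonsing_inv_mul _ hdet, transpose_one]
    have h2 : (Q.bOver R)⁻¹ * Q.bOver R = 1 := Matrix.nonsing_inv_mul _ hdet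
    rw [SymplecticGroup.fromBlocks_mem_iff]
    generalize Q.bOver R = b at *
    generalize Q.aOver R = a at *
    generalize Q.cOver R = c at *
    simp only [transpose_neg, transpose_smul, transpose_sub, transpose_mul, transpose_transpose,
      ha, hc, Matrix.mul_sub, Matrix.sub_mul, Matrix.neg_mul, Matrix.mul_neg, Matrix.smul_mul,
      Matrix.mul_smul, Matrix.mul_assoc, h1, h2, mul_one]
    rw [← Matrix.mul_assoc bᵀ, h1, one_mul]
    refine ⟨?_, ?_, ?_⟩
    · module
    · trivial
    · module⟩

/-- `Γ_q`, the subgroup of `Sp₈(ℤ/q)` generated by the elements `(g^(r))⁻¹ g^(s)` with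
`r, s ∈ (ℤ/q)ˣ`. -/
noncomputable def Gam (Q : QuadForm8) (q : ℕ) (hb : IsUnit ((Q.b.det : ℤ) : ZMod q)) :
    Subgroup (Sp8 (ZMod q)) :=
  Subgroup.closure {x | ∃ r s : (ZMod q)ˣ,
    x = (Sp8.dilate r (Q.symplecticElement (ZMod q) hb))⁻¹ *
      Sp8.dilate s (Q.symplecticElement (ZMod q) hb)}

end QuadForm8

/-! ### The Weil representation -/

/-- The space `ℓ²((ℤ/q)⁴)` of all functions `(ℤ/q)⁴ → ℂ`. -/
abbrev L2 (q : ℕ) : Type := (Fin 4 → ZMod q) → ℂ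

/-- The normalised inner product `𝔼ₓ f₁(x) conj(f₂(x))` of `ℓ²((ℤ/q)⁴)`. -/
noncomputable def L2.innerAvg {q : ℕ} [NeZero q] (f₁ f₂ : L2 q) : ℂ :=
  𝔼 x, f₁ x * (starRingEnd ℂ) (f₂ x)

/-- `ρ` is the Weil representation of `Sp₈(ℤ/q)` on `ℓ²((ℤ/q)⁴)` (`q` odd): a unitary
representation which acts on the elements `s(E)`, `J` and `l(W)`, up to a phase `ξ`, by dilation,
Fourier transform and quadratic modulation. Here `ZMod.stdAddChar t = e_q(t) = exp(2πit/q)`, and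
`2⁻¹` is the inverse modulo `q`. Such a `ρ` exists for every odd `q`, see
`exists_isWeilRepresentation`. -/
structure IsWeilRepresentation {q : ℕ} [NeZero q]
    (ρ : Representation ℂ (Sp8 (ZMod q)) (L2 q)) : Prop where
  unitary : ∀ (g : Sp8 (ZMod q)) (f₁ f₂ : L2 q),
    L2.innerAvg (ρ g f₁) (ρ g f₂) = L2.innerAvg f₁ f₂
  formulas : ∃ ξ : Sp8 (ZMod q) → ℂ, (∀ g, ‖ξ g‖ = 1) ∧
    (∀ (E : GL (Fin 4) (ZMod q)) (f : L2 q) (x : Fin 4 → ZMod q),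
      ρ (Sp8.s E) f x = ξ (Sp8.s E) *
        f (((E⁻¹ : GL (Fin 4) (ZMod q)) : Matrix (Fin 4) (Fin 4) (ZMod q)) *ᵥ x)) ∧
    (∀ (f : L2 q) (x : Fin 4 → ZMod q),
      ρ (Sp8.J (ZMod q)) f x = ξ (Sp8.J (ZMod q)) *
        ((q : ℂ) ^ 2 * 𝔼 y, f y * ZMod.stdAddChar (x ⬝ᵥ y))) ∧
    (∀ (W : Matrix (Fin 4) (Fin 4) (ZMod q)) (hW : W.IsSymm) (f : L2 q) (x : Fin 4 → ZMod q),
      ρ (Sp8.l W hW) f x = ξ (Sp8.l W hW) *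
        (ZMod.stdAddChar (-(2⁻¹ * (x ⬝ᵥ (W *ᵥ x)))) * f x))

/-! ### Existence of the Weil representation

What follows proves that the previous definition is satisfiable, for every odd `q`. The
operators are the intertwiners of the Heisenberg representation, normalised to have equal
determinants on even and on odd functions. -/

namespace WeilExistence

set_option linter.unusedSimpArgs false
set_option linter.unusedSectionVars false

variable {q : ℕ} [NeZero q]

/-- Operators on `ℓ²((ℤ/q)⁴)`, as matrices. -/
abbrev Op (q : ℕ) : Type := Matrix (Fin 4 → ZMod q) (Fin 4 → ZMod q) ℂ

/-- The Heisenberg operator `f ↦ e_q(w·x + u·w/2) f(x + u)`, for `v = (u, w)`. -/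
noncomputable def H (v : Fin 4 ⊕ Fin 4 → ZMod q) : Op q :=
  Matrix.of fun x y => if y = x + v ∘ Sum.inl then
    ZMod.stdAddChar ((v ∘ Sum.inr) ⬝ᵥ x + 2⁻¹ * ((v ∘ Sum.inl) ⬝ᵥ (v ∘ Sum.inr))) else 0

lemma two_half (hq : Odd q) : (2 : ZMod q) * 2⁻¹ = 1 := by
  have := ZMod.coe_mul_inv_eq_one (n := q) 2 (Nat.coprime_two_left.mpr hq)
  simpa using this

lemma H_mul (hq : Odd q) (v v' : Fin 4 ⊕ Fin 4 → ZMod q) :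
    H v * H v' = (ZMod.stdAddChar (2⁻¹ * (v ⬝ᵥ ((Sp8.J (ZMod q)).1 *ᵥ v'))) : ℂ) • H (v + v') := by
  have h2 := two_half hq
  ext x y
  rw [Matrix.mul_apply, Finset.sum_eq_single (x + v ∘ Sum.inl)
    (fun z _ hz => by rw [H, Matrix.of_apply, if_neg hz, zero_mul]) (by simp)]
  simp only [H, Matrix.of_apply, if_true, Matrix.smul_apply, smul_eq_mul, mul_ite, mul_zero]
  have e : x + v ∘ Sum.inl + v' ∘ Sum.inl = x + (v + v') ∘ Sum.inl := by
    ext i; simp [add_assoc]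
  rw [e]
  split_ifs with hy
  · rw [← AddChar.map_add_eq_mul, ← AddChar.map_add_eq_mul]
    congr 1
    simp only [Sp8.J, Matrix.fromBlocks_mulVec, dotProduct, Fintype.sum_sum_type, Sum.elim_inl,
      Sum.elim_inr, Matrix.zero_mulVec, Matrix.one_mulVec, Matrix.neg_mulVec, Pi.add_apply,
      Pi.zero_apply, Pi.neg_apply, Function.comp_apply, Finset.mul_sum, ← Finset.sum_add_distrib,
      zero_add, add_zero]
    refine Finset.sum_congr rfl fun i _ => ?_
    linear_combination (v' (Sum.inr i) * v (Sum.inl i)) * (-h2)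
  · rfl

lemma H_zero : H (0 : Fin 4 ⊕ Fin 4 → ZMod q) = 1 := by
  ext x y
  have h1 : (0 : Fin 4 ⊕ Fin 4 → ZMod q) ∘ Sum.inl = 0 := rfl
  have h2 : (0 : Fin 4 ⊕ Fin 4 → ZMod q) ∘ Sum.inr = 0 := rfl
  simp [H, Matrix.one_apply, h1, h2, eq_comm]

lemma form_self (v : Fin 4 ⊕ Fin 4 → ZMod q) : v ⬝ᵥ ((Sp8.J (ZMod q)).1 *ᵥ v) = 0 := by
  simp only [Sp8.J, Matrix.fromBlocks_mulVec, dotProduct, Fintype.sum_sum_type, Sum.elim_inl,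
      Sum.elim_inr, Matrix.zero_mulVec, Matrix.one_mulVec, Matrix.neg_mulVec, Pi.add_apply,
      Pi.zero_apply, Pi.neg_apply, Function.comp_apply,
      zero_add, add_zero, ← Finset.sum_add_distrib]
  exact Finset.sum_eq_zero fun i _ => by ring

lemma H_mul_neg (hq : Odd q) (v : Fin 4 ⊕ Fin 4 → ZMod q) : H v * H (-v) = 1 := by
  rw [H_mul hq, Matrix.mulVec_neg, dotProduct_neg, form_self]
  simp [H_zero]

lemma H_conjTranspose (v : Fin 4 ⊕ Fin 4 → ZMod q) (hq : Odd q) : (H v)ᴴ = H (-v) := by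
  have h2 := two_half hq
  ext x y
  simp only [H, Matrix.conjTranspose_apply, Matrix.of_apply]
  have e : x = y + v ∘ Sum.inl ↔ y = x + (-v) ∘ Sum.inl := by
    have : (-v) ∘ Sum.inl = -(v ∘ Sum.inl) := rfl
    rw [this, ← sub_eq_add_neg, eq_sub_iff_add_eq, eq_comm]
  by_cases hx : x = y + v ∘ Sum.inl
  · rw [if_pos hx, if_pos (e.1 hx)]
    rw [← starRingEnd_apply, ← AddChar.map_neg_eq_conj]
    congr 1
    rw [hx]
    simp only [dotProduct, Pi.add_apply,
      Pi.neg_apply, Function.comp_apply, Finset.mul_sum, ← Finset.sum_add_distrib,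
      ← Finset.sum_neg_distrib]
    refine Finset.sum_congr rfl fun i _ => ?_
    linear_combination (v (Sum.inr i) * v (Sum.inl i)) * (-h2)
  · rw [if_neg hx, if_neg (fun h => hx (e.2 h))]
    simp

lemma trace_H (v : Fin 4 ⊕ Fin 4 → ZMod q) :
    (H v).trace = if v = 0 then ((q : ℂ) ^ 4) else 0 := by
  split_ifs with hv
  · rw [hv, H_zero, Matrix.trace_one]
    simp [ZMod.card]
  · by_cases hu : v ∘ Sum.inl = 0
    · have hw : v ∘ Sum.inr ≠ 0 := by
        intro hw
        apply hv
        ext (i | i)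
        · exact congrFun hu i
        · exact congrFun hw i
      simp only [H, Matrix.trace, Matrix.diag_apply, Matrix.of_apply, hu, add_zero, if_true,
        zero_dotProduct, mul_zero]
      let ψ : AddChar (Fin 4 → ZMod q) ℂ :=
        (ZMod.stdAddChar (N := q)).compAddMonoidHom
          (AddMonoidHom.mk' (fun x => (v ∘ Sum.inr) ⬝ᵥ x) (fun x y => dotProduct_add _ x y))
      have hψ : ψ ≠ 0 := by
        intro h0
        apply hw
        ext i
        have h1 : ψ (Pi.single i 1) = 1 := by rw [h0]; simp
        have h3 : (ZMod.stdAddChar (N := q)) ((v ∘ Sum.inr) ⬝ᵥ (Pi.single i 1)) =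
          ZMod.stdAddChar (N := q) 0 := by
            rw [AddChar.map_zero_eq_one]; exact h1
        have h4 := ZMod.injective_stdAddChar h3
        simpa using h4
      exact (AddChar.sum_eq_zero_iff_ne_zero (ψ := ψ)).2 hψ
    · simp only [H, Matrix.trace, Matrix.diag_apply, Matrix.of_apply]
      refine Finset.sum_eq_zero fun x _ => if_neg ?_
      intro h
      exact hu (by simpa using h)

/-- `X` commutes with all Heisenberg operators only if it is a scalar. -/
lemma scalar_of_commute (X : Op q)
    (hX : ∀ v, H v * X = X * H v) : X = (X 0 0) • (1 : Op q) := by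
  have hdiag : ∀ x y, x ≠ y → X x y = 0 := by
    intro x y hxy
    obtain ⟨i, hi⟩ := Function.ne_iff.1 hxy
    have h := congrFun (congrFun (hX (Sum.elim 0 (Pi.single i 1))) x) y
    simp only [H, Matrix.mul_apply, Matrix.of_apply, Sum.elim_comp_inl, Sum.elim_comp_inr,
      add_zero, zero_dotProduct, mul_zero, ite_mul, zero_mul, mul_ite, Finset.sum_ite_eq,
      Finset.sum_ite_eq', Finset.mem_univ, if_true, single_dotProduct, one_mul] at h
    by_contra hne
    rw [mul_comm] at h
    exact hi (ZMod.injective_stdAddChar (mul_left_cancel₀ hne h))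
  have hconst : ∀ x, X x x = X 0 0 := by
    intro x
    have h := congrFun (congrFun (hX (Sum.elim x 0)) 0) x
    simp only [H, Matrix.mul_apply, Matrix.of_apply, Sum.elim_comp_inl, Sum.elim_comp_inr,
      zero_dotProduct, dotProduct_zero, mul_zero, ite_mul, zero_mul, mul_ite, Finset.sum_ite_eq,
      Finset.sum_ite_eq', Finset.mem_univ, if_true, zero_add, add_zero, AddChar.map_zero_eq_one,
      one_mul, mul_one] at h
    rw [h]
    rw [Finset.sum_eq_single 0]
    · simp
    · intro y _ hy
      rw [if_neg]
      intro h'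
      apply hy
      simpa using h'
    · simp
  ext x y
  by_cases hxy : x = y
  · subst hxy
    simp [hconst]
  · simp [hxy, hdiag x y hxy]

/-- `U` intertwines `v ↦ H v` with `v ↦ H (g v)`. -/
def Intw (g : Sp8 (ZMod q)) (U : Op q) : Prop :=
  ∀ v, H (g.1 *ᵥ v) * U = U * H v

lemma form_inv (g : Sp8 (ZMod q)) (v v' : Fin 4 ⊕ Fin 4 → ZMod q) :
    (g.1 *ᵥ v) ⬝ᵥ ((Sp8.J (ZMod q)).1 *ᵥ (g.1 *ᵥ v')) = v ⬝ᵥ ((Sp8.J (ZMod q)).1 *ᵥ v') := by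
  have hJ : (Sp8.J (ZMod q)).1 = -Matrix.J (Fin 4) (ZMod q) := by
    simp [Sp8.J, Matrix.J, Matrix.fromBlocks_neg]
  have h := SymplecticGroup.mem_iff'.1 g.2
  have hK : g.1ᵀ * (Sp8.J (ZMod q)).1 * g.1 = (Sp8.J (ZMod q)).1 := by
    rw [hJ, Matrix.mul_neg, Matrix.neg_mul, h]
  conv_rhs => rw [← hK, ← Matrix.mulVec_mulVec, ← Matrix.mulVec_mulVec, Matrix.dotProduct_mulVec,
    Matrix.vecMul_transpose]

/-- The averaging construction of an intertwiner, from an arbitrary operator `A`. -/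
noncomputable def avg (g : Sp8 (ZMod q)) (A : Op q) : Op q :=
  ∑ v, H (g.1 *ᵥ v) * A * H (-v)

lemma avg_intw (hq : Odd q) (g : Sp8 (ZMod q)) (A : Op q) : Intw g (avg g A) := by
  intro v
  have key : ∀ v', H (g.1 *ᵥ v) * (H (g.1 *ᵥ v') * A * H (-v')) * H (-v) =
      H (g.1 *ᵥ (v + v')) * A * H (-(v + v')) := by
    intro v'
    have h1 : H (g.1 *ᵥ v) * (H (g.1 *ᵥ v') * A * H (-v')) * H (-v) =
        (H (g.1 *ᵥ v) * H (g.1 *ᵥ v')) * A * (H (-v') * H (-v)) := by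
      simp only [Matrix.mul_assoc]
    rw [h1, H_mul hq, H_mul hq, form_inv, Matrix.mulVec_neg, dotProduct_neg, neg_dotProduct,
      neg_neg, ← Matrix.mulVec_add]
    have h3 : v' ⬝ᵥ ((Sp8.J (ZMod q)).1 *ᵥ v) = - (v ⬝ᵥ ((Sp8.J (ZMod q)).1 *ᵥ v')) := by
      have := form_self (v + v')
      rw [Matrix.mulVec_add, dotProduct_add, add_dotProduct, add_dotProduct, form_self,
        form_self] at this
      linear_combination this
    rw [h3]
    simp only [Matrix.smul_mul, Matrix.mul_smul, smul_smul]
    rw [← AddChar.map_add_eq_mul]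
    have h4 : -v' + -v = -(v + v') := by abel
    have h5 : 2⁻¹ * -(v ⬝ᵥ ((Sp8.J (ZMod q)).1 *ᵥ v')) +
      2⁻¹ * (v ⬝ᵥ ((Sp8.J (ZMod q)).1 *ᵥ v')) = 0 := by ring
    rw [h4]
    simp [h5]
  have h6 : H (g.1 *ᵥ v) * avg g A * H (-v) = avg g A := by
    rw [avg, Finset.mul_sum, Finset.sum_mul, Finset.sum_congr rfl fun v' _ => key v']
    exact Fintype.sum_equiv (Equiv.addLeft v) _ _ fun v' => rfl
  have h7 : H (-v) * H v = 1 := by simpa using H_mul_neg hq (-v)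
  calc H (g.1 *ᵥ v) * avg g A = H (g.1 *ᵥ v) * avg g A * (H (-v) * H v) := by rw [h7, mul_one]
    _ = (H (g.1 *ᵥ v) * avg g A * H (-v)) * H v := by simp only [Matrix.mul_assoc]
    _ = _ := by rw [h6]

lemma Intw.mul {g h : Sp8 (ZMod q)} {U V : Op q} (hU : Intw g U) (hV : Intw h V) :
    Intw (g * h) (U * V) := by
  intro v
  have : (g * h).1 *ᵥ v = g.1 *ᵥ (h.1 *ᵥ v) := by simp [Matrix.mulVec_mulVec]
  rw [this, ← Matrix.mul_assoc, hU, Matrix.mul_assoc, hV, Matrix.mul_assoc]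

lemma Intw.star_mul (hq : Odd q) {g : Sp8 (ZMod q)} {U V : Op q} (hU : Intw g U)
    (hV : Intw g V) : ∀ v, H v * (Uᴴ * V) = (Uᴴ * V) * H v := by
  intro v
  have h1 := congrArg Matrix.conjTranspose (hU (-v))
  rw [Matrix.conjTranspose_mul, Matrix.conjTranspose_mul, H_conjTranspose _ hq,
    H_conjTranspose _ hq, Matrix.mulVec_neg, neg_neg, neg_neg] at h1
  rw [← Matrix.mul_assoc, ← h1, Matrix.mul_assoc, hV, Matrix.mul_assoc]

lemma exists_intw_ne_zero (hq : Odd q) (g : Sp8 (ZMod q)) : ∃ U : Op q, Intw g U ∧ U ≠ 0 := by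
  by_contra! hcon
  have h0 : ∀ A : Op q, avg g A = 0 := fun A => hcon _ (avg_intw hq g A)
  have hg : ∀ v, g.1 *ᵥ v = 0 ↔ v = 0 := by
    intro v
    constructor
    · intro h
      have h1 : (g⁻¹ * g).1 *ᵥ v = g⁻¹.1 *ᵥ (g.1 *ᵥ v) := by
        rw [Matrix.mulVec_mulVec]; rfl
      rw [h, inv_mul_cancel] at h1
      simpa using h1
    · rintro rfl; simp
  have h1 : ∑ i, (avg g (Matrix.single i (0 : Fin 4 → ZMod q) (1 : ℂ))) i 0 = (q : ℂ) ^ 4 := by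
    have h2 : ∀ i, (avg g (Matrix.single i (0 : Fin 4 → ZMod q) (1 : ℂ))) i 0 =
        ∑ v, H (g.1 *ᵥ v) i i * H (-v) 0 0 := by
      intro i
      rw [avg, Matrix.sum_apply]
      refine Finset.sum_congr rfl fun v _ => ?_
      rw [Matrix.mul_apply, Finset.sum_eq_single 0]
      · simp
      · intro b _ hb
        rw [Matrix.mul_single_apply_of_ne (hbj := hb), zero_mul]
      · simp
    simp only [h2]
    rw [Finset.sum_comm]
    have h3 : ∀ v : Fin 4 ⊕ Fin 4 → ZMod q, ∑ i, H (g.1 *ᵥ v) i i * H (-v) 0 0 =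
        if v = 0 then (q : ℂ) ^ 4 else 0 := by
      intro v
      rw [← Finset.sum_mul]
      have := trace_H (g.1 *ᵥ v)
      rw [Matrix.trace] at this
      simp only [Matrix.diag_apply] at this
      rw [this]
      simp only [hg]
      split_ifs with hv
      · subst hv
        simp [H_zero]
      · simp
    simp [h3]
  simp only [h0, Matrix.zero_apply, Finset.sum_const_zero] at h1
  exact pow_ne_zero 4 (NeZero.ne (q : ℂ)) h1.symm

open scoped ComplexOrder in
/-- The scalar in Schur's lemma for `Uᴴ U`, and unitary normalisation. -/
lemma exists_intw_unitary (hq : Odd q) (g : Sp8 (ZMod q)) :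
    ∃ U : Op q, Intw g U ∧ Uᴴ * U = 1 := by
  obtain ⟨U, hU, hne⟩ := exists_intw_ne_zero hq g
  have hs := scalar_of_commute _ (hU.star_mul hq hU)
  set c : ℂ := (Uᴴ * U) 0 0 with hc
  have hc' : c = ((∑ x, ‖U x 0‖ ^ 2 : ℝ) : ℂ) := by
    rw [hc, Matrix.mul_apply]
    push_cast
    refine Finset.sum_congr rfl fun x _ => ?_
    rw [Matrix.conjTranspose_apply, ← starRingEnd_apply, Complex.conj_mul']
  set t : ℝ := ∑ x, ‖U x 0‖ ^ 2 with ht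
  have ht0 : 0 ≤ t := Finset.sum_nonneg fun _ _ => by positivity
  have htne : t ≠ 0 := by
    intro h
    apply hne
    rw [hc', h] at hs
    apply Matrix.conjTranspose_mul_self_eq_zero.1
    simpa using hs
  refine ⟨((Real.sqrt t)⁻¹ : ℂ) • U, ?_, ?_⟩
  · intro v
    rw [Matrix.mul_smul, hU v, Matrix.smul_mul]
  · rw [Matrix.conjTranspose_smul, Matrix.smul_mul, Matrix.mul_smul, smul_smul, hs, hc', smul_smul]
    have : (star ((Real.sqrt t)⁻¹ : ℂ) * ((Real.sqrt t)⁻¹ : ℂ) * (t : ℂ)) = 1 := by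
      rw [← Complex.ofReal_inv, ← starRingEnd_apply, Complex.conj_ofReal]
      norm_cast
      rw [← mul_inv, Real.mul_self_sqrt ht0, inv_mul_cancel₀ htne]
    rw [this, one_smul]

lemma Intw.unique (hq : Odd q) {g : Sp8 (ZMod q)} {U V : Op q} (hU : Intw g U)
    (hUu : Uᴴ * U = 1) (hV : Intw g V) : ∃ c : ℂ, V = c • U := by
  have hs := scalar_of_commute _ (hU.star_mul hq hV)
  refine ⟨(Uᴴ * V) 0 0, ?_⟩
  have h1 : U * (Uᴴ * V) = V := by
    rw [← Matrix.mul_assoc, mul_eq_one_comm.1 hUu, one_mul]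
  rw [hs, Matrix.mul_smul, mul_one] at h1
  exact h1.symm

/-- The parity operator `f(x) ↦ f(-x)`. -/
def P : Op q := Matrix.of fun x y => if y = -x then 1 else 0

lemma P_mul_P : (P : Op q) * P = 1 := by
  ext x y
  rw [Matrix.mul_apply, Finset.sum_eq_single (-x) (fun z _ hz => by simp [P, hz]) (by simp)]
  simp [P, Matrix.one_apply, eq_comm]

lemma P_herm : (P : Op q)ᴴ = P := by
  ext x y
  have : x = -y ↔ y = -x := by constructor <;> (rintro rfl; simp)
  simp only [P, Matrix.conjTranspose_apply, Matrix.of_apply, this]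
  split_ifs <;> simp

lemma P_trace (hq : Odd q) : (P : Op q).trace = 1 := by
  have h2 := two_half hq
  have : ∀ x : Fin 4 → ZMod q, x = -x ↔ x = 0 := by
    intro x
    constructor
    · intro h
      ext i
      have hi : x i = - x i := congrFun h i
      have : x i = 0 := by linear_combination (2⁻¹ : ZMod q) * hi - x i * h2
      simpa using this
    · rintro rfl; simp
  simp [Matrix.trace, P, this]

lemma P_mul_H (v : Fin 4 ⊕ Fin 4 → ZMod q) : P * H v = H (-v) * P := by
  ext x y
  rw [Matrix.mul_apply, Finset.sum_eq_single (-x) (fun z _ hz => by simp [P, hz]) (by simp)]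
  rw [Matrix.mul_apply, Finset.sum_eq_single (x + (-v) ∘ Sum.inl)
    (fun z _ hz => by simp [H, hz]) (by simp)]
  have e1 : (-v) ∘ Sum.inl = -(v ∘ Sum.inl) := rfl
  have e2 : (-v) ∘ Sum.inr = -(v ∘ Sum.inr) := rfl
  have e3 : -(x + -(v ∘ Sum.inl)) = -x + v ∘ Sum.inl := by abel
  simp only [P, H, Matrix.of_apply, if_true, one_mul, e1, e2, e3, mul_ite, mul_one, mul_zero,
    neg_dotProduct, dotProduct_neg, neg_neg]

lemma Intw.comm_P (hq : Odd q) {g : Sp8 (ZMod q)} {U : Op q} (hU : Intw g U)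
    (hUu : Uᴴ * U = 1) : U * P = P * U := by
  have h1 : Intw g (P * U * P) := by
    intro v
    have hP : ∀ w : Fin 4 ⊕ Fin 4 → ZMod q, H w * P = P * H (-w) := by
      intro w; rw [P_mul_H, neg_neg]
    calc H (g.1 *ᵥ v) * (P * U * P) = (H (g.1 *ᵥ v) * P) * U * P := by
          simp only [Matrix.mul_assoc]
      _ = P * (H (g.1 *ᵥ (-v)) * U) * P := by
          rw [hP, Matrix.mulVec_neg]; simp only [Matrix.mul_assoc]
      _ = P * U * (H (-v) * P) := by rw [hU]; simp only [Matrix.mul_assoc]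
      _ = P * U * P * H v := by rw [hP, neg_neg]; simp only [Matrix.mul_assoc]
  obtain ⟨c, hc⟩ := hU.unique hq hUu h1
  have h2 : U * P = c • (P * U) := by
    calc U * P = P * (P * U * P) := by
          rw [← Matrix.mul_assoc, ← Matrix.mul_assoc, P_mul_P, one_mul]
      _ = _ := by rw [hc, Matrix.mul_smul]
  have h3 : U * P * Uᴴ = c • P := by
    rw [h2, Matrix.smul_mul, Matrix.mul_assoc, mul_eq_one_comm.1 hUu, mul_one]
  have h4 := congrArg Matrix.trace h3
  rw [Matrix.trace_mul_comm, ← Matrix.mul_assoc, hUu, one_mul, Matrix.trace_smul, P_trace hq,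
    smul_eq_mul, mul_one] at h4
  rw [h2, ← h4, one_smul]

/-- Projections to even and odd functions. -/
noncomputable def Pe : Op q := (2⁻¹ : ℂ) • (1 + P)
noncomputable def Po : Op q := (2⁻¹ : ℂ) • (1 - P)

lemma Pe_Pe : (Pe : Op q) * Pe = Pe := by
  simp only [Pe, Matrix.smul_mul, Matrix.mul_smul, Matrix.mul_add, Matrix.add_mul, P_mul_P,
    one_mul, mul_one]
  module

lemma Po_Po : (Po : Op q) * Po = Po := by
  simp only [Po, Matrix.smul_mul, Matrix.mul_smul, Matrix.mul_sub, Matrix.sub_mul, P_mul_P,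
    one_mul, mul_one]
  module

lemma Pe_Po : (Pe : Op q) * Po = 0 := by
  simp only [Po, Pe, Matrix.smul_mul, Matrix.mul_smul, Matrix.mul_sub, Matrix.add_mul, P_mul_P,
    one_mul, mul_one]
  module

lemma Po_Pe : (Po : Op q) * Pe = 0 := by
  simp only [Po, Pe, Matrix.smul_mul, Matrix.mul_smul, Matrix.mul_add, Matrix.sub_mul, P_mul_P,
    one_mul, mul_one]
  module

lemma Pe_add_Po : (Pe : Op q) + Po = 1 := by
  simp only [Po, Pe]
  module

lemma Pe_herm : (Pe : Op q)ᴴ = Pe := by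
  simp [Pe, Matrix.conjTranspose_smul, P_herm]

lemma Po_herm : (Po : Op q)ᴴ = Po := by
  simp [Po, Matrix.conjTranspose_smul, P_herm]

/-- Determinants of (the restrictions of) `U` on even and odd functions. -/
noncomputable def De (U : Op q) : ℂ := (U * Pe + Po).det
noncomputable def Do (U : Op q) : ℂ := (U * Po + Pe).det

lemma comm_Pe {U : Op q} (h : U * P = P * U) : Pe * U = U * Pe := by
  simp [Pe, Matrix.mul_add, Matrix.add_mul, h]

lemma comm_Po {U : Op q} (h : U * P = P * U) : Po * U = U * Po := by
  simp [Po, Matrix.mul_sub, Matrix.sub_mul, h]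

lemma De_mul {U V : Op q} (hV : V * P = P * V) :
    De (U * V) = De U * De V := by
  rw [De, De, De, ← Matrix.det_mul]
  congr 1
  have h1 : U * Pe * (V * Pe) = U * V * Pe := by
    rw [Matrix.mul_assoc, ← Matrix.mul_assoc Pe, comm_Pe hV, Matrix.mul_assoc V, Pe_Pe,
      Matrix.mul_assoc]
  have h2 : Po * (V * Pe) = 0 := by
    rw [← Matrix.mul_assoc, comm_Po hV, Matrix.mul_assoc, Po_Pe, mul_zero]
  have h3 : U * Pe * Po = 0 := by rw [Matrix.mul_assoc, Pe_Po, mul_zero]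
  rw [Matrix.add_mul, Matrix.mul_add, Matrix.mul_add, h1, h2, h3, Po_Po, add_zero, zero_add]

lemma Do_mul {U V : Op q} (hV : V * P = P * V) :
    Do (U * V) = Do U * Do V := by
  rw [Do, Do, Do, ← Matrix.det_mul]
  congr 1
  have h1 : U * Po * (V * Po) = U * V * Po := by
    rw [Matrix.mul_assoc, ← Matrix.mul_assoc Po, comm_Po hV, Matrix.mul_assoc V, Po_Po,
      Matrix.mul_assoc]
  have h2 : Pe * (V * Po) = 0 := by
    rw [← Matrix.mul_assoc, comm_Pe hV, Matrix.mul_assoc, Pe_Po, mul_zero]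
  have h3 : U * Po * Pe = 0 := by rw [Matrix.mul_assoc, Po_Pe, mul_zero]
  rw [Matrix.add_mul, Matrix.mul_add, Matrix.mul_add, h1, h2, h3, Pe_Pe, add_zero, zero_add]

lemma norm_De {U : Op q} (hU : U * P = P * U) (hUu : Uᴴ * U = 1) : ‖De U‖ = 1 := by
  have hPU : P * Uᴴ = Uᴴ * P := by
    have := congrArg Matrix.conjTranspose hU
    simpa [Matrix.conjTranspose_mul, P_herm] using this
  have h1 : De Uᴴ = star (De U) := by
    rw [De, De, ← Matrix.det_conjTranspose]
    congr 1
    rw [Matrix.conjTranspose_add, Matrix.conjTranspose_mul, Pe_herm, Po_herm, comm_Pe hPU.symm]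
  have h2 : De (1 : Op q) = 1 := by rw [De, one_mul, Pe_add_Po, Matrix.det_one]
  have h3 := De_mul (U := Uᴴ) hU
  rw [hUu, h2, h1, ← starRingEnd_apply, Complex.conj_mul'] at h3
  have h4 : ‖De U‖ ^ 2 = 1 := by exact_mod_cast h3.symm
  exact (pow_eq_one_iff_of_nonneg (norm_nonneg _) two_ne_zero).1 h4

lemma norm_Do {U : Op q} (hU : U * P = P * U) (hUu : Uᴴ * U = 1) : ‖Do U‖ = 1 := by
  have hPU : P * Uᴴ = Uᴴ * P := by
    have := congrArg Matrix.conjTranspose hU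
    simpa [Matrix.conjTranspose_mul, P_herm] using this
  have h1 : Do Uᴴ = star (Do U) := by
    rw [Do, Do, ← Matrix.det_conjTranspose]
    congr 1
    rw [Matrix.conjTranspose_add, Matrix.conjTranspose_mul, Pe_herm, Po_herm, comm_Po hPU.symm]
  have h2 : Do (1 : Op q) = 1 := by rw [Do, one_mul, add_comm, Pe_add_Po, Matrix.det_one]
  have h3 := Do_mul (U := Uᴴ) hU
  rw [hUu, h2, h1, ← starRingEnd_apply, Complex.conj_mul'] at h3
  have h4 : ‖Do U‖ ^ 2 = 1 := by exact_mod_cast h3.symm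
  exact (pow_eq_one_iff_of_nonneg (norm_nonneg _) two_ne_zero).1 h4

/-- Even functions have dimension one more than odd ones. -/
lemma De_smul_one (hq : Odd q) (c : ℂ) :
    De (c • (1 : Op q)) = c * Do (c • (1 : Op q)) := by
  classical
  have hH : (P : Op q).IsHermitian := P_herm
  set V : Op q := (hH.eigenvectorUnitary : Op q) with hV
  set ε : (Fin 4 → ZMod q) → ℝ := hH.eigenvalues with hε
  have hVV : Vᴴ * V = 1 := by
    simpa [Matrix.star_eq_conjTranspose] using
      Unitary.coe_star_mul_self hH.eigenvectorUnitary
  have hVV' : V * Vᴴ = 1 := mul_eq_one_comm.1 hVV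
  have hsp : (P : Op q) = V * Matrix.diagonal (fun i => (ε i : ℂ)) * Vᴴ := by
    have := hH.spectral_theorem
    simpa [Unitary.conjStarAlgAut_apply, Matrix.star_eq_conjTranspose, Function.comp_def]
      using this
  have hdet : ∀ α β : ℂ, (α • (1 : Op q) + β • P).det = ∏ i, (α + β * ε i) := by
    intro α β
    have : α • (1 : Op q) + β • P =
        V * Matrix.diagonal (fun i => α + β * (ε i : ℂ)) * Vᴴ := by
      have hd : Matrix.diagonal (fun i => α + β * (ε i : ℂ)) =
          α • (1 : Op q) + β • Matrix.diagonal (fun i => (ε i : ℂ)) := by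
        ext i j
        by_cases hij : i = j
        · subst hij; simp
        · simp [hij]
      rw [hd, Matrix.mul_add, Matrix.add_mul, Matrix.mul_smul, Matrix.mul_smul, Matrix.smul_mul,
        Matrix.smul_mul, mul_one, hVV', ← hsp]
    rw [this, Matrix.det_mul_right_comm, hVV', one_mul, Matrix.det_diagonal]
  have hsq : ∀ i, ε i = 1 ∨ ε i = -1 := by
    intro i
    have h1 : Matrix.diagonal (fun i => (ε i : ℂ)) * Matrix.diagonal (fun i => (ε i : ℂ)) =
        (1 : Op q) := by
      have h2 : Matrix.diagonal (fun i => (ε i : ℂ)) = Vᴴ * P * V := by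
        rw [hsp]
        simp only [← Matrix.mul_assoc, hVV, one_mul]
        rw [Matrix.mul_assoc, hVV, mul_one]
      rw [h2]
      calc Vᴴ * P * V * (Vᴴ * P * V) = Vᴴ * P * (V * Vᴴ) * P * V := by
            simp only [Matrix.mul_assoc]
        _ = Vᴴ * (P * P) * V := by rw [hVV', mul_one]; simp only [Matrix.mul_assoc]
        _ = 1 := by rw [P_mul_P, mul_one, hVV]
    have h3 := congrFun (congrFun h1 i) i
    rw [Matrix.diagonal_mul_diagonal, Matrix.diagonal_apply_eq, Matrix.one_apply_eq] at h3
    have h4 : ε i * ε i = 1 := by exact_mod_cast h3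
    exact mul_self_eq_one_iff.1 h4
  have htr : ∑ i, ε i = 1 := by
    have h1 : (P : Op q).trace = ∑ i, (ε i : ℂ) := hH.trace_eq_sum_eigenvalues
    rw [P_trace hq] at h1
    exact_mod_cast h1.symm
  set S := Finset.univ.filter (fun i => ε i = 1) with hS
  have hcard : S.card = (Finset.univ.filter (fun i => ¬ ε i = 1)).card + 1 := by
    have h1 : ∑ i, ε i = (S.card : ℝ) - (Finset.univ.filter (fun i => ¬ ε i = 1)).card := by
      rw [← Finset.sum_filter_add_sum_filter_not Finset.univ (fun i => ε i = 1)]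
      rw [Finset.sum_congr rfl (g := fun _ => (1 : ℝ))
        (fun i hi => (Finset.mem_filter.1 hi).2)]
      rw [Finset.sum_congr (s₁ := Finset.univ.filter (fun i => ¬ ε i = 1)) rfl
        (g := fun _ => (-1 : ℝ))
        (fun i hi => (hsq i).resolve_left (Finset.mem_filter.1 hi).2)]
      simp [sub_eq_add_neg, hS]
    rw [htr] at h1
    have h2 : (S.card : ℝ) = (Finset.univ.filter (fun i => ¬ ε i = 1)).card + 1 := by linarith
    exact_mod_cast h2
  have hDe : De (c • (1 : Op q)) = c ^ S.card := by
    have e1 : c • (1 : Op q) * Pe + Po = ((c + 1) / 2) • (1 : Op q) + ((c - 1) / 2) • P := by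
      simp only [Pe, Po, Matrix.smul_mul, one_mul]
      module
    rw [De, e1, hdet, ← Finset.prod_filter_mul_prod_filter_not Finset.univ (fun i => ε i = 1)]
    rw [Finset.prod_congr rfl (g := fun _ => c)
      (fun i hi => by rw [(Finset.mem_filter.1 hi).2]; push_cast; ring)]
    rw [Finset.prod_congr (s₁ := Finset.univ.filter (fun i => ¬ ε i = 1)) rfl
      (g := fun _ => (1 : ℂ))
      (fun i hi => by rw [(hsq i).resolve_left (Finset.mem_filter.1 hi).2]; push_cast; ring)]
    simp [hS]
  have hDo : Do (c • (1 : Op q)) = c ^ (Finset.univ.filter (fun i => ¬ ε i = 1)).card := by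
    have e1 : c • (1 : Op q) * Po + Pe = ((c + 1) / 2) • (1 : Op q) + (-(c - 1) / 2) • P := by
      simp only [Pe, Po, Matrix.smul_mul, one_mul]
      module
    rw [Do, e1, hdet, ← Finset.prod_filter_mul_prod_filter_not Finset.univ (fun i => ε i = 1)]
    rw [Finset.prod_congr rfl (g := fun _ => (1 : ℂ))
      (fun i hi => by rw [(Finset.mem_filter.1 hi).2]; push_cast; ring)]
    rw [Finset.prod_congr (s₁ := Finset.univ.filter (fun i => ¬ ε i = 1)) rfl
      (g := fun _ => c)
      (fun i hi => by rw [(hsq i).resolve_left (Finset.mem_filter.1 hi).2]; push_cast; ring)]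
    simp
  rw [hDe, hDo, hcard, pow_succ, mul_comm]

/-- The canonical normalisation of an intertwiner. -/
noncomputable def N (U : Op q) : Op q := (Do U / De U) • U

lemma N_smul (hq : Odd q) {U : Op q} (hU : U * P = P * U) (hUu : Uᴴ * U = 1) (c : ℂ)
    (hc : c ≠ 0) : N (c • U) = N U := by
  have h1 : De (c • U) = De (c • (1 : Op q)) * De U := by
    rw [← De_mul hU]; simp
  have h2 : Do (c • U) = Do (c • (1 : Op q)) * Do U := by
    rw [← Do_mul hU]; simp
  have h3 : De U ≠ 0 := fun h => by simpa [h] using norm_De hU hUu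
  have h5 := De_smul_one (q := q) hq c
  have h4 : Do (c • (1 : Op q)) ≠ 0 := by
    intro h
    have h6 : Do ((c⁻¹ • (1 : Op q)) * (c • (1 : Op q))) = 1 := by
      rw [Matrix.smul_mul, one_mul, smul_smul, inv_mul_cancel₀ hc, one_smul, Do, one_mul,
        add_comm, Pe_add_Po, Matrix.det_one]
    rw [Do_mul (by simp), h, mul_zero] at h6
    exact zero_ne_one h6
  rw [N, N, h1, h2, h5, smul_smul]
  congr 1
  field_simp

/-- A unitary intertwiner for `g`. -/
noncomputable def U0 (hq : Odd q) (g : Sp8 (ZMod q)) : Op q :=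
  (exists_intw_unitary hq g).choose

lemma U0_intw (hq : Odd q) (g : Sp8 (ZMod q)) : Intw g (U0 hq g) :=
  (exists_intw_unitary hq g).choose_spec.1

lemma U0_unitary (hq : Odd q) (g : Sp8 (ZMod q)) : (U0 hq g)ᴴ * U0 hq g = 1 :=
  (exists_intw_unitary hq g).choose_spec.2

lemma N_eq (hq : Odd q) {g : Sp8 (ZMod q)} {U : Op q} (hU : Intw g U) (hUu : Uᴴ * U = 1) :
    N U = N (U0 hq g) := by
  obtain ⟨c, hc⟩ := (U0_intw hq g).unique hq (U0_unitary hq g) hU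
  have hne : c ≠ 0 := by
    rintro rfl
    rw [hc] at hUu
    simp at hUu
  rw [hc, N_smul hq ((U0_intw hq g).comm_P hq (U0_unitary hq g)) (U0_unitary hq g) c hne]

lemma N_mul {U V : Op q} (hV : V * P = P * V) : N (U * V) = N U * N V := by
  rw [N, N, N, De_mul hV, Do_mul hV, Matrix.smul_mul, Matrix.mul_smul, smul_smul]
  congr 1
  rw [mul_div_mul_comm]

/-- The Weil representation. -/
noncomputable def weil (hq : Odd q) : Representation ℂ (Sp8 (ZMod q)) (L2 q) where
  toFun g := Matrix.toLin' (N (U0 hq g))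
  map_one' := by
    have h1 : Intw (1 : Sp8 (ZMod q)) (1 : Op q) := fun v => by simp
    rw [← N_eq hq h1 (by simp), N, De, Do, one_mul, one_mul, add_comm Po, Pe_add_Po,
      Matrix.det_one, div_one, one_smul, Matrix.toLin'_one]
    rfl
  map_mul' g h := by
    have h1 := (U0_intw hq g).mul (U0_intw hq h)
    have h2 : (U0 hq g * U0 hq h)ᴴ * (U0 hq g * U0 hq h) = 1 := by
      rw [Matrix.conjTranspose_mul, Matrix.mul_assoc, ← Matrix.mul_assoc _ (U0 hq g),
        U0_unitary, one_mul, U0_unitary]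
    rw [← N_eq hq h1 h2, N_mul ((U0_intw hq h).comm_P hq (U0_unitary hq h)), Matrix.toLin'_mul]
    rfl

lemma N_unitary (hq : Odd q) (g : Sp8 (ZMod q)) : (N (U0 hq g))ᴴ * N (U0 hq g) = 1 := by
  have hU := (U0_intw hq g).comm_P hq (U0_unitary hq g)
  have hn : ‖Do (U0 hq g) / De (U0 hq g)‖ = 1 := by
    rw [norm_div, norm_De hU (U0_unitary hq g), norm_Do hU (U0_unitary hq g), div_one]
  rw [N, Matrix.conjTranspose_smul, Matrix.smul_mul, Matrix.mul_smul, U0_unitary, smul_smul,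
    ← starRingEnd_apply, Complex.conj_mul', hn]
  simp

/-- The Weil operator of `g` is a phase times any intertwiner whose row `0` has norm `1` and
whose entry `(0, 0)` is positive; the phase is that of the entry `(0, 0)`. -/
lemma weil_eq (hq : Odd q) {g : Sp8 (ZMod q)} {U : Op q} (hU : Intw g U)
    (hrow : ∑ y, ‖U 0 y‖ ^ 2 = 1) (t : ℝ) (ht : 0 < t) (h00 : U 0 0 = (t : ℂ)) :
    ‖N (U0 hq g) 0 0 / ‖N (U0 hq g) 0 0‖‖ = 1 ∧
    N (U0 hq g) = (N (U0 hq g) 0 0 / ‖N (U0 hq g) 0 0‖) • U := by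
  have hNi : Intw g (N (U0 hq g)) := by
    intro v
    rw [N, Matrix.mul_smul, U0_intw hq g v, Matrix.smul_mul]
  obtain ⟨c, hc⟩ := hNi.unique hq (N_unitary hq g) hU
  have hrow' : ∑ y, ‖N (U0 hq g) 0 y‖ ^ 2 = 1 := by
    have h0 : N (U0 hq g) * (N (U0 hq g))ᴴ = 1 := mul_eq_one_comm.1 (N_unitary hq g)
    have h1 := congrFun (congrFun h0 0) 0
    rw [Matrix.mul_apply, Matrix.one_apply_eq] at h1
    have h2 : ((∑ y, ‖N (U0 hq g) 0 y‖ ^ 2 : ℝ) : ℂ) = 1 := by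
      rw [← h1]
      push_cast
      refine Finset.sum_congr rfl fun y _ => ?_
      rw [Matrix.conjTranspose_apply, ← starRingEnd_apply, Complex.mul_conj']
    exact_mod_cast h2
  have hcn : ‖c‖ = 1 := by
    rw [hc] at hrow
    simp only [Matrix.smul_apply, smul_eq_mul, norm_mul, mul_pow, ← Finset.mul_sum, hrow',
      mul_one] at hrow
    exact (pow_eq_one_iff_of_nonneg (norm_nonneg _) two_ne_zero).1 hrow
  have hc0 : c ≠ 0 := by
    rintro rfl
    simp at hcn
  have hN : N (U0 hq g) = c⁻¹ • U := by
    rw [hc, smul_smul, inv_mul_cancel₀ hc0, one_smul]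
  have hph : N (U0 hq g) 0 0 / ‖N (U0 hq g) 0 0‖ = c⁻¹ := by
    have h1 : N (U0 hq g) 0 0 = c⁻¹ * t := by rw [hN, Matrix.smul_apply, h00, smul_eq_mul]
    have h2 : (t : ℂ) ≠ 0 := by exact_mod_cast ht.ne'
    rw [h1, norm_mul, norm_inv, hcn, inv_one, one_mul, Complex.norm_real, Real.norm_of_nonneg ht.le,
      mul_div_assoc, div_self h2, mul_one]
  rw [hph]
  exact ⟨by rw [norm_inv, hcn, inv_one], hN⟩

open scoped Classical in
/-- The phase of the entry `(0, 0)` of the Weil operator (`1` if that entry vanishes). -/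
noncomputable def ph (hq : Odd q) (g : Sp8 (ZMod q)) : ℂ :=
  if N (U0 hq g) 0 0 = 0 then 1 else N (U0 hq g) 0 0 / ‖N (U0 hq g) 0 0‖

lemma norm_ph (hq : Odd q) (g : Sp8 (ZMod q)) : ‖ph hq g‖ = 1 := by
  rw [ph]
  split_ifs with h
  · simp
  · rw [norm_div, Complex.norm_real, norm_norm, div_self]
    simpa using h

lemma weil_apply (hq : Odd q) {g : Sp8 (ZMod q)} {U : Op q}
    (h : ‖N (U0 hq g) 0 0 / ‖N (U0 hq g) 0 0‖‖ = 1 ∧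
      N (U0 hq g) = (N (U0 hq g) 0 0 / ‖N (U0 hq g) 0 0‖) • U) (f : L2 q)
    (x : Fin 4 → ZMod q) : weil hq g f x = ph hq g * (U *ᵥ f) x := by
  have hne : N (U0 hq g) 0 0 ≠ 0 := by
    intro h0
    have h1 := h.1
    rw [h0] at h1
    simp at h1
  have h2 : ph hq g = N (U0 hq g) 0 0 / ‖N (U0 hq g) 0 0‖ := by rw [ph, if_neg hne]
  have h3 : weil hq g f = N (U0 hq g) *ᵥ f := Matrix.toLin'_apply _ _
  have h4 := h.2
  rw [← h2] at h4
  rw [h3, h4, Matrix.smul_mulVec, Pi.smul_apply, smul_eq_mul]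

lemma H_elim (u w x y : Fin 4 → ZMod q) : H (Sum.elim u w) x y =
    if y = x + u then ZMod.stdAddChar (w ⬝ᵥ x + 2⁻¹ * (u ⬝ᵥ w)) else 0 := rfl

/-- The dilation operator `f ↦ f(E⁻¹ x)`. -/
def opS (E : GL (Fin 4) (ZMod q)) : Op q := Matrix.of fun x y =>
  if y = ((E⁻¹ : GL (Fin 4) (ZMod q)) : Matrix (Fin 4) (Fin 4) (ZMod q)) *ᵥ x then 1 else 0

lemma opS_intw (E : GL (Fin 4) (ZMod q)) : Intw (Sp8.s E) (opS E) := by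
  intro v
  obtain ⟨u, w, rfl⟩ : ∃ u w, v = Sum.elim u w :=
    ⟨v ∘ Sum.inl, v ∘ Sum.inr, (Sum.elim_comp_inl_inr v).symm⟩
  set F : Matrix (Fin 4) (Fin 4) (ZMod q) :=
    ((E⁻¹ : GL (Fin 4) (ZMod q)) : Matrix (Fin 4) (Fin 4) (ZMod q)) with hF
  have hFE : F * (E : Matrix (Fin 4) (Fin 4) (ZMod q)) = 1 := by
    rw [hF, ← Units.val_mul]; simp
  have hv : (Sp8.s E).1 *ᵥ Sum.elim u w = Sum.elim
      ((E : Matrix (Fin 4) (Fin 4) (ZMod q)) *ᵥ u) (Fᵀ *ᵥ w) := by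
    simp [Sp8.s, Matrix.fromBlocks_mulVec, hF]
  rw [hv]
  ext x y
  rw [Matrix.mul_apply, Finset.sum_eq_single (x + (E : Matrix (Fin 4) (Fin 4) (ZMod q)) *ᵥ u)
    (fun z _ hz => by simp [H_elim, hz]) (by simp)]
  rw [Matrix.mul_apply, Finset.sum_eq_single (F *ᵥ x)
    (fun z _ hz => by rw [opS, Matrix.of_apply, if_neg hz, zero_mul]) (by simp)]
  have e1 : F *ᵥ (x + (E : Matrix (Fin 4) (Fin 4) (ZMod q)) *ᵥ u) = F *ᵥ x + u := by
    rw [Matrix.mulVec_add, Matrix.mulVec_mulVec, hFE, Matrix.one_mulVec]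
  have e2 : (Fᵀ *ᵥ w) ⬝ᵥ x = w ⬝ᵥ (F *ᵥ x) := by
    rw [Matrix.mulVec_transpose, Matrix.dotProduct_mulVec]
  have e3 : ((E : Matrix (Fin 4) (Fin 4) (ZMod q)) *ᵥ u) ⬝ᵥ (Fᵀ *ᵥ w) = u ⬝ᵥ w := by
    rw [Matrix.dotProduct_mulVec, Matrix.vecMul_transpose, Matrix.mulVec_mulVec, hFE,
      Matrix.one_mulVec]
  simp only [H_elim, opS, Matrix.of_apply, if_true, one_mul,
    ← hF, e1, e2, e3, mul_ite, mul_one, mul_zero]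

/-- The modulation operator `f ↦ e_q(-xᵀWx/2) f(x)`. -/
noncomputable def opL (W : Matrix (Fin 4) (Fin 4) (ZMod q)) : Op q :=
  Matrix.diagonal fun x => ZMod.stdAddChar (-(2⁻¹ * (x ⬝ᵥ (W *ᵥ x))))

lemma opL_intw (hq : Odd q) (W : Matrix (Fin 4) (Fin 4) (ZMod q)) (hW : W.IsSymm) :
    Intw (Sp8.l W hW) (opL W) := by
  have h2 := two_half hq
  intro v
  obtain ⟨u, w, rfl⟩ : ∃ u w, v = Sum.elim u w :=
    ⟨v ∘ Sum.inl, v ∘ Sum.inr, (Sum.elim_comp_inl_inr v).symm⟩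
  have hv : (Sp8.l W hW).1 *ᵥ Sum.elim u w = Sum.elim u (W *ᵥ u + w) := by
    simp [Sp8.l, Matrix.fromBlocks_mulVec]
  rw [hv]
  ext x y
  rw [opL, Matrix.mul_diagonal, Matrix.diagonal_mul]
  rw [H_elim, H_elim]
  split_ifs with hy
  · subst hy
    rw [← AddChar.map_add_eq_mul, ← AddChar.map_add_eq_mul]
    congr 1
    have e1 : (W *ᵥ u) ⬝ᵥ x = u ⬝ᵥ (W *ᵥ x) := by
      rw [Matrix.dotProduct_mulVec, ← Matrix.mulVec_transpose, hW.eq]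
    have e2 : x ⬝ᵥ (W *ᵥ u) = u ⬝ᵥ (W *ᵥ x) := by rw [dotProduct_comm, e1]
    simp only [Matrix.mulVec_add, add_dotProduct, dotProduct_add, e1, e2]
    linear_combination (u ⬝ᵥ (W *ᵥ x)) * (-h2)
  · rw [zero_mul, mul_zero]

/-- The Fourier transform. -/
noncomputable def opJ : Op q :=
  Matrix.of fun x y => ((q : ℂ) ^ 2)⁻¹ * ZMod.stdAddChar (x ⬝ᵥ y)

lemma opJ_intw (hq : Odd q) : Intw (Sp8.J (ZMod q)) opJ := by
  have h2 := two_half hq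
  intro v
  obtain ⟨u, w, rfl⟩ : ∃ u w, v = Sum.elim u w :=
    ⟨v ∘ Sum.inl, v ∘ Sum.inr, (Sum.elim_comp_inl_inr v).symm⟩
  have hv : (Sp8.J (ZMod q)).1 *ᵥ Sum.elim u w = Sum.elim w (-u) := by
    simp [Sp8.J, Matrix.fromBlocks_mulVec, Matrix.neg_mulVec]
  rw [hv]
  ext x y
  rw [Matrix.mul_apply, Finset.sum_eq_single (x + w)
    (fun z _ hz => by simp [H_elim, hz]) (by simp)]
  rw [Matrix.mul_apply, Finset.sum_eq_single (y - u)
    (fun z _ hz => by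
      have : y ≠ z + u := fun h => hz (by rw [h]; simp)
      simp [H_elim, this]) (by simp)]
  simp only [H_elim, opJ, Matrix.of_apply, if_true,
    sub_add_cancel]
  rw [mul_left_comm, mul_assoc, ← AddChar.map_add_eq_mul, ← AddChar.map_add_eq_mul]
  congr 2
  simp only [add_dotProduct, dotProduct_sub, neg_dotProduct, dotProduct_neg,
    dotProduct_comm w u, dotProduct_comm u x]
  linear_combination (u ⬝ᵥ w) * (-h2)

end WeilExistence

open WeilExistence in
/-- The Weil representation exists for every odd `q`. -/
theorem exists_isWeilRepresentation {q : ℕ} [NeZero q] (hq : Odd q) :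
    ∃ ρ : Representation ℂ (Sp8 (ZMod q)) (L2 q), IsWeilRepresentation ρ := by
  classical
  have hq0 : (q : ℂ) ≠ 0 := NeZero.ne _
  refine ⟨weil hq, ⟨?_, ?_⟩⟩
  · intro g f₁ f₂
    have h1 : ∀ f₁ f₂ : L2 q, L2.innerAvg f₁ f₂ =
        (f₁ ⬝ᵥ star f₂) / (Fintype.card (Fin 4 → ZMod q) : ℂ) := by
      intro f₁ f₂
      rw [L2.innerAvg, Fintype.expect_eq_sum_div_card]
      rfl
    have h2 : ∀ f, weil hq g f = N (U0 hq g) *ᵥ f := fun f => Matrix.toLin'_apply _ _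
    rw [h1, h1, h2, h2]
    congr 1
    rw [Matrix.star_mulVec, dotProduct_comm, ← Matrix.dotProduct_mulVec, Matrix.mulVec_mulVec,
      N_unitary, Matrix.one_mulVec, dotProduct_comm]
  · have hS := fun E : GL (Fin 4) (ZMod q) => weil_eq hq (opS_intw E)
      (by
        simp only [opS, Matrix.of_apply, Matrix.mulVec_zero]
        rw [Finset.sum_eq_single 0] <;> simp +contextual) 1 one_pos (by simp [opS])
    have hL := fun (W : Matrix (Fin 4) (Fin 4) (ZMod q)) (hW : W.IsSymm) =>
      weil_eq hq (opL_intw hq W hW)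
      (by
        simp only [opL]
        rw [Finset.sum_eq_single 0]
        · simp
        · intro y _ hy
          simp [Matrix.diagonal_apply_ne _ hy.symm]
        · simp) 1 one_pos (by simp [opL])
    have hJ := weil_eq hq (opJ_intw (q := q) hq)
      (by
        simp only [opJ, Matrix.of_apply, zero_dotProduct, AddChar.map_zero_eq_one, mul_one]
        have : (q : ℝ) ≠ 0 := NeZero.ne _
        simp [ZMod.card]
        field_simp) ((q : ℝ) ^ 2)⁻¹
      (by
        have : (0 : ℝ) < q := by exact_mod_cast Nat.pos_of_ne_zero (NeZero.ne q)
        positivity) (by simp [opJ])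
    refine ⟨ph hq, norm_ph hq, ?_, ?_, ?_⟩
    · intro E f x
      rw [weil_apply hq (hS E)]
      congr 1
      simp [opS, Matrix.mulVec, dotProduct]
    · intro f x
      rw [weil_apply hq hJ]
      congr 1
      rw [Fintype.expect_eq_sum_div_card, Matrix.mulVec, dotProduct, Finset.sum_div,
        Finset.mul_sum]
      refine Finset.sum_congr rfl fun y _ => ?_
      simp only [opJ, Matrix.of_apply, Fintype.card_pi, ZMod.card, Finset.prod_const,
        Finset.card_univ, Fintype.card_fin, Nat.cast_pow]
      field_simp
    · intro W hW f x
      rw [weil_apply hq (hL W hW)]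
      congr 1
      rw [opL, Matrix.mulVec_diagonal]

/-! Everything takes place in an image of SL₂ over a commutative ring. Put e = 2c. Then eΔ is
symmetric, so Δ is self-adjoint for e, and (x y; z w) ↦ (x, y e⁻¹; e z, e w e⁻¹) maps SL₂ over a
ring of polynomials in Δ to Sp₈. A generator of Γ_q is the image of an explicit matrix `quot δ r s`,
where δ acts as Δ (`dilate_inv_mul_dilate`). Let first q = p be a large prime and R = F_p[X]/(χ),
with χ the characteristic polynomial of Δ mod p. The subgroup Γ of SL₂(R) generated by the `quot δ r
s` has index less than p, hence contains every element of order p, in particular all elementary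
matrices (`mem_quotGroup_of_pow_eq_one`). To bound the index, adjoin the torus diag(1, t), t ∈
F_p^×. The enlarged group contains one-parameter groups 1 + (u - 1)N with N idempotent. These N are
stable under conjugation by such elements, so their span is closed under commutators and has
dimension at least 3·4 + 1 = 13. A polynomial argument (`pow_le_card_of_prod_mem`) shows that
products of 13 factors 1 + aᵢNᵢ take at least a constant times p^13 values. Removing the torus
leaves |Γ| at least a constant times p^12, against |SL₂(R)| ≤ p^12. The Chinese remainder theorem
passes to squarefree q (`mem_Gam_of_forall_prime`). Now let V be a nonzero invariant subspace. Lower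
elementary matrices act by multiplication with e_q(-xᵀ e β(Δ) x / 2), and upper ones do the same on
the Fourier side. Hence V is stable under restriction to joint level sets of these quadratic forms
(`indicator_mem`). As Δ has distinct eigenvalues, the forms have no common nontrivial zero modulo a
good prime p (`eq_zero_of_isotropic`). A function living on their common zeros mod p, together with
its Fourier transform, would be supported on vectors divisible by p, which is impossible
(`eq_zero_of_supported`). So some function of V is nonzero at a vector x₀ where the forms do not all
vanish modulo any p dividing q (`exists_form_ne_zero`). Scalar dilations by units t also preserve V,
and they multiply the forms by t². Dilating a function that lives on the level set of x₀ gives ∏ (p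
- 1)/2 linearly independent elements of V (`prod_le_finrank`). This product is at least q / 4^ω(q),
where ω(q), the number of prime factors, is o(log q). -/

/-! ### Products of one-parameter families: a lower bound for their number -/

section PolynomialMethod

open MvPolynomial

/-- An endomorphism of a polynomial ring which is the identity to first order is injective. -/
theorem MvPolynomial.bind₁_injective_of_sub_X_mem {σ F : Type*} [CommRing F]
    (f : σ → MvPolynomial σ F) (hf : ∀ j, f j - X j ∈ idealOfVars σ F ^ 2)
    {g : MvPolynomial σ F} (hg : bind₁ f g = 0) : g = 0 := by
  set I := idealOfVars σ F with hI
  set φ : MvPolynomial σ F →ₐ[F] MvPolynomial σ F := bind₁ f with hφ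
  have hX : ∀ j, X j ∈ I := fun j => Ideal.subset_span ⟨j, rfl⟩
  have hφX : ∀ j, φ (X j) = f j := fun j => bind₁_X_right f j
  have h0 : ∀ g, φ g - g ∈ I := by
    intro g
    induction g using MvPolynomial.induction_on with
    | C a => simp [hφ]
    | add p q hp hq =>
      have : φ (p + q) - (p + q) = (φ p - p) + (φ q - q) := by rw [map_add]; ring
      rw [this]; exact I.add_mem hp hq
    | mul_X p j hp =>
      have : φ (p * X j) - p * X j = (φ p - p) * f j + p * (f j - X j) := by
        rw [map_mul, hφX]; ring
      rw [this]
      exact I.add_mem (I.mul_mem_right _ hp)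
        (I.mul_mem_left _ (Ideal.pow_le_self two_ne_zero (hf j)))
  have h0' : ∀ b ∈ I, φ b ∈ I := fun b hb => by
    have := I.add_mem (h0 b) hb
    rwa [sub_add_cancel] at this
  have h1 : ∀ b ∈ I, φ b - b ∈ I ^ 2 := by
    intro b hb
    refine Submodule.span_induction (p := fun b _ => φ b - b ∈ I ^ 2) ?_ (by simp) ?_ ?_ hb
    · rintro _ ⟨j, rfl⟩
      rw [hφX]; exact hf j
    · intro x y _ _ hx hy
      have : φ (x + y) - (x + y) = (φ x - x) + (φ y - y) := by rw [map_add]; ring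
      rw [this]; exact (I ^ 2).add_mem hx hy
    · intro c x hx hx'
      have : φ (c • x) - c • x = (φ c - c) * φ x + c * (φ x - x) := by
        rw [smul_eq_mul, map_mul]; ring
      rw [this]
      refine (I ^ 2).add_mem ?_ ((I ^ 2).mul_mem_left _ hx')
      rw [pow_two]
      exact Ideal.mul_mem_mul (h0 c) (h0' x hx)
  -- The map φ is the identity on every graded piece I^m / I^(m+1). A polynomial in the kernel
  -- therefore lies in all powers of I.
  have h2 : ∀ m, ∀ g ∈ I ^ m, φ g - g ∈ I ^ (m + 1) := by
    intro m
    induction m with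
    | zero => intro g _; simpa using h0 g
    | succ m ih =>
      intro g hg
      rw [pow_succ] at hg
      refine Submodule.mul_induction_on hg ?_ ?_
      · intro a ha b hb
        have : φ (a * b) - a * b = (φ a - a) * φ b + a * (φ b - b) := by rw [map_mul]; ring
        rw [this]
        refine Ideal.add_mem _ ?_ ?_
        · rw [pow_succ]; exact Ideal.mul_mem_mul (ih a ha) (h0' b hb)
        · rw [show m + 1 + 1 = m + 2 by ring, pow_add]
          exact Ideal.mul_mem_mul ha (h1 b hb)
      · intro x y hx hy
        have : φ (x + y) - (x + y) = (φ x - x) + (φ y - y) := by rw [map_add]; ring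
        rw [this]; exact Ideal.add_mem _ hx hy
  have h3 : ∀ m, g ∈ I ^ m := by
    intro m
    induction m with
    | zero => simp
    | succ m ih => simpa [hg] using h2 m g ih
  ext x
  exact (mem_pow_idealOfVars_iff' _ g).1 (h3 (x.degree + 1)) x (Nat.lt_succ_self _)

variable {ι F A : Type*} [Field F] [Ring A] [Algebra F A]

/-- The polynomial `ℓ (∏ᵢ (1 + Xᵢ Nᵢ))`, the product being over a list. -/
noncomputable def prodPoly (N : ι → A) : List ι → (A →ₗ[F] F) → MvPolynomial ι F
  | [], ℓ => C (ℓ 1)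
  | i :: L, ℓ => prodPoly N L ℓ + X i * prodPoly N L (ℓ ∘ₗ LinearMap.mulLeft F (N i))

lemma eval_prodPoly (N : ι → A) (a : ι → F) (L : List ι) (ℓ : A →ₗ[F] F) :
    eval a (prodPoly N L ℓ) = ℓ (L.map fun i => 1 + a i • N i).prod := by
  induction L generalizing ℓ with
  | nil => simp [prodPoly]
  | cons i L ih => simp [prodPoly, ih, add_mul]

/-- Each variable occurs in a single factor of the product, so the polynomial is multilinear. -/
lemma degreeOf_prodPoly_le (N : ι → A) (i : ι) (L : List ι) (hL : L.Nodup) (ℓ : A →ₗ[F] F) :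
    degreeOf i (prodPoly N L ℓ) ≤ 1 ∧ (i ∉ L → degreeOf i (prodPoly N L ℓ) = 0) := by
  classical
  induction L generalizing ℓ with
  | nil => simp [prodPoly]
  | cons j L ih =>
    obtain ⟨hj, hL⟩ := List.nodup_cons.1 hL
    have h1 := ih hL ℓ
    have h2 := ih hL (ℓ ∘ₗ LinearMap.mulLeft F (N j))
    have h3 := degreeOf_add_le i (prodPoly N L ℓ)
      (X j * prodPoly N L (ℓ ∘ₗ LinearMap.mulLeft F (N j)))
    have h4 := degreeOf_mul_le i (X j) (prodPoly N L (ℓ ∘ₗ LinearMap.mulLeft F (N j)))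
    have h5 := degreeOf_X (R := F) i j
    rw [prodPoly]
    by_cases hij : i = j
    · subst hij
      have := h2.2 hj
      rw [if_pos rfl] at h5
      refine ⟨by omega, by simp⟩
    · rw [if_neg hij] at h5
      refine ⟨by omega, fun hi => ?_⟩
      have hi' : i ∉ L := fun h => hi (List.mem_cons_of_mem _ h)
      have := h1.2 hi'
      have := h2.2 hi'
      omega

/-- First-order Taylor expansion at the origin. The first half is what puts the new term Xᵢ·(…) of
the induction into the square of the ideal. -/
lemma prodPoly_sub_mem (N : ι → A) (L : List ι) (ℓ : A →ₗ[F] F) :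
    prodPoly N L ℓ - C (ℓ 1) ∈ idealOfVars ι F ∧
    prodPoly N L ℓ - C (ℓ 1) - (L.map fun i => C (ℓ (N i)) * X i).sum ∈ idealOfVars ι F ^ 2 := by
  induction L generalizing ℓ with
  | nil => simp [prodPoly]
  | cons i L ih =>
    have hX : (X i : MvPolynomial ι F) ∈ idealOfVars ι F := Ideal.subset_span ⟨i, rfl⟩
    obtain ⟨h1, h2⟩ := ih ℓ
    obtain ⟨h3, -⟩ := ih (ℓ ∘ₗ LinearMap.mulLeft F (N i))
    have e : (ℓ ∘ₗ LinearMap.mulLeft F (N i)) 1 = ℓ (N i) := by simp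
    rw [e] at h3
    constructor
    · rw [prodPoly, add_sub_right_comm]
      exact Ideal.add_mem _ h1 (Ideal.mul_mem_right _ _ hX)
    · have : prodPoly N (i :: L) ℓ - C (ℓ 1) -
          ((i :: L).map fun i => C (ℓ (N i)) * X i).sum =
          (prodPoly N L ℓ - C (ℓ 1) - (L.map fun i => C (ℓ (N i)) * X i).sum) +
          X i * (prodPoly N L (ℓ ∘ₗ LinearMap.mulLeft F (N i)) - C (ℓ (N i))) := by
        rw [prodPoly, List.map_cons, List.sum_cons]; ring
      rw [this]
      refine Ideal.add_mem _ h2 ?_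
      rw [pow_two]
      exact Ideal.mul_mem_mul hX h3

/-- If `N₁, …, Nₙ` are linearly independent, then the products `∏ᵢ (1 + aᵢ Nᵢ)` with `aᵢ ∈ T`
take many values. -/
theorem pow_le_card_of_prod_mem {n k : ℕ} (N : Fin n → A) (hN : LinearIndependent F N)
    (T : Finset F) (hk : n * k < T.card) (S : Finset A)
    (hS : ∀ a : Fin n → F, (∀ i, a i ∈ T) →
      ((List.finRange n).map fun i => 1 + a i • N i).prod ∈ S) :
    (k + 1) ^ n ≤ S.card := by
  classical
  by_contra! hlt
  -- The map π gives coordinates dual to the Nᵢ. In these coordinates, and up to constants, the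
  -- product is the polynomial map a ↦ a + O(a²).
  obtain ⟨π, hπ⟩ := LinearMap.exists_leftInverse_of_injective (Fintype.linearCombination F N)
    (LinearMap.ker_eq_bot.2 (hN.fintypeLinearCombination_injective))
  have hπN : ∀ i j, π (N i) j = if i = j then 1 else 0 := by
    intro i j
    have h := congrFun (LinearMap.congr_fun hπ (Pi.single i 1)) j
    simpa [Pi.single_apply, eq_comm] using h
  set f : Fin n → MvPolynomial (Fin n) F := fun j =>
    prodPoly N (List.finRange n) (LinearMap.proj j ∘ₗ π) - C (π 1 j) with hf
  have hfX : ∀ j, f j - X j ∈ idealOfVars (Fin n) F ^ 2 := by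
    intro j
    have h := (prodPoly_sub_mem N (List.finRange n) (LinearMap.proj j ∘ₗ π)).2
    have e : ((List.finRange n).map fun i => C ((LinearMap.proj j ∘ₗ π) (N i)) * X i).sum
        = (X j : MvPolynomial (Fin n) F) := by
      rw [← List.ofFn_eq_map, List.sum_ofFn]
      simp [hπN]
    rw [e] at h
    exact h
  have hfdeg : ∀ i j, degreeOf i (f j) ≤ 1 := by
    intro i j
    have h1 := (degreeOf_prodPoly_le N i (List.finRange n) (List.nodup_finRange n)
      (LinearMap.proj j ∘ₗ π)).1
    refine (degreeOf_sub_le i _ _).trans ?_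
    simp [h1]
  -- The (k + 1)^n monomials with exponents at most k outnumber the points of S, so a nontrivial
  -- combination g of them vanishes at the coordinates of all points of S.
  let M : Matrix S (Fin n → Fin (k + 1)) F :=
    Matrix.of fun s m => ∏ j, (π s.1 j - π 1 j) ^ (m j : ℕ)
  have hker : LinearMap.ker M.mulVecLin ≠ ⊥ :=
    LinearMap.ker_ne_bot_of_finrank_lt (by simpa using hlt)
  obtain ⟨c, hc, hc0⟩ := (Submodule.ne_bot_iff _).1 hker
  set g : MvPolynomial (Fin n) F :=
    ∑ m : Fin n → Fin (k + 1), monomial (Finsupp.equivFunOnFinite.symm fun j => (m j : ℕ)) (c m)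
    with hg
  have hg0 : g ≠ 0 := by
    intro h0
    apply hc0
    ext m
    have h := congrArg (coeff (Finsupp.equivFunOnFinite.symm fun j => (m j : ℕ))) h0
    rw [hg, coeff_sum, Finset.sum_eq_single m] at h
    · simpa using h
    · intro m' _ hm'
      rw [coeff_monomial, if_neg]
      intro h'
      apply hm'
      ext j
      exact congrFun (Finsupp.equivFunOnFinite.symm.injective h') j
    · simp
  apply hg0
  apply bind₁_injective_of_sub_X_mem f hfX
  have hb : bind₁ f g = ∑ m : Fin n → Fin (k + 1), C (c m) * ∏ j, f j ^ (m j : ℕ) := by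
    rw [hg, map_sum]
    refine Finset.sum_congr rfl fun m _ => ?_
    rw [bind₁_monomial]
    congr 1
    refine Finset.prod_subset (Finset.subset_univ _) ?_
    intro j _ hj
    simp at hj
    simp [hj]
  -- Substituting the product into g gives degree at most nk in each variable, since every
  -- coordinate is multilinear. It vanishes on the grid T^n, whose side exceeds nk.
  apply eq_zero_of_eval_zero_at_prod_finset _ fun _ => T
  · intro i
    refine lt_of_le_of_lt ?_ hk
    rw [hb]
    refine (degreeOf_sum_le i _ _).trans (Finset.sup_le fun m _ => ?_)
    refine (degreeOf_C_mul_le _ _ _).trans ((degreeOf_prod_le i _ _).trans ?_)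
    calc ∑ j, degreeOf i (f j ^ (m j : ℕ)) ≤ ∑ _j : Fin n, k := by
          refine Finset.sum_le_sum fun j _ => (degreeOf_pow_le i _ _).trans ?_
          have := hfdeg i j
          have := (m j).2
          calc (m j : ℕ) * degreeOf i (f j) ≤ (m j : ℕ) * 1 := by gcongr
            _ ≤ k := by omega
      _ = n * k := by simp
  · intro a ha
    rw [hb, map_sum]
    have h1 := congrFun (LinearMap.mem_ker.1 hc) ⟨_, hS a ha⟩
    simp only [Matrix.mulVecLin_apply, Matrix.mulVec, dotProduct, M, Matrix.of_apply,
      Pi.zero_apply] at h1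
    rw [← h1]
    refine Finset.sum_congr rfl fun m _ => ?_
    simp [hf, eval_prodPoly, mul_comm]

end PolynomialMethod

/-! ### Subgroups of `SL₂(R)` generated by quotients of dilates -/

namespace SL2

open Matrix.SpecialLinearGroup

variable {R : Type*} [CommRing R]

/-- The lower unitriangular matrix `(1 0; β 1)`. -/
def low (β : R) : SpecialLinearGroup (Fin 2) R := ⟨!![1, 0; β, 1], by simp⟩

/-- The upper unitriangular matrix `(1 β; 0 1)`. -/
def upp (β : R) : SpecialLinearGroup (Fin 2) R := ⟨!![1, β; 0, 1], by simp⟩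

lemma coe_low (β : R) : (low β : Matrix (Fin 2) (Fin 2) R) = !![1, 0; β, 1] := rfl

lemma coe_upp (β : R) : (upp β : Matrix (Fin 2) (Fin 2) R) = !![1, β; 0, 1] := rfl

lemma low_mul (a b : R) : low a * low b = low (a + b) := by
  apply Subtype.ext
  simp [coe_mul, coe_low]

lemma upp_mul (a b : R) : upp a * upp b = upp (a + b) := by
  apply Subtype.ext
  simp [coe_mul, coe_upp, add_comm]

lemma low_zero : low (0 : R) = 1 := by
  apply Subtype.ext; simp [coe_low, Matrix.one_fin_two]

lemma upp_zero : upp (0 : R) = 1 := by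
  apply Subtype.ext; simp [coe_upp, Matrix.one_fin_two]

lemma low_pow (a : R) (n : ℕ) : low a ^ n = low (n * a) := by
  induction n with
  | zero => simp [low_zero]
  | succ n ih => rw [pow_succ, ih, low_mul]; congr 1; push_cast; ring

lemma upp_pow (a : R) (n : ℕ) : upp a ^ n = upp (n * a) := by
  induction n with
  | zero => simp [upp_zero]
  | succ n ih => rw [pow_succ, ih, upp_mul]; congr 1; push_cast; ring

/-- The matrix `(1 + (1 - s/r) δ, (1/r - 1/s)(δ + 1); (r - s) δ, 1 + (1 - r/s) δ)`. -/
def quot (δ : R) (r s : Rˣ) : SpecialLinearGroup (Fin 2) R :=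
  ⟨!![1 + (1 - s * (r⁻¹ : Rˣ)) * δ, ((r⁻¹ : Rˣ) - (s⁻¹ : Rˣ)) * (δ + 1);
      (r - s) * δ, 1 + (1 - r * (s⁻¹ : Rˣ)) * δ], by
    have hr : (r : R) * (r⁻¹ : Rˣ) = 1 := by simp
    have hs : (s : R) * (s⁻¹ : Rˣ) = 1 := by simp
    rw [Matrix.det_fin_two_of]
    linear_combination δ ^ 2 * (s * (s⁻¹ : Rˣ) - 1) * hr - δ * hr - δ * hs⟩

lemma coe_quot (δ : R) (r s : Rˣ) : (quot δ r s : Matrix (Fin 2) (Fin 2) R) =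
    !![1 + (1 - s * (r⁻¹ : Rˣ)) * δ, ((r⁻¹ : Rˣ) - (s⁻¹ : Rˣ)) * (δ + 1);
      (r - s) * δ, 1 + (1 - r * (s⁻¹ : Rˣ)) * δ] := rfl

/-- Conjugation by `diag(1, t)`. -/
def dil (t : Rˣ) : SpecialLinearGroup (Fin 2) R →* SpecialLinearGroup (Fin 2) R where
  toFun M := ⟨!![M 0 0, (t⁻¹ : Rˣ) * M 0 1; t * M 1 0, M 1 1], by
    have h := M.2
    have ht : (t : R) * (t⁻¹ : Rˣ) = 1 := by simp
    rw [Matrix.det_fin_two] at h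
    rw [Matrix.det_fin_two_of]
    linear_combination h - M 0 1 * M 1 0 * ht⟩
  map_one' := by apply Subtype.ext; simp [Matrix.one_fin_two]
  map_mul' M N := by
    have ht : (t : R) * (t⁻¹ : Rˣ) = 1 := by simp
    apply Subtype.ext
    show !![(M.1 * N.1) 0 0, (t⁻¹ : Rˣ) * (M.1 * N.1) 0 1; t * (M.1 * N.1) 1 0, (M.1 * N.1) 1 1] =
      !![M.1 0 0, (t⁻¹ : Rˣ) * M.1 0 1; t * M.1 1 0, M.1 1 1] *
      !![N.1 0 0, (t⁻¹ : Rˣ) * N.1 0 1; t * N.1 1 0, N.1 1 1]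
    ext i j
    fin_cases i <;> fin_cases j <;> simp [Matrix.mul_apply, Fin.sum_univ_two]
    · linear_combination - M 0 1 * N 1 0 * ht
    · ring
    · ring
    · linear_combination - M 1 0 * N 0 1 * ht

lemma coe_dil (t : Rˣ) (M : SpecialLinearGroup (Fin 2) R) :
    (dil t M : Matrix (Fin 2) (Fin 2) R) =
      !![M.1 0 0, (t⁻¹ : Rˣ) * M.1 0 1; t * M.1 1 0, M.1 1 1] := rfl

/-- The diagonal matrix `diag(1, t)`. -/
def D (t : R) : Matrix (Fin 2) (Fin 2) R := !![1, 0; 0, t]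

lemma D_mul_coe (t : Rˣ) (M : SpecialLinearGroup (Fin 2) R) :
    D (t : R) * (M : Matrix (Fin 2) (Fin 2) R) = (dil t M : Matrix (Fin 2) (Fin 2) R) * D (t : R) := by
  have ht : (t : R) * (t⁻¹ : Rˣ) = 1 := by simp
  ext i j
  fin_cases i <;> fin_cases j <;> simp [D, coe_dil, Matrix.mul_apply, Fin.sum_univ_two]
  · linear_combination - M 0 1 * ht
  · ring

lemma D_mul_D (s t : R) : D s * D t = D (s * t) := by
  simp [D]

/-- Conjugation by diag(1, t) permutes the generators, so the torus normalises the group they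
generate. -/
lemma dil_quot (δ : R) (t r s : Rˣ) : dil t (quot δ r s) = quot δ (t * r) (t * s) := by
  have ht : (t : R) * (t⁻¹ : Rˣ) = 1 := by simp
  apply Subtype.ext
  ext i j
  fin_cases i <;> fin_cases j <;> simp [coe_dil, coe_quot]
  · linear_combination (δ * s * (r⁻¹ : Rˣ)) * ht
  · ring
  · ring
  · linear_combination (δ * r * (s⁻¹ : Rˣ)) * ht

/-- There are at most `|R|³` matrices of determinant `1`. -/
lemma card_le [Finite R] : Nat.card (SpecialLinearGroup (Fin 2) R) ≤ Nat.card R ^ 3 := by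
  classical
  have hex : ∀ M : SpecialLinearGroup (Fin 2) R, ∃ N : SpecialLinearGroup (Fin 2) R,
      N 0 0 = M 0 0 ∧ N 0 1 = M 0 1 := fun M => ⟨M, rfl, rfl⟩
  let base : R → R → SpecialLinearGroup (Fin 2) R := fun x y =>
    if h : ∃ N : SpecialLinearGroup (Fin 2) R, N 0 0 = x ∧ N 0 1 = y then h.choose else 1
  have hbase : ∀ M : SpecialLinearGroup (Fin 2) R,
      base (M 0 0) (M 0 1) 0 0 = M 0 0 ∧ base (M 0 0) (M 0 1) 0 1 = M 0 1 := by
    intro M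
    have h := hex M
    simp only [base, dif_pos h]
    exact h.choose_spec
  -- If B is the chosen matrix with the same first row as M, then M B⁻¹ is lower unitriangular, and
  -- the third coordinate is its corner entry. No entry of R needs to be invertible.
  let f : SpecialLinearGroup (Fin 2) R → R × R × R := fun M =>
    (M 0 0, M 0 1, M 1 0 * base (M 0 0) (M 0 1) 1 1 - M 1 1 * base (M 0 0) (M 0 1) 1 0)
  have hf : Function.Injective f := by
    intro M N h
    simp only [f, Prod.mk.injEq] at h
    obtain ⟨h1, h2, h3⟩ := h
    obtain ⟨b1, b2⟩ := hbase M
    rw [← h1, ← h2] at h3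
    generalize base (M 0 0) (M 0 1) = B at *
    have hB := B.2
    have hM := M.2
    have hN := N.2
    rw [Matrix.det_fin_two] at hB hM hN
    have b1' : B.1 0 0 = M.1 0 0 := b1
    have b2' : B.1 0 1 = M.1 0 1 := b2
    have h1' : N.1 0 0 = M.1 0 0 := h1.symm
    have h2' : N.1 0 1 = M.1 0 1 := h2.symm
    have h3' : M.1 1 0 * B.1 1 1 - M.1 1 1 * B.1 1 0 =
      N.1 1 0 * B.1 1 1 - N.1 1 1 * B.1 1 0 := h3
    rw [b1', b2'] at hB
    rw [h1', h2'] at hN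
    apply Subtype.ext
    ext i j
    fin_cases i <;> fin_cases j
    · exact h1'.symm
    · exact h2'.symm
    · show M.1 1 0 = N.1 1 0
      linear_combination (N.1 1 0 - M.1 1 0) * hB + M.1 0 0 * h3' + B.1 1 0 * (hM - hN)
    · show M.1 1 1 = N.1 1 1
      linear_combination (N.1 1 1 - M.1 1 1) * hB + M.1 0 1 * h3' + B.1 1 1 * (hM - hN)
  calc Nat.card (SpecialLinearGroup (Fin 2) R) ≤ Nat.card (R × R × R) :=
        Nat.card_le_card_of_injective f hf
    _ = Nat.card R ^ 3 := by rw [Nat.card_prod, Nat.card_prod]; ring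

end SL2

/-! ### The group generated by the `quot δ r s`: span of idempotents, index, elements of order p. -/

namespace SL2

open Matrix.SpecialLinearGroup

section Algebra

variable {F R : Type*} [Field F] [CommRing R] [Algebra F R]

/-- The subgroup of `SL₂(R)` generated by the matrices `quot δ r s` with `r, s ∈ Fˣ`. -/
def quotGroup (F : Type*) [Field F] [Algebra F R] (δ : R) :
    Subgroup (SpecialLinearGroup (Fin 2) R) :=
  Subgroup.closure {x | ∃ r s : Fˣ, x = quot δ (Units.map (algebraMap F R) r)
    (Units.map (algebraMap F R) s)}

lemma quot_mem_quotGroup (δ : R) (r s : Fˣ) : quot δ (Units.map (algebraMap F R) r)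
    (Units.map (algebraMap F R) s) ∈ quotGroup F δ :=
  Subgroup.subset_closure ⟨r, s, rfl⟩

lemma dil_mem_quotGroup {δ : R} (t : Fˣ) {γ : SpecialLinearGroup (Fin 2) R}
    (hγ : γ ∈ quotGroup F δ) : dil (Units.map (algebraMap F R) t) γ ∈ quotGroup F δ := by
  refine Subgroup.closure_induction (p := fun γ _ =>
    dil (Units.map (algebraMap F R : F →* R) t) γ ∈ quotGroup F δ) ?_ ?_ ?_ ?_ hγ
  · rintro _ ⟨r, s, rfl⟩
    rw [dil_quot, ← map_mul, ← map_mul]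
    exact Subgroup.subset_closure ⟨_, _, rfl⟩
  · rw [map_one]; exact one_mem _
  · intro x y _ _ hx hy
    rw [map_mul]; exact mul_mem hx hy
  · intro x _ hx
    rw [map_inv]; exact inv_mem hx

/-- The matrices `γ diag(1, t)` with `γ` in `quotGroup F δ` and `t ∈ Fˣ`. -/
def torusSet (F : Type*) [Field F] [Algebra F R] (δ : R) : Set (Matrix (Fin 2) (Fin 2) R) :=
  {x | ∃ γ ∈ quotGroup F δ, ∃ t : Fˣ, x = γ * D (algebraMap F R t)}

/-- Moving diag(1, t) past γ' replaces γ' by its dilate, which stays in the group. The set behaves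
as the product of the group with a torus normalising it. -/
lemma mul_mem_torusSet {δ : R} {x y : Matrix (Fin 2) (Fin 2) R} (hx : x ∈ torusSet F δ)
    (hy : y ∈ torusSet F δ) : x * y ∈ torusSet F δ := by
  obtain ⟨γ, hγ, t, rfl⟩ := hx
  obtain ⟨γ', hγ', t', rfl⟩ := hy
  refine ⟨γ * dil (Units.map (algebraMap F R) t) γ', mul_mem hγ (dil_mem_quotGroup t hγ'),
    t * t', ?_⟩
  have h := D_mul_coe (Units.map (algebraMap F R : F →* R) t) γ'
  simp only [Units.coe_map, MonoidHom.coe_coe] at h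
  rw [Matrix.mul_assoc, ← Matrix.mul_assoc (D _), h, coe_mul, Units.val_mul, map_mul, ← D_mul_D]
  simp only [Matrix.mul_assoc]

/-- The idempotents whose associated homologies belong to `torusSet F δ`. -/
def torusIdem (F : Type*) [Field F] [Algebra F R] (δ : R) : Set (Matrix (Fin 2) (Fin 2) R) :=
  {N | N * N = N ∧ ∀ u : Fˣ, 1 + ((u : F) - 1) • N ∈ torusSet F δ}

/-- For idempotent N the elements 1 + (u - 1)N form a multiplicative one-parameter group, acting by
u on the range of N and by 1 on its kernel. -/
lemma homology_mul {A : Type*} [Ring A] [Algebra F A] {N : A} (hN : N * N = N) (u v : F) :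
    (1 + (u - 1) • N) * (1 + (v - 1) • N) = 1 + (u * v - 1) • N := by
  simp only [add_mul, mul_add, one_mul, mul_one, smul_mul_assoc, mul_smul_comm, hN]
  module

/-- With g the homology of N, the homology of g M g⁻¹ is the g-conjugate of that of M, hence a
product of three elements of `torusSet`. -/
lemma conj_mem_torusIdem {δ : R} {N M : Matrix (Fin 2) (Fin 2) R} (hN : N ∈ torusIdem F δ)
    (hM : M ∈ torusIdem F δ) (u : Fˣ) :
    (1 + ((u : F) - 1) • N) * M * (1 + (((u⁻¹ : Fˣ) : F) - 1) • N) ∈ torusIdem F δ := by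
  have h1 := homology_mul (F := F) hN.1 ((u⁻¹ : Fˣ) : F) u
  have h2 := homology_mul (F := F) hN.1 u ((u⁻¹ : Fˣ) : F)
  have e : ((u⁻¹ : Fˣ) : F) * u = 1 := by simp
  rw [e, sub_self, zero_smul, add_zero] at h1
  rw [mul_comm, e, sub_self, zero_smul, add_zero] at h2
  have hg := hN.2 u
  have hg' := hN.2 u⁻¹
  generalize 1 + ((u : F) - 1) • N = g at *
  generalize 1 + (((u⁻¹ : Fˣ) : F) - 1) • N = g' at *
  constructor
  · calc g * M * g' * (g * M * g') = g * M * (g' * g) * M * g' := by simp only [Matrix.mul_assoc]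
      _ = g * (M * M) * g' := by rw [h1]; simp only [Matrix.mul_assoc, Matrix.one_mul]
      _ = g * M * g' := by rw [hM.1]
  · intro v
    have : 1 + ((v : F) - 1) • (g * M * g') = g * (1 + ((v : F) - 1) • M) * g' := by
      rw [Matrix.mul_add, Matrix.add_mul, Matrix.mul_one, h2, Matrix.mul_smul, Matrix.smul_mul]
    rw [this]
    exact mul_mem_torusSet (mul_mem_torusSet hg (hM.2 v)) hg'

/-- The span of `torusIdem F δ` is closed under commutators. -/
lemma commutator_mem_span {δ : R} (h2 : (2 : F) ≠ 0) (h3 : (3 : F) ≠ 0)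
    {Z Y : Matrix (Fin 2) (Fin 2) R}
    (hZ : Z ∈ Submodule.span F (torusIdem F δ)) (hY : Y ∈ Submodule.span F (torusIdem F δ)) :
    Z * Y - Y * Z ∈ Submodule.span F (torusIdem F δ) := by
  set L := Submodule.span F (torusIdem F δ) with hL
  have hconj : ∀ N ∈ torusIdem F δ, ∀ u : Fˣ, ∀ Y ∈ L,
      (1 + ((u : F) - 1) • N) * Y * (1 + (((u⁻¹ : Fˣ) : F) - 1) • N) ∈ L := by
    intro N hN u Y hY
    refine Submodule.span_induction (p := fun Y _ =>
      (1 + ((u : F) - 1) • N) * Y * (1 + (((u⁻¹ : Fˣ) : F) - 1) • N) ∈ L) ?_ ?_ ?_ ?_ hY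
    · intro M hM
      exact Submodule.subset_span (conj_mem_torusIdem hN hM u)
    · simp
    · intro x y _ _ hx hy
      generalize 1 + ((u : F) - 1) • N = g at *
      generalize 1 + (((u⁻¹ : Fˣ) : F) - 1) • N = g' at *
      rw [Matrix.mul_add, Matrix.add_mul]
      exact L.add_mem hx hy
    · intro c x _ hx
      rw [Matrix.mul_smul, Matrix.smul_mul]
      exact L.smul_mem c hx
  refine Submodule.span_induction (p := fun Z _ => Z * Y - Y * Z ∈ L) ?_ ?_ ?_ ?_ hZ
  · intro N hN
    have a1 := hconj N hN (-1) Y hY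
    have a2 := hconj N hN (Units.mk0 2 h2) Y hY
    -- Conjugating Y by the homology of parameter u changes it by (u - 1)NY + (u⁻¹ - 1)YN + (u -
    -- 1)(u⁻¹ - 1)NYN. The values u = -1 and u = 2, with weights 1 and 8, cancel NYN and leave six
    -- times the commutator.
    have key : (6 : F) • (N * Y - Y * N) =
        ((1 + (((-1 : Fˣ) : F) - 1) • N) * Y * (1 + ((((-1)⁻¹ : Fˣ) : F) - 1) • N) - Y) +
        (8 : F) • ((1 + (((Units.mk0 2 h2 : Fˣ) : F) - 1) • N) * Y *
          (1 + ((((Units.mk0 2 h2)⁻¹ : Fˣ) : F) - 1) • N) - Y) := by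
      have e1 : (8 : F) • (1 + ((((Units.mk0 2 h2)⁻¹ : Fˣ) : F) - 1) • N) =
          (8 : F) • 1 - (4 : F) • N := by
        have : (8 : F) * (2⁻¹ - 1) = -4 := by field_simp; norm_num
        rw [smul_add, smul_smul, Units.val_inv_eq_inv_val, Units.val_mk0, this]
        module
      have e2 : (((-1 : Fˣ) : F) - 1) = -2 := by simp; norm_num
      have e3 : ((((-1)⁻¹ : Fˣ) : F) - 1) = -2 := by simp; norm_num
      have e4 : (((Units.mk0 2 h2 : Fˣ) : F) - 1) = 1 := by simp; norm_num
      rw [smul_sub (8 : F), ← Matrix.mul_smul _ (8 : F), e1, e2, e3, e4]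
      simp only [add_mul, mul_add, one_mul, mul_one, smul_mul_assoc, mul_smul_comm, mul_sub,
        smul_add, smul_sub, mul_assoc]
      module
    have h6 : (6 : F) ≠ 0 := by
      have : (6 : F) = 2 * 3 := by norm_num
      rw [this]; exact mul_ne_zero h2 h3
    rw [← L.smul_mem_iff h6, key]
    exact L.add_mem (L.sub_mem a1 hY) (L.smul_mem _ (L.sub_mem a2 hY))
  · simp
  · intro x y _ _ hx hy
    have : (x + y) * Y - Y * (x + y) = (x * Y - Y * x) + (y * Y - Y * y) := by noncomm_ring
    rw [this]; exact L.add_mem hx hy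
  · intro c x _ hx
    rw [Matrix.smul_mul, Matrix.mul_smul, ← smul_sub]
    exact L.smul_mem c hx

/-- A subspace of `F[δ]` which is stable under `δ` and contains a unit is everything. -/
lemma eq_top_of_mul_mem {δ : R} (hδ : Algebra.adjoin F {δ} = ⊤) (K : Submodule F R)
    (hK : ∀ r ∈ K, δ * r ∈ K) {w : R} (hw : IsUnit w) (hwK : w ∈ K) (r : R) : r ∈ K := by
  have h : ∀ s : R, ∀ r ∈ K, s * r ∈ K := by
    intro s
    have hs : s ∈ Algebra.adjoin F {δ} := by rw [hδ]; trivial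
    refine Algebra.adjoin_induction (p := fun s _ => ∀ r ∈ K, s * r ∈ K) ?_ ?_ ?_ ?_ hs
    · rintro _ rfl r hr
      exact hK r hr
    · intro c r hr
      rw [← Algebra.smul_def]; exact K.smul_mem c hr
    · intro x y _ _ hx hy r hr
      rw [add_mul]; exact K.add_mem (hx r hr) (hy r hr)
    · intro x y _ _ hx hy r hr
      rw [mul_assoc]; exact hx _ (hy r hr)
  obtain ⟨u, rfl⟩ := hw
  have := h (r * (u⁻¹ : Rˣ)) _ hwK
  simpa [mul_assoc] using this

/-- Matrices whose trace is a scalar. -/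
def scalarTrace (F R : Type*) [Field F] [CommRing R] [Algebra F R] :
    (R × R × R × F) →ₗ[F] Matrix (Fin 2) (Fin 2) R where
  toFun x := !![x.1, x.2.1; x.2.2.1, algebraMap F R x.2.2.2 - x.1]
  map_add' x y := by
    ext i j; fin_cases i <;> fin_cases j <;> simp; ring
  map_smul' c x := by
    ext i j; fin_cases i <;> fin_cases j <;> simp [Algebra.smul_def, mul_sub]

lemma scalarTrace_injective [Nontrivial R] : Function.Injective (scalarTrace F R) := by
  rintro ⟨a, b, c, t⟩ ⟨a', b', c', t'⟩ h
  have h00 := congrFun (congrFun h 0) 0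
  have h01 := congrFun (congrFun h 0) 1
  have h10 := congrFun (congrFun h 1) 0
  have h11 := congrFun (congrFun h 1) 1
  simp only [scalarTrace, LinearMap.coe_mk, AddHom.coe_mk, Matrix.of_apply, Matrix.cons_val',
    Matrix.cons_val_zero, Matrix.cons_val_one, Matrix.cons_val_fin_one] at h00 h01 h10 h11
  subst h00 h01 h10
  rw [(algebraMap F R).injective (sub_left_injective h11)]

lemma add_fin_two (a b c d a' b' c' d' : R) : !![a, b; c, d] + !![a', b'; c', d'] =
    !![a + a', b + b'; c + c', d + d'] := by simp

lemma sub_fin_two (a b c d a' b' c' d' : R) : !![a, b; c, d] - !![a', b'; c', d'] =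
    !![a - a', b - b'; c - c', d - d'] := by simp

lemma smul_fin_two (t : F) (a b c d : R) : t • !![a, b; c, d] =
    !![algebraMap F R t * a, algebraMap F R t * b; algebraMap F R t * c, algebraMap F R t * d] := by
  simp [← Algebra.smul_def]

lemma ext_fin_two {α : Type*} {a b c d a' b' c' d' : α} (h1 : a = a') (h2 : b = b') (h3 : c = c')
    (h4 : d = d') : !![a, b; c, d] = !![a', b'; c', d'] := by rw [h1, h2, h3, h4]

/-- This idempotent comes from the generators themselves: 1 + (u - 1)N = `quot δ 1 u` · diag(1, u).
-/
lemma idem_mem_torusIdem (δ : R) : !![-δ, δ + 1; -δ, 1 + δ] ∈ torusIdem F δ := by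
  constructor
  · rw [Matrix.mul_fin_two]
    apply ext_fin_two <;> ring
  · intro u
    have hu : algebraMap F R ((u⁻¹ : Fˣ) : F) * algebraMap F R u = 1 := by
      rw [← map_mul]; simp
    refine ⟨_, quot_mem_quotGroup δ 1 u, u, ?_⟩
    rw [smul_fin_two, Matrix.one_fin_two, add_fin_two, D, map_sub, map_one, coe_quot,
      Matrix.mul_fin_two, ← map_inv, ← map_inv]
    simp only [Units.coe_map, MonoidHom.coe_coe, inv_one, Units.val_one, map_one]
    apply ext_fin_two
    · ring
    · linear_combination (δ + 1) * hu
    · ring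
    · linear_combination δ * hu

/-- The idempotents of `torusIdem F δ` span the matrices whose trace is a scalar. -/
lemma scalarTrace_mem_span {δ : R} (h2 : (2 : F) ≠ 0) (h3 : (3 : F) ≠ 0)
    (hδ : Algebra.adjoin F {δ} = ⊤) (hu : IsUnit δ) (hu' : IsUnit (δ + 1))
    (x : R × R × R × F) : scalarTrace F R x ∈ Submodule.span F (torusIdem F δ) := by
  set L := Submodule.span F (torusIdem F δ) with hL
  have comm : ∀ {Z Y}, Z ∈ L → Y ∈ L → Z * Y - Y * Z ∈ L := fun hZ hY =>
    commutator_mem_span h2 h3 hZ hY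
  have half : ∀ {Z : Matrix (Fin 2) (Fin 2) R}, (2 : F) • Z ∈ L → Z ∈ L := fun h =>
    (L.smul_mem_iff h2).1 h
  -- The homologies of this idempotent are the torus elements diag(1, u).
  have hE : (!![0, 0; 0, 1] : Matrix (Fin 2) (Fin 2) R) ∈ L := by
    refine Submodule.subset_span ⟨?_, fun u => ⟨1, one_mem _, u, ?_⟩⟩
    · rw [Matrix.mul_fin_two]
      apply ext_fin_two <;> ring
    · rw [coe_one, Matrix.one_mul, smul_fin_two, Matrix.one_fin_two, add_fin_two, D, map_sub,
        map_one]
      apply ext_fin_two <;> ring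
  have hP : !![-δ, δ + 1; -δ, 1 + δ] ∈ L := Submodule.subset_span (idem_mem_torusIdem δ)
  -- Bracketing with diag(0, 1) kills the diagonal and acts by opposite signs on the two
  -- off-diagonal entries. Doing it twice separates them.
  have hB1 : !![0, -(δ + 1); -δ, 0] ∈ L := by
    convert comm hE hP using 1
    rw [Matrix.mul_fin_two, Matrix.mul_fin_two, sub_fin_two]
    apply ext_fin_two <;> ring
  have hB2 : !![0, δ + 1; -δ, 0] ∈ L := by
    convert comm hE hB1 using 1
    rw [Matrix.mul_fin_two, Matrix.mul_fin_two, sub_fin_two]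
    apply ext_fin_two <;> ring
  have h12 : !![0, δ + 1; 0, 0] ∈ L := by
    apply half
    convert L.sub_mem hB2 hB1 using 1
    rw [smul_fin_two, sub_fin_two, map_ofNat]
    apply ext_fin_two <;> ring
  have h21 : !![0, 0; δ, 0] ∈ L := by
    convert L.sub_mem h12 hB2 using 1
    rw [sub_fin_two]
    apply ext_fin_two <;> ring
  have hH : !![δ, 0; 0, -δ] ∈ L := by
    convert L.sub_mem (L.sub_mem (L.add_mem hE h12) h21) hP using 1
    rw [add_fin_two, sub_fin_two, sub_fin_two]
    apply ext_fin_two <;> ring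
  let m12 : R →ₗ[F] Matrix (Fin 2) (Fin 2) R :=
    { toFun := fun r => !![0, r; 0, 0]
      map_add' := fun x y => by rw [add_fin_two]; apply ext_fin_two <;> ring
      map_smul' := fun c x => by
        rw [smul_fin_two, Algebra.smul_def, RingHom.id_apply]; apply ext_fin_two <;> ring }
  let m21 : R →ₗ[F] Matrix (Fin 2) (Fin 2) R :=
    { toFun := fun r => !![0, 0; r, 0]
      map_add' := fun x y => by rw [add_fin_two]; apply ext_fin_two <;> ring
      map_smul' := fun c x => by
        rw [smul_fin_two, Algebra.smul_def, RingHom.id_apply]; apply ext_fin_two <;> ring }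
  -- Bracketing with diag(δ, -δ) multiplies an off-diagonal entry by ±2δ. The attainable entries
  -- thus form a δ-stable subspace containing the unit δ + 1 (δ in the lower corner), which is all
  -- of R.
  have k12 : ∀ r : R, !![0, r; 0, 0] ∈ L := by
    refine eq_top_of_mul_mem hδ (L.comap m12) ?_ hu' h12
    intro r hr
    apply half
    show (2 : F) • !![0, δ * r; 0, 0] ∈ L
    convert comm hH (show !![0, r; 0, 0] ∈ L from hr) using 1
    rw [Matrix.mul_fin_two, Matrix.mul_fin_two, sub_fin_two, smul_fin_two, map_ofNat]
    apply ext_fin_two <;> ring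
  have k21 : ∀ r : R, !![0, 0; r, 0] ∈ L := by
    refine eq_top_of_mul_mem hδ (L.comap m21) ?_ hu h21
    intro r hr
    apply half
    show (2 : F) • !![0, 0; δ * r, 0] ∈ L
    convert comm (show !![0, 0; r, 0] ∈ L from hr) hH using 1
    rw [Matrix.mul_fin_two, Matrix.mul_fin_two, sub_fin_two, smul_fin_two, map_ofNat]
    apply ext_fin_two <;> ring
  have kH : ∀ r : R, !![r, 0; 0, -r] ∈ L := by
    intro r
    convert comm (k12 r) (k21 1) using 1
    rw [Matrix.mul_fin_two, Matrix.mul_fin_two, sub_fin_two]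
    apply ext_fin_two <;> ring
  obtain ⟨a, b, c, t⟩ := x
  convert L.add_mem (L.add_mem (kH a) (k12 b)) (L.add_mem (k21 c) (L.smul_mem t hE)) using 1
  rw [add_fin_two, smul_fin_two, add_fin_two, add_fin_two]
  apply ext_fin_two <;> ring

end Algebra

section Finite

variable {F R : Type*} [Field F] [Fintype F] [CommRing R] [Algebra F R] [Finite R]

/-- A lower bound for the order of `quotGroup F δ`. -/
lemma pow_le_card_quotGroup [Nontrivial R] {δ : R} (h2 : (2 : F) ≠ 0) (h3 : (3 : F) ≠ 0)
    (hδ : Algebra.adjoin F {δ} = ⊤) (hu : IsUnit δ) (hu' : IsUnit (δ + 1))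
    {d k : ℕ} (hR : Module.finrank F R = d) (hk : (3 * d + 1) * k + 1 < Fintype.card F) :
    (k + 1) ^ (3 * d + 1) ≤ Nat.card (quotGroup F δ) * (Fintype.card F - 1) := by
  classical
  set L := Submodule.span F (torusIdem F δ) with hL
  have hdim : 3 * d + 1 ≤ Module.finrank F L := by
    have h := LinearMap.finrank_le_finrank_of_injective
      (f := (scalarTrace F R).codRestrict L (scalarTrace_mem_span h2 h3 hδ hu hu'))
      (fun x y h => scalarTrace_injective (congrArg Subtype.val h))
    simp only [Module.finrank_prod, hR, Module.finrank_self] at h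
    omega
  -- The independent vectors are taken among the idempotents and not merely in their span, as the
  -- homologies of each one must lie in `torusSet`.
  obtain ⟨f, hf, -, hli⟩ := Submodule.exists_fun_fin_finrank_span_eq F (torusIdem F δ)
  let N : Fin (3 * d + 1) → Matrix (Fin 2) (Fin 2) R := fun i => f (Fin.castLE hdim i)
  have hN : LinearIndependent F N := hli.comp _ (Fin.castLE_injective hdim)
  let φ : quotGroup F δ × Fˣ → Matrix (Fin 2) (Fin 2) R := fun x =>
    (x.1.1 : Matrix (Fin 2) (Fin 2) R) * D (algebraMap F R x.2)
  have := Fintype.ofFinite (quotGroup F δ)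
  -- The value a = -1 is excluded because 1 + aN is the homology of parameter u = a + 1, which must
  -- be invertible.
  have key := pow_le_card_of_prod_mem (k := k) N hN (Finset.univ.erase (-1))
    (by rw [Finset.card_erase_of_mem (Finset.mem_univ _), Finset.card_univ]; omega)
    (Finset.univ.image φ) (by
      intro a ha
      have hmem : ∀ l : List (Fin (3 * d + 1)),
          (l.map fun i => 1 + a i • N i).prod ∈ torusSet F δ := by
        intro l
        induction l with
        | nil => exact ⟨1, one_mem _, 1, by simp [D, Matrix.one_fin_two]⟩
        | cons i l ih =>
          rw [List.map_cons, List.prod_cons]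
          refine mul_mem_torusSet ?_ ih
          have h1 : a i + 1 ≠ 0 := by
            have := ha i
            simp only [Finset.mem_erase, Finset.mem_univ, and_true] at this
            exact fun h => this (eq_neg_of_add_eq_zero_left h)
          have := (hf (Fin.castLE hdim i)).2 (Units.mk0 _ h1)
          simpa using this
      obtain ⟨γ, hγ, t, ht⟩ := hmem (List.finRange _)
      rw [ht]
      exact Finset.mem_image.2 ⟨(⟨γ, hγ⟩, t), Finset.mem_univ _, rfl⟩)
  refine key.trans (Finset.card_image_le.trans ?_)
  rw [Finset.card_univ, Fintype.card_prod, Nat.card_eq_fintype_card, Fintype.card_units]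

end Finite

/-- For large `p`, the group `quotGroup` contains every element of order `p`. -/
theorem mem_quotGroup_of_pow_eq_one {p : ℕ} [Fact p.Prime] (hp : 26 ^ 13 < p) {R : Type*}
    [CommRing R] [Nontrivial R] [Algebra (ZMod p) R] [Finite R] {δ : R}
    (hδ : Algebra.adjoin (ZMod p) {δ} = ⊤) (hu : IsUnit δ) (hu' : IsUnit (δ + 1))
    (hR : Module.finrank (ZMod p) R = 4) {x : SpecialLinearGroup (Fin 2) R} (hx : x ^ p = 1) :
    x ∈ quotGroup (ZMod p) δ := by
  have hpp : p.Prime := Fact.out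
  have hne : ∀ n : ℕ, 0 < n → n < p → ((n : ℕ) : ZMod p) ≠ 0 := by
    intro n h0 hn h
    exact absurd (Nat.le_of_dvd h0 ((ZMod.natCast_eq_zero_iff _ _).1 h)) (by omega)
  have hcardR : Nat.card R = p ^ 4 := by
    rw [Module.natCard_eq_pow_finrank (K := ZMod p), hR, Nat.card_zmod]
  -- Here 13 = 3·4 + 1, and k is the largest integer with 13k + 1 < p.
  have h1 := pow_le_card_quotGroup (F := ZMod p) (k := (p - 2) / 13)
    (by exact_mod_cast hne 2 (by norm_num) (by omega))
    (by exact_mod_cast hne 3 (by norm_num) (by omega)) hδ hu hu' hR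
    (by rw [ZMod.card]; omega)
  have h2 : Nat.card (SpecialLinearGroup (Fin 2) R) ≤ (p ^ 4) ^ 3 := hcardR ▸ card_le
  rw [ZMod.card] at h1
  set Γ := quotGroup (ZMod p) δ with hΓ
  have h3 := Γ.index_mul_card
  -- An index of at least p would force |Γ| ≤ p^11. Then (k + 1)^13 ≤ |Γ|(p - 1) with p ≤ 26(k + 1)
  -- gives p^13 ≤ 26^13 p^12.
  have hidx : Γ.index < p := by
    by_contra! hle
    have h4 : p * Nat.card Γ ≤ p ^ 12 :=
      calc p * Nat.card Γ ≤ Γ.index * Nat.card Γ := by gcongr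
        _ ≤ p ^ 12 := by rw [h3]; exact h2.trans (by rw [← pow_mul])
    have h5 : Nat.card Γ ≤ p ^ 11 := by
      rw [pow_succ'] at h4
      exact Nat.le_of_mul_le_mul_left h4 hpp.pos
    have h6 : p ≤ 26 * ((p - 2) / 13 + 1) := by omega
    have h7 : p ^ 13 ≤ 26 ^ 13 * p ^ 12 :=
      calc p ^ 13 ≤ (26 * ((p - 2) / 13 + 1)) ^ 13 := by gcongr
        _ = 26 ^ 13 * ((p - 2) / 13 + 1) ^ 13 := by rw [mul_pow]
        _ ≤ 26 ^ 13 * (p ^ 11 * p) := by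
          gcongr
          exact h1.trans (Nat.mul_le_mul h5 (Nat.sub_le _ _))
        _ = 26 ^ 13 * p ^ 12 := by rw [← pow_succ]
    rw [pow_succ' p 12] at h7
    exact absurd (Nat.le_of_mul_le_mul_right h7 (pow_pos hpp.pos _)) (by omega)
  -- Some power xⁿ with 0 < n ≤ index lies in Γ. Since n < p is prime to the order of x, x is itself
  -- a power of xⁿ.
  obtain ⟨n, hn0, hn, hmem⟩ := Γ.exists_pow_mem_of_index_ne_zero Subgroup.index_ne_zero_of_finite x
  have hcop : n.Coprime (orderOf x) := by
    have : n.Coprime p := (Nat.coprime_of_lt_prime (by omega) (by omega) hpp).symm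
    exact this.coprime_dvd_right (orderOf_dvd_of_pow_eq_one hx)
  obtain ⟨m, hm⟩ := exists_pow_eq_self_of_coprime hcop
  rw [← hm]
  exact pow_mem hmem m

end SL2

/-! ### Embeddings of `SL₂` over a commutative algebra of matrices into `Sp₈` -/

/-- An action of an `S`-algebra `R` on `S⁴` by operators which are self-adjoint for a
nondegenerate symmetric form with Gram matrix `e`. -/
structure SelfAdjAction (R S : Type*) [CommRing R] [CommRing S] [Algebra S R] where
  φ : R →ₐ[S] Matrix (Fin 4) (Fin 4) S
  e : Matrix (Fin 4) (Fin 4) S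
  e' : Matrix (Fin 4) (Fin 4) S
  mul_e' : e * e' = 1
  e_symm : eᵀ = e
  adj : ∀ r, (φ r)ᵀ * e = e * φ r

namespace SelfAdjAction

variable {R S : Type*} [CommRing R] [CommRing S] [Algebra S R] (T : SelfAdjAction R S)

lemma e'_mul : T.e' * T.e = 1 := mul_eq_one_comm.1 T.mul_e'

lemma e'_symm : T.e'ᵀ = T.e' := by
  have h : T.e'ᵀ * T.e = 1 := by
    rw [← T.e_symm, ← transpose_mul, T.mul_e', transpose_one]
  calc T.e'ᵀ = T.e'ᵀ * (T.e * T.e') := by rw [T.mul_e', Matrix.mul_one]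
    _ = T.e' := by rw [← Matrix.mul_assoc, h, Matrix.one_mul]

/-- Transposition becomes conjugation by e, which reduces the symplectic relations for `hom` to
commutativity of φ(R) and the determinant condition. -/
lemma φ_transpose (r : R) : (T.φ r)ᵀ = T.e * T.φ r * T.e' := by
  rw [← T.adj, Matrix.mul_assoc, T.mul_e', Matrix.mul_one]

lemma φ_comm (r s : R) : T.φ r * T.φ s = T.φ s * T.φ r := by
  rw [← map_mul, mul_comm, map_mul]

/-- The homomorphism `(x y; z w) ↦ (x y e⁻¹; e z e w e⁻¹)`. -/
def hom : SpecialLinearGroup (Fin 2) R →* Sp8 S where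
  toFun M := ⟨fromBlocks (T.φ (M.1 0 0)) (T.φ (M.1 0 1) * T.e') (T.e * T.φ (M.1 1 0))
      (T.e * T.φ (M.1 1 1) * T.e'), by
    have hdet : T.φ (M.1 0 0) * T.φ (M.1 1 1) - T.φ (M.1 1 0) * T.φ (M.1 0 1) = 1 := by
      have h := M.2
      rw [Matrix.det_fin_two] at h
      rw [← map_mul, ← map_mul, ← map_sub, mul_comm (M.1 1 0), h, map_one]
    have hee := T.e'_mul
    have c1 : ∀ X, T.e' * (T.e * X) = X := fun X => by
      rw [← Matrix.mul_assoc, hee, Matrix.one_mul]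
    rw [SymplecticGroup.fromBlocks_mem_iff]
    simp only [transpose_mul, T.φ_transpose, T.e_symm, T.e'_symm, Matrix.mul_assoc, c1, hee,
      Matrix.mul_one]
    refine ⟨?_, ?_, ?_⟩
    · rw [T.φ_comm]
    · rw [← Matrix.mul_assoc, T.φ_comm, Matrix.mul_assoc]
    · rw [← Matrix.mul_sub, ← Matrix.mul_assoc, ← Matrix.mul_assoc, ← Matrix.sub_mul, hdet,
        Matrix.one_mul, T.mul_e']⟩
  map_one' := by
    apply Subtype.ext
    simp [T.mul_e']
  map_mul' M N := by
    have hee := T.e'_mul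
    have c1 : ∀ X, T.e' * (T.e * X) = X := fun X => by
      rw [← Matrix.mul_assoc, hee, Matrix.one_mul]
    have hij : ∀ i j, (M * N).1 i j = M.1 i 0 * N.1 0 j + M.1 i 1 * N.1 1 j := fun i j => by
      show (M.1 * N.1) i j = _
      rw [Matrix.mul_apply, Fin.sum_univ_two]
    apply Subtype.ext
    rw [Submonoid.coe_mul]
    simp only [hij, Matrix.fromBlocks_multiply, map_add, map_mul, Matrix.mul_assoc, c1,
      Matrix.mul_add, Matrix.add_mul]

lemma coe_hom (M : SpecialLinearGroup (Fin 2) R) : (T.hom M).1 =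
    fromBlocks (T.φ (M.1 0 0)) (T.φ (M.1 0 1) * T.e') (T.e * T.φ (M.1 1 0))
      (T.e * T.φ (M.1 1 1) * T.e') := rfl

lemma coe_hom_low (β : R) : (T.hom (SL2.low β)).1 = fromBlocks 1 0 (T.e * T.φ β) 1 := by
  rw [coe_hom, SL2.coe_low]
  simp [T.mul_e']

lemma coe_hom_upp (β : R) : (T.hom (SL2.upp β)).1 = fromBlocks 1 (T.φ β * T.e') 0 1 := by
  rw [coe_hom, SL2.coe_upp]
  simp [T.mul_e']

end SelfAdjAction

/-! ### The generators of Γ_q as images of matrices in SL₂. -/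

namespace QuadForm8

variable (Q : QuadForm8)

/-- The discriminant matrix `Δ` over a commutative ring. -/
noncomputable def discOver (S : Type*) [CommRing S] : Matrix (Fin 4) (Fin 4) S :=
  (4 : S) • ((Q.bOver S)⁻¹ * Q.aOver S * ((Q.bOver S)⁻¹)ᵀ * Q.cOver S) - 1

variable {Q} {R S : Type*} [CommRing R] [CommRing S] [Algebra S R]

lemma det_bOver (S : Type*) [CommRing S] : (Q.bOver S).det = ((Q.b.det : ℤ) : S) := by
  simpa using ((Int.castRingHom S).map_det Q.b).symm

/-- The generators of `Γ_q` come from `SL₂`. -/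
lemma dilate_inv_mul_dilate (T : SelfAdjAction R S) (hb : IsUnit ((Q.b.det : ℤ) : S))
    (he : T.e = (2 : S) • Q.cOver S) {δ : R} (hδ : T.φ δ = Q.discOver S) (r s : Sˣ) :
    (Sp8.dilate r (Q.symplecticElement S hb))⁻¹ * Sp8.dilate s (Q.symplecticElement S hb) =
      T.hom (SL2.quot δ (Units.map (algebraMap S R) r) (Units.map (algebraMap S R) s)) := by
  rw [inv_mul_eq_iff_eq_mul]
  have hdet : IsUnit (Q.bOver S).det := by rwa [det_bOver]
  have hb1 : Q.bOver S * (Q.bOver S)⁻¹ = 1 := Matrix.mul_nonsing_inv _ hdet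
  set b := Q.bOver S
  set B := ((Q.bOver S)⁻¹)ᵀ
  set Δ := Q.discOver S with hΔ
  -- In terms of b, B = b⁻ᵀ, e and Δ, the blocks of g are -Be, B, bΔ and -b(Δ + 1)e⁻¹. Each is b or
  -- B times a polynomial in Δ, up to e on the right, so b cancels in the quotient of two dilates.
  have hA : -((2 : S) • (B * Q.cOver S)) = -(B * T.e) := by rw [he, Matrix.mul_smul]
  have hC : (4 : S) • (Q.aOver S * B * Q.cOver S) - b = b * Δ := by
    rw [hΔ, discOver, Matrix.mul_sub, Matrix.mul_smul, Matrix.mul_one]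
    simp only [← Matrix.mul_assoc]
    rw [hb1, Matrix.one_mul]
  have hD : -((2 : S) • (Q.aOver S * B)) = -(b * (Δ + 1) * T.e') := by
    have h1 : b * (Δ + 1) = (2 : S) • (Q.aOver S * B) * T.e := by
      rw [Matrix.mul_add, ← hC, he, Matrix.mul_smul, Matrix.smul_mul, smul_smul]
      norm_num
    rw [h1, Matrix.mul_assoc, T.mul_e', Matrix.mul_one]
  have e1 : (r : S) * (r⁻¹ : Sˣ) = 1 := by simp
  have hs : ∀ t : S, T.φ (algebraMap S R t) = t • 1 := fun t => by
    rw [AlgHom.commutes, Algebra.algebraMap_eq_smul_one]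
  have c1 : ∀ X, T.e' * (T.e * X) = X := fun X => by
    rw [← Matrix.mul_assoc, T.e'_mul, Matrix.one_mul]
  apply Subtype.ext
  rw [Submonoid.coe_mul]
  simp only [Sp8.dilate, symplecticElement, toBlocks_fromBlocks₁₁, toBlocks_fromBlocks₁₂,
    toBlocks_fromBlocks₂₁, toBlocks_fromBlocks₂₂, SelfAdjAction.coe_hom, SL2.coe_quot,
    Matrix.fromBlocks_multiply, Units.coe_map, MonoidHom.coe_coe, ← map_inv]
  change fromBlocks _ _ _ _ = fromBlocks _ _ _ _
  rw [hA, hC, hD]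
  simp only [Matrix.of_apply, Matrix.cons_val', Matrix.cons_val_zero, Matrix.cons_val_one,
    Matrix.cons_val_fin_one, map_add, map_sub, map_mul, map_one, hs, hδ]
  simp only [Matrix.mul_assoc, Matrix.mul_add, Matrix.add_mul, Matrix.mul_sub, Matrix.sub_mul,
    Matrix.smul_mul, Matrix.mul_smul, Matrix.mul_one, Matrix.one_mul, Matrix.neg_mul,
    c1, T.mul_e', smul_add, smul_neg, smul_smul]
  congr 1
  · linear_combination (norm := module) (-e1) • (B * (T.e * Δ))
  · linear_combination (norm := module) ((s⁻¹ : Sˣ) * e1) • (B * (T.e * (Δ * T.e')))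
  · linear_combination (norm := module) (s * e1) • (b * (Δ * Δ))
  · linear_combination (norm := module) (-e1) • (b * (Δ * (Δ * T.e')) + b * (Δ * T.e'))

end QuadForm8

/-! ### Polynomials in Δ acting on S⁴, and elementary matrices in Γ_p. -/

namespace QuadForm8

open Polynomial

variable (Q : QuadForm8) (S : Type*) [CommRing S]

/-- The product 2cΔ = 8 c b⁻¹ a b⁻ᵀ c - 2c is symmetric because a and c are. -/
lemma discOver_transpose_mul :
    (Q.discOver S)ᵀ * ((2 : S) • Q.cOver S) = ((2 : S) • Q.cOver S) * Q.discOver S := by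
  have ha : (Q.aOver S)ᵀ = Q.aOver S := by
    rw [aOver, ← Matrix.transpose_map, Q.a_symm.eq]
  have hc : (Q.cOver S)ᵀ = Q.cOver S := by
    rw [cOver, ← Matrix.transpose_map, Q.c_symm.eq]
  rw [discOver]
  simp only [transpose_sub, transpose_smul, transpose_mul, transpose_transpose, ha, hc,
    transpose_one, Matrix.sub_mul, Matrix.mul_sub, Matrix.one_mul, Matrix.mul_one,
    Matrix.smul_mul, Matrix.mul_smul, Matrix.mul_assoc]
  module

lemma aeval_discOver_transpose_mul (f : S[X]) :
    (aeval (Q.discOver S) f)ᵀ * ((2 : S) • Q.cOver S) =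
      ((2 : S) • Q.cOver S) * aeval (Q.discOver S) f := by
  induction f using Polynomial.induction_on' with
  | add p q hp hq => rw [map_add, transpose_add, Matrix.add_mul, Matrix.mul_add, hp, hq]
  | monomial n a =>
    rw [aeval_monomial, Algebra.algebraMap_eq_smul_one, smul_one_mul, transpose_smul,
      Matrix.smul_mul, Matrix.mul_smul _ a]
    congr 1
    induction n with
    | zero => simp
    | succ n ih =>
      rw [pow_succ', transpose_mul, Matrix.mul_assoc, discOver_transpose_mul, ← Matrix.mul_assoc, ih,
        Matrix.mul_assoc, ← pow_succ, ← pow_succ']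

variable {S}

/-- The action of `S[X]` through the discriminant matrix. -/
noncomputable def polyAction (hc : IsUnit ((2 : S) • Q.cOver S).det) : SelfAdjAction S[X] S where
  φ := aeval (Q.discOver S)
  e := (2 : S) • Q.cOver S
  e' := ((2 : S) • Q.cOver S)⁻¹
  mul_e' := Matrix.mul_nonsing_inv _ hc
  e_symm := by rw [transpose_smul, cOver, ← Matrix.transpose_map, Q.c_symm.eq]
  adj := Q.aeval_discOver_transpose_mul S

/-- The action of `S[X] / (χ)`, where `χ` is the characteristic polynomial of the discriminant
matrix. -/
noncomputable def rootAction (hc : IsUnit ((2 : S) • Q.cOver S).det) :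
    SelfAdjAction (AdjoinRoot (Q.discOver S).charpoly) S where
  φ := Ideal.Quotient.liftₐ (Ideal.span {(Q.discOver S).charpoly}) (aeval (Q.discOver S)) (by
    intro f hf
    obtain ⟨g, rfl⟩ := Ideal.mem_span_singleton'.1 hf
    rw [map_mul, Matrix.aeval_self_charpoly, mul_zero])
  e := (2 : S) • Q.cOver S
  e' := ((2 : S) • Q.cOver S)⁻¹
  mul_e' := Matrix.mul_nonsing_inv _ hc
  e_symm := by rw [transpose_smul, cOver, ← Matrix.transpose_map, Q.c_symm.eq]
  adj r := by
    obtain ⟨f, rfl⟩ := AdjoinRoot.mk_surjective r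
    exact Q.aeval_discOver_transpose_mul S f

variable {Q}

lemma rootAction_φ_mk (hc : IsUnit ((2 : S) • Q.cOver S).det) (f : S[X]) :
    (Q.rootAction hc).φ (AdjoinRoot.mk _ f) = aeval (Q.discOver S) f := rfl

/-- X - a divides f - f(a), so modulo f the element root - a divides the unit -f(a). -/
lemma _root_.AdjoinRoot.isUnit_root_sub {F : Type*} [Field F] (f : F[X]) (a : F)
    (ha : f.eval a ≠ 0) : IsUnit (AdjoinRoot.root f - algebraMap F (AdjoinRoot f) a) := by
  obtain ⟨g, hg⟩ := Polynomial.X_sub_C_dvd_sub_C_eval (a := a) (p := f)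
  have h := congrArg (AdjoinRoot.mk f) hg
  rw [map_sub, AdjoinRoot.mk_self, map_mul, map_sub, AdjoinRoot.mk_X, AdjoinRoot.mk_C,
    AdjoinRoot.mk_C, zero_sub] at h
  refine isUnit_of_mul_isUnit_left (y := AdjoinRoot.mk f g) ?_
  rw [AdjoinRoot.algebraMap_eq, ← h]
  exact ((isUnit_iff_ne_zero.2 ha).map (AdjoinRoot.of f)).neg

/-- Modulo a large prime, `Γ_p` contains the images of the elementary matrices. -/
theorem low_upp_mem_Gam {p : ℕ} [Fact p.Prime] (hp : 26 ^ 13 < p)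
    (hb : IsUnit ((Q.b.det : ℤ) : ZMod p)) (hc : IsUnit ((2 : ZMod p) • Q.cOver (ZMod p)).det)
    (h0 : (Q.discOver (ZMod p)).det ≠ 0) (h1 : (Q.discOver (ZMod p) + 1).det ≠ 0)
    (β : (ZMod p)[X]) :
    (Q.polyAction hc).hom (SL2.low β) ∈ Q.Gam p hb ∧
      (Q.polyAction hc).hom (SL2.upp β) ∈ Q.Gam p hb := by
  set χ := (Q.discOver (ZMod p)).charpoly with hχ
  have hmonic : χ.Monic := Matrix.charpoly_monic _
  have hdeg : χ.natDegree = 4 := by rw [hχ, Matrix.charpoly_natDegree_eq_dim]; rfl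
  have hne : χ ≠ 0 := hmonic.ne_zero
  have : Module.Finite (ZMod p) (AdjoinRoot χ) := (AdjoinRoot.powerBasis hne).finite
  have hfin : Finite (AdjoinRoot χ) := Module.finite_of_finite (ZMod p)
  have hrank : Module.finrank (ZMod p) (AdjoinRoot χ) = 4 := by
    rw [(AdjoinRoot.powerBasis hne).finrank, AdjoinRoot.powerBasis_dim, hdeg]
  have : Nontrivial (AdjoinRoot χ) := Module.nontrivial_of_finrank_pos (R := ZMod p) (by omega)
  have hadj : Algebra.adjoin (ZMod p) {AdjoinRoot.root χ} = ⊤ := AdjoinRoot.adjoinRoot_eq_top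
  -- Up to sign, χ(0) is det Δ and χ(-1) is det(Δ + 1). Both are nonzero, so δ and δ + 1 are units.
  have hu : IsUnit (AdjoinRoot.root χ) := by
    have := AdjoinRoot.isUnit_root_sub χ 0 (by
      rw [hχ, Matrix.eval_charpoly]
      simpa [Matrix.det_neg] using h0)
    simpa using this
  have hu' : IsUnit (AdjoinRoot.root χ + 1) := by
    have := AdjoinRoot.isUnit_root_sub χ (-1) (by
      rw [hχ, Matrix.eval_charpoly, map_neg, map_one, ← neg_add', Matrix.det_neg, add_comm]
      simpa using h1)
    simpa using this
  have hle : SL2.quotGroup (ZMod p) (AdjoinRoot.root χ) ≤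
      (Q.Gam p hb).comap (Q.rootAction hc).hom := by
    rw [SL2.quotGroup, Subgroup.closure_le]
    rintro _ ⟨r, s, rfl⟩
    refine Subgroup.subset_closure ⟨r, s, ?_⟩
    symm
    refine dilate_inv_mul_dilate _ hb rfl ?_ r s
    rw [← AdjoinRoot.mk_X, rootAction_φ_mk, aeval_X]
  -- In characteristic p the elementary matrices satisfy xᵖ = 1.
  have hpR : ((p : ℕ) : AdjoinRoot χ) = 0 := by
    rw [← map_natCast (algebraMap (ZMod p) (AdjoinRoot χ)), ZMod.natCast_self, map_zero]
  have hlow := hle (SL2.mem_quotGroup_of_pow_eq_one hp hadj hu hu' hrank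
    (x := SL2.low (AdjoinRoot.mk χ β)) (by
      rw [SL2.low_pow, hpR, zero_mul, SL2.low_zero]))
  have hupp := hle (SL2.mem_quotGroup_of_pow_eq_one hp hadj hu hu' hrank
    (x := SL2.upp (AdjoinRoot.mk χ β)) (by
      rw [SL2.upp_pow, hpR, zero_mul, SL2.upp_zero]))
  constructor
  -- The finite ring S[X]/(χ) serves for counting, while S[X] is compatible with reduction from q to
  -- p. On an elementary matrix the two homomorphisms agree, since the image depends only on β(Δ).
  · have h : (Q.polyAction hc).hom (SL2.low β) =
        (Q.rootAction hc).hom (SL2.low (AdjoinRoot.mk χ β)) := Subtype.ext <|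
      (SelfAdjAction.coe_hom_low _ _).trans (SelfAdjAction.coe_hom_low _ _).symm
    rw [h]; exact hlow
  · have h : (Q.polyAction hc).hom (SL2.upp β) =
        (Q.rootAction hc).hom (SL2.upp (AdjoinRoot.mk χ β)) := Subtype.ext <|
      (SelfAdjAction.coe_hom_upp _ _).trans (SelfAdjAction.coe_hom_upp _ _).symm
    rw [h]; exact hupp

end QuadForm8

/-! ### Reduction modulo prime factors -/

namespace ZMod

variable {q : ℕ}

lemma eq_of_castHom_eq (hq : Squarefree q) {x y : ZMod q}
    (h : ∀ p (_ : p.Prime) (hpq : p ∣ q),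
      ZMod.castHom hpq (ZMod p) x = ZMod.castHom hpq (ZMod p) y) : x = y := by
  have : NeZero q := ⟨hq.ne_zero⟩
  rw [← sub_eq_zero]
  obtain ⟨n, hn⟩ := ZMod.natCast_zmod_surjective (x - y)
  rw [← hn, ZMod.natCast_eq_zero_iff, ← Nat.prod_primeFactors_of_squarefree hq]
  refine Finset.prod_primes_dvd n (fun p hp => (Nat.prime_of_mem_primeFactors hp).prime) ?_
  intro p hp
  have hpq := Nat.dvd_of_mem_primeFactors hp
  have h1 := h p (Nat.prime_of_mem_primeFactors hp) hpq
  rw [← sub_eq_zero, ← map_sub, ← hn, map_natCast, ZMod.natCast_eq_zero_iff] at h1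
  exact h1

lemma exists_castHom_eq [NeZero q] (a : ∀ p : ℕ, ZMod p) :
    ∃ x : ZMod q, ∀ p (_ : p.Prime) (hpq : p ∣ q), ZMod.castHom hpq (ZMod p) x = a p := by
  obtain ⟨k, hk⟩ := Nat.chineseRemainderOfFinset (fun p => (a p).val) id q.primeFactors
    (fun p hp => (Nat.prime_of_mem_primeFactors hp).ne_zero) (by
      intro p hp p' hp' hne
      exact (Nat.coprime_primes (Nat.prime_of_mem_primeFactors hp)
        (Nat.prime_of_mem_primeFactors hp')).2 hne)
  refine ⟨k, fun p hp hpq => ?_⟩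
  have : NeZero p := ⟨hp.ne_zero⟩
  have h := (ZMod.natCast_eq_natCast_iff _ _ _).2
    (hk p (Nat.mem_primeFactors.2 ⟨hp, hpq, NeZero.ne q⟩))
  rw [map_natCast]
  simpa using h

lemma exists_unit_castHom_eq (hq : Squarefree q) (a : ∀ p : ℕ, (ZMod p)ˣ) :
    ∃ x : (ZMod q)ˣ, ∀ p (_ : p.Prime) (hpq : p ∣ q),
      Units.map (ZMod.castHom hpq (ZMod p) : ZMod q →* ZMod p) x = a p := by
  have : NeZero q := ⟨hq.ne_zero⟩
  obtain ⟨x, hx⟩ := exists_castHom_eq (q := q) fun p => ((a p : (ZMod p)ˣ) : ZMod p)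
  obtain ⟨y, hy⟩ := exists_castHom_eq (q := q) fun p => (((a p)⁻¹ : (ZMod p)ˣ) : ZMod p)
  have hxy : x * y = 1 := eq_of_castHom_eq hq fun p hp hpq => by
    rw [map_mul, hx p hp, hy p hp, map_one, Units.mul_inv]
  exact ⟨⟨x, y, hxy, by rw [mul_comm, hxy]⟩, fun p hp hpq => Units.ext (hx p hp hpq)⟩

end ZMod

namespace Sp8

variable {S S' : Type*} [CommRing S'] [CommRing S]

/-- Functoriality of `Sp₈`. -/
def map (f : S →+* S') : Sp8 S →* Sp8 S' where
  toFun γ := ⟨f.mapMatrix γ.1, by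
    have h := congrArg f.mapMatrix (SymplecticGroup.mem_iff.1 γ.2)
    have hJ : f.mapMatrix (Matrix.J (Fin 4) S) = Matrix.J (Fin 4) S' := by
      ext (i | i) (j | j) <;> simp [Matrix.J, Matrix.one_apply, apply_ite f]
    have ht : f.mapMatrix γ.1ᵀ = (f.mapMatrix γ.1)ᵀ := rfl
    rw [map_mul, map_mul, hJ, ht] at h
    exact SymplecticGroup.mem_iff.2 h⟩
  map_one' := Subtype.ext (map_one _)
  map_mul' x y := Subtype.ext (map_mul _ _ _)

lemma coe_map (f : S →+* S') (γ : Sp8 S) : (map f γ).1 = f.mapMatrix γ.1 := rfl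

lemma map_dilate (f : S →+* S') (r : Sˣ) (γ : Sp8 S) :
    map f (dilate r γ) = dilate (Units.map (f : S →* S') r) (map f γ) := by
  apply Subtype.ext
  rw [coe_map]
  ext (i | i) (j | j) <;> simp [dilate, coe_map, toBlocks₁₁, toBlocks₁₂, toBlocks₂₁, toBlocks₂₂, ← map_inv]

end Sp8

namespace QuadForm8

open Polynomial

variable {Q : QuadForm8} {S S' : Type*} [CommRing S] [CommRing S']

lemma mapMatrix_cast (f : S →+* S') (M : Matrix (Fin 4) (Fin 4) ℤ) :
    f.mapMatrix (M.map (Int.cast : ℤ → S)) = M.map (Int.cast : ℤ → S') := by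
  ext i j; simp

lemma mapMatrix_smul (f : S →+* S') (t : S) (M : Matrix (Fin 4) (Fin 4) S) :
    f.mapMatrix (t • M) = f t • f.mapMatrix M := by
  ext i j; simp

lemma mapMatrix_transpose (f : S →+* S') (M : Matrix (Fin 4) (Fin 4) S) :
    f.mapMatrix Mᵀ = (f.mapMatrix M)ᵀ := rfl

lemma mapMatrix_inv_bOver (f : S →+* S') (hb : IsUnit ((Q.b.det : ℤ) : S)) :
    f.mapMatrix (Q.bOver S)⁻¹ = (Q.bOver S')⁻¹ := by
  symm
  apply Matrix.inv_eq_right_inv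
  rw [bOver, ← mapMatrix_cast f, ← map_mul, Matrix.mul_nonsing_inv _ (by rwa [det_bOver]), map_one]

lemma mapMatrix_discOver (f : S →+* S') (hb : IsUnit ((Q.b.det : ℤ) : S)) :
    f.mapMatrix (Q.discOver S) = Q.discOver S' := by
  rw [discOver, discOver, map_sub, map_one, mapMatrix_smul, map_mul, map_mul, map_mul,
    mapMatrix_transpose, mapMatrix_inv_bOver f hb, mapMatrix_cast, mapMatrix_cast, map_ofNat]

lemma mapMatrix_aeval_discOver (f : S →+* S') (hb : IsUnit ((Q.b.det : ℤ) : S)) (β : S[X]) :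
    f.mapMatrix (aeval (Q.discOver S) β) = aeval (Q.discOver S') (β.map f) := by
  rw [← mapMatrix_discOver f hb, aeval_def, aeval_def, hom_eval₂, eval₂_map]
  congr 1
  ext t i j
  by_cases hij : i = j <;> simp [Algebra.algebraMap_eq_smul_one, hij]

lemma map_symplecticElement (f : S →+* S') (hb : IsUnit ((Q.b.det : ℤ) : S))
    (hb' : IsUnit ((Q.b.det : ℤ) : S')) :
    Sp8.map f (Q.symplecticElement S hb) = Q.symplecticElement S' hb' := by
  have hM : ∀ A B C D : Matrix (Fin 4) (Fin 4) S, f.mapMatrix (fromBlocks A B C D) =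
      fromBlocks (f.mapMatrix A) (f.mapMatrix B) (f.mapMatrix C) (f.mapMatrix D) := fun A B C D =>
    Matrix.fromBlocks_map _ _ _ _ _
  apply Subtype.ext
  rw [Sp8.coe_map]
  simp only [symplecticElement, hM, map_sub, map_neg, mapMatrix_smul, map_mul,
    mapMatrix_transpose, mapMatrix_inv_bOver f hb, mapMatrix_cast, map_ofNat]

lemma isUnit_cast {p q : ℕ} (hpq : p ∣ q) {n : ℤ} (hb : IsUnit ((n : ℤ) : ZMod q)) :
    IsUnit ((n : ℤ) : ZMod p) := by
  simpa using hb.map (ZMod.castHom hpq (ZMod p))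

/-- Elements of `Γ_p` lift to elements of `Γ_q` which are trivial modulo the other primes. -/
lemma exists_lift_mem_Gam {q : ℕ} (hq : Squarefree q) (hb : IsUnit ((Q.b.det : ℤ) : ZMod q))
    {p : ℕ} (hp : p.Prime) (hpq : p ∣ q) {γ : Sp8 (ZMod p)}
    (hγ : γ ∈ Q.Gam p (isUnit_cast hpq hb)) :
    ∃ γ' ∈ Q.Gam q hb, Sp8.map (ZMod.castHom hpq (ZMod p)) γ' = γ ∧
      ∀ p' (_ : p'.Prime) (hp'q : p' ∣ q), p' ≠ p →
        Sp8.map (ZMod.castHom hp'q (ZMod p')) γ' = 1 := by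
  -- Lifting r by 1 at all other primes makes the lifted generator a quotient of two equal dilates
  -- there, hence trivial.
  have hunit : ∀ r : (ZMod p)ˣ, ∃ r' : (ZMod q)ˣ,
      Units.map (ZMod.castHom hpq (ZMod p) : ZMod q →* ZMod p) r' = r ∧
      ∀ p' (_ : p'.Prime) (hp'q : p' ∣ q), p' ≠ p →
        Units.map (ZMod.castHom hp'q (ZMod p') : ZMod q →* ZMod p') r' = 1 := by
    intro r
    obtain ⟨r', hr'⟩ := ZMod.exists_unit_castHom_eq hq fun p' =>
      if h : p' = p then h ▸ r else 1
    exact ⟨r', by simpa using hr' p hp hpq, fun p' hp' hp'q hne => by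
      simpa [hne] using hr' p' hp' hp'q⟩
  refine Subgroup.closure_induction (p := fun γ _ => ∃ γ' ∈ Q.Gam q hb,
    Sp8.map (ZMod.castHom hpq (ZMod p)) γ' = γ ∧
      ∀ p' (_ : p'.Prime) (hp'q : p' ∣ q), p' ≠ p →
        Sp8.map (ZMod.castHom hp'q (ZMod p')) γ' = 1) ?_ ?_ ?_ ?_ hγ
  · rintro _ ⟨r, s, rfl⟩
    obtain ⟨r', hr, hr1⟩ := hunit r
    obtain ⟨s', hs, hs1⟩ := hunit s
    refine ⟨_, Subgroup.subset_closure ⟨r', s', rfl⟩, ?_, ?_⟩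
    · rw [map_mul, map_inv, Sp8.map_dilate, Sp8.map_dilate, hr, hs,
        map_symplecticElement _ hb (isUnit_cast hpq hb)]
    · intro p' hp' hp'q hne
      rw [map_mul, map_inv, Sp8.map_dilate, Sp8.map_dilate, hr1 p' hp' hp'q hne,
        hs1 p' hp' hp'q hne, inv_mul_cancel]
  · exact ⟨1, one_mem _, map_one _, fun _ _ _ _ => map_one _⟩
  · rintro x y _ _ ⟨x', hx, hx1, hx2⟩ ⟨y', hy, hy1, hy2⟩
    refine ⟨x' * y', mul_mem hx hy, by rw [map_mul, hx1, hy1], fun p' hp' hp'q hne => ?_⟩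
    rw [map_mul, hx2 p' hp' hp'q hne, hy2 p' hp' hp'q hne, one_mul]
  · rintro x _ ⟨x', hx, hx1, hx2⟩
    refine ⟨x'⁻¹, inv_mem hx, by rw [map_inv, hx1], fun p' hp' hp'q hne => ?_⟩
    rw [map_inv, hx2 p' hp' hp'q hne, inv_one]

/-- Membership in `Γ_q` can be checked modulo the prime factors of `q`. -/
theorem mem_Gam_of_forall_prime {q : ℕ} (hq : Squarefree q)
    (hb : IsUnit ((Q.b.det : ℤ) : ZMod q)) {γ : Sp8 (ZMod q)}
    (hγ : ∀ p (_ : p.Prime) (hpq : p ∣ q),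
      Sp8.map (ZMod.castHom hpq (ZMod p)) γ ∈ Q.Gam p (isUnit_cast hpq hb)) :
    γ ∈ Q.Gam q hb := by
  -- The element γ is assembled one prime at a time, multiplying by lifts that are trivial modulo
  -- the other primes.
  have key : ∀ s : Finset ℕ, s ⊆ q.primeFactors → ∃ γ' ∈ Q.Gam q hb,
      ∀ p (_ : p.Prime) (hpq : p ∣ q), Sp8.map (ZMod.castHom hpq (ZMod p)) γ' =
        if p ∈ s then Sp8.map (ZMod.castHom hpq (ZMod p)) γ else 1 := by
    intro s
    induction s using Finset.induction_on with
    | empty => exact fun _ => ⟨1, one_mem _, fun p _ _ => by simp⟩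
    | insert p₀ s hps ih =>
      intro hs
      obtain ⟨γ', hγ', h1⟩ := ih ((Finset.subset_insert _ _).trans hs)
      have hp₀ := Nat.mem_primeFactors.1 (hs (Finset.mem_insert_self _ _))
      obtain ⟨g, hg, hg1, hg2⟩ := exists_lift_mem_Gam hq hb hp₀.1 hp₀.2.1 (hγ p₀ hp₀.1 hp₀.2.1)
      refine ⟨γ' * g, mul_mem hγ' hg, fun p hp hpq => ?_⟩
      rw [map_mul, h1 p hp hpq]
      by_cases hpp : p = p₀
      · subst hpp
        rw [if_neg hps, hg1, if_pos (Finset.mem_insert_self _ _), one_mul]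
      · rw [hg2 p hp hpq hpp, mul_one]
        simp [Finset.mem_insert, hpp]
  obtain ⟨γ', hγ', h1⟩ := key _ subset_rfl
  have : γ' = γ := by
    apply Subtype.ext
    ext i j
    refine ZMod.eq_of_castHom_eq hq fun p hp hpq => ?_
    have h := h1 p hp hpq
    rw [if_pos (Nat.mem_primeFactors.2 ⟨hp, hpq, hq.ne_zero⟩)] at h
    exact congrFun (congrFun (congrArg Subtype.val h) i) j
  exact this ▸ hγ'

/-- If all prime factors of `q` are large, then `Γ_q` contains the images of the elementary
matrices. -/
theorem low_upp_mem_Gam_of_squarefree {q : ℕ} (hq : Squarefree q)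
    (hb : IsUnit ((Q.b.det : ℤ) : ZMod q)) (hc : IsUnit ((2 : ZMod q) • Q.cOver (ZMod q)).det)
    (hlarge : ∀ p : ℕ, p.Prime → p ∣ q → 26 ^ 13 < p)
    (h0 : ∀ p : ℕ, p.Prime → p ∣ q → (Q.discOver (ZMod p)).det ≠ 0)
    (h1 : ∀ p : ℕ, p.Prime → p ∣ q → (Q.discOver (ZMod p) + 1).det ≠ 0) (β : (ZMod q)[X]) :
    (Q.polyAction hc).hom (SL2.low β) ∈ Q.Gam q hb ∧
      (Q.polyAction hc).hom (SL2.upp β) ∈ Q.Gam q hb := by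
  have hM : ∀ {S S' : Type} [CommRing S] [CommRing S'] (f : S →+* S')
      (A B C D : Matrix (Fin 4) (Fin 4) S), f.mapMatrix (fromBlocks A B C D) =
      fromBlocks (f.mapMatrix A) (f.mapMatrix B) (f.mapMatrix C) (f.mapMatrix D) :=
    fun f A B C D => Matrix.fromBlocks_map _ _ _ _ _
  have hcp : ∀ {p : ℕ} (hpq : p ∣ q), IsUnit ((2 : ZMod p) • Q.cOver (ZMod p)).det := by
    intro p hpq
    have h := hc.map (ZMod.castHom hpq (ZMod p))
    rwa [RingHom.map_det, mapMatrix_smul, mapMatrix_cast, map_ofNat] at h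
  have he' : ∀ {p : ℕ} (hpq : p ∣ q),
      (ZMod.castHom hpq (ZMod p)).mapMatrix (Q.polyAction hc).e' =
        (Q.polyAction (hcp hpq)).e' := by
    intro p hpq
    symm
    apply Matrix.inv_eq_right_inv
    have h := congrArg (ZMod.castHom hpq (ZMod p)).mapMatrix (Q.polyAction hc).mul_e'
    have e1 : (Q.polyAction hc).e = (2 : ZMod q) • Q.cOver (ZMod q) := rfl
    rwa [map_mul, map_one, e1, mapMatrix_smul, mapMatrix_cast, map_ofNat] at h
  have he : ∀ {p : ℕ} (hpq : p ∣ q),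
      (ZMod.castHom hpq (ZMod p)).mapMatrix (Q.polyAction hc).e = (Q.polyAction (hcp hpq)).e := by
    intro p hpq
    have e1 : (Q.polyAction hc).e = (2 : ZMod q) • Q.cOver (ZMod q) := rfl
    rw [e1, mapMatrix_smul, mapMatrix_cast, map_ofNat]
    rfl
  have hφ : ∀ {p : ℕ} (hpq : p ∣ q),
      (ZMod.castHom hpq (ZMod p)).mapMatrix ((Q.polyAction hc).φ β) =
        (Q.polyAction (hcp hpq)).φ (β.map (ZMod.castHom hpq (ZMod p))) := fun hpq =>
    mapMatrix_aeval_discOver _ hb β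
  constructor
  · refine mem_Gam_of_forall_prime hq hb fun p hp hpq => ?_
    have : Fact p.Prime := ⟨hp⟩
    have h := (low_upp_mem_Gam (hlarge p hp hpq) (isUnit_cast hpq hb) (hcp hpq) (h0 p hp hpq)
      (h1 p hp hpq) (β.map (ZMod.castHom hpq (ZMod p)))).1
    suffices e : Sp8.map (ZMod.castHom hpq (ZMod p)) ((Q.polyAction hc).hom (SL2.low β)) =
        (Q.polyAction (hcp hpq)).hom (SL2.low (β.map (ZMod.castHom hpq (ZMod p)))) by
      rwa [e]
    apply Subtype.ext
    rw [Sp8.coe_map, SelfAdjAction.coe_hom_low, SelfAdjAction.coe_hom_low, hM, map_mul, he hpq,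
      hφ hpq, map_one, map_zero]
  · refine mem_Gam_of_forall_prime hq hb fun p hp hpq => ?_
    have : Fact p.Prime := ⟨hp⟩
    have h := (low_upp_mem_Gam (hlarge p hp hpq) (isUnit_cast hpq hb) (hcp hpq) (h0 p hp hpq)
      (h1 p hp hpq) (β.map (ZMod.castHom hpq (ZMod p)))).2
    suffices e : Sp8.map (ZMod.castHom hpq (ZMod p)) ((Q.polyAction hc).hom (SL2.upp β)) =
        (Q.polyAction (hcp hpq)).hom (SL2.upp (β.map (ZMod.castHom hpq (ZMod p)))) by
      rwa [e]
    apply Subtype.ext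
    rw [Sp8.coe_map, SelfAdjAction.coe_hom_upp, SelfAdjAction.coe_hom_upp, hM, map_mul, he' hpq,
      hφ hpq, map_one, map_zero]

end QuadForm8

/-! ### Self-adjoint matrices with separable characteristic polynomial -/

namespace Matrix

open Polynomial

variable {n K : Type*} [Fintype n] [DecidableEq n] [Field K]

/-- A vector isotropic for all the forms `xᵀ e Δᵏ y` vanishes, when `Δ` is self-adjoint for the
nondegenerate symmetric form `e` and diagonalizable with distinct eigenvalues. -/
lemma eq_zero_of_isotropic_of_diagonalization {m : ℕ} {e Δ P : Matrix (Fin m) (Fin m) K}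
    {μ : Fin m → K} (hμ : Function.Injective μ) (he : IsUnit e.det) (hP : IsUnit P.det)
    (hadj : Δᵀ * e = e * Δ) (hΔ : Δ * P = P * diagonal μ) (x : Fin m → K)
    (hx : ∀ k : ℕ, x ⬝ᵥ ((e * Δ ^ k) *ᵥ x) = 0) : x = 0 := by
  -- Gram matrix of e in an eigenbasis. Self-adjointness makes it commute with diag(μ), so it is
  -- diagonal because the μᵢ are distinct.
  set G := Pᵀ * e * P with hG
  have hcomm : diagonal μ * G = G * diagonal μ := by
    have h1 : diagonal μ * Pᵀ = Pᵀ * Δᵀ := by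
      rw [← transpose_mul, hΔ, transpose_mul, diagonal_transpose]
    calc diagonal μ * G = (diagonal μ * Pᵀ) * e * P := by simp only [hG, Matrix.mul_assoc]
      _ = Pᵀ * (Δᵀ * e) * P := by rw [h1]; simp only [Matrix.mul_assoc]
      _ = Pᵀ * e * (Δ * P) := by rw [hadj]; simp only [Matrix.mul_assoc]
      _ = G * diagonal μ := by rw [hΔ]; simp only [hG, Matrix.mul_assoc]
  have hdiag : G = diagonal fun i => G i i := by
    ext i j
    by_cases hij : i = j
    · subst hij; simp
    · rw [diagonal_apply_ne _ hij]
      have h := congrFun (congrFun hcomm i) j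
      rw [diagonal_mul, mul_diagonal] at h
      have h2 : (μ i - μ j) * G i j = 0 := by linear_combination h
      exact (mul_eq_zero.1 h2).resolve_left (sub_ne_zero.2 fun h => hij (hμ h))
  have hGdet : G.det ≠ 0 := by
    rw [hG, det_mul, det_mul, det_transpose]
    exact mul_ne_zero (mul_ne_zero hP.ne_zero he.ne_zero) hP.ne_zero
  have hGi : ∀ i, G i i ≠ 0 := by
    rw [hdiag, det_diagonal] at hGdet
    exact fun i => Finset.prod_ne_zero_iff.1 hGdet i (Finset.mem_univ i)
  obtain ⟨c, hxc⟩ : ∃ c, x = P *ᵥ c :=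
    ⟨P⁻¹ *ᵥ x, by rw [mulVec_mulVec, mul_nonsing_inv _ hP, one_mulVec]⟩
  have hpow : ∀ k, Δ ^ k * P = P * diagonal (fun i => μ i ^ k) := by
    intro k
    induction k with
    | zero => simp
    | succ k ih =>
      rw [pow_succ', Matrix.mul_assoc, ih, ← Matrix.mul_assoc, hΔ, Matrix.mul_assoc,
        diagonal_mul_diagonal]
      simp only [pow_succ']
  -- In eigen-coordinates c, isotropy is a Vandermonde system for the numbers Gⱼⱼ cⱼ², and Gⱼⱼ ≠ 0
  -- by nondegeneracy.
  have hsum : ∀ k : Fin m, ∑ j, (G j j * c j ^ 2) * μ j ^ (k : ℕ) = 0 := by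
    intro k
    have h1 : x ⬝ᵥ ((e * Δ ^ (k : ℕ)) *ᵥ x) = c ⬝ᵥ ((G * diagonal (fun i => μ i ^ (k : ℕ))) *ᵥ c) := by
      rw [hxc, mulVec_mulVec, Matrix.mul_assoc, hpow,
        show P *ᵥ c = c ᵥ* Pᵀ from (vecMul_transpose P c).symm, ← dotProduct_mulVec, mulVec_mulVec]
      simp only [hG, Matrix.mul_assoc]
    rw [← hx k, h1, hdiag, diagonal_mul_diagonal]
    simp only [dotProduct, mulVec_diagonal]
    exact Finset.sum_congr rfl fun i _ => by simp; ring
  have hv := Matrix.eq_zero_of_forall_pow_sum_mul_pow_eq_zero hμ hsum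
  have hc0 : c = 0 := by
    ext i
    have := congrFun hv i
    simpa [hGi i] using this
  rw [hxc, hc0, mulVec_zero]

/-- A vector isotropic for all the forms `xᵀ e Δᵏ y` vanishes, when `Δ` is self-adjoint for the
nondegenerate symmetric form `e` and has separable characteristic polynomial. -/
theorem eq_zero_of_isotropic {m : ℕ} {e Δ : Matrix (Fin m) (Fin m) K}
    (he : IsUnit e.det) (hadj : Δᵀ * e = e * Δ) (hsep : Δ.charpoly.Separable) (x : Fin m → K)
    (hx : ∀ k : ℕ, x ⬝ᵥ ((e * Δ ^ k) *ᵥ x) = 0) : x = 0 := by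
  classical
  set L := AlgebraicClosure K
  set f := algebraMap K L with hf
  have hcard : Fintype.card (Δ.charpoly.rootSet L) = m := by
    rw [(card_rootSet_eq_natDegree_iff_of_splits (charpoly_monic Δ).ne_zero
      (IsAlgClosed.splits _)).2 hsep, charpoly_natDegree_eq_dim, Fintype.card_fin]
  let ε := Fintype.equivFinOfCardEq hcard
  let μ : Fin m → L := fun i => (ε.symm i : L)
  have hμ : Function.Injective μ := Subtype.val_injective.comp ε.symm.injective
  have hmap : ∀ M : Matrix (Fin m) (Fin m) K, f.mapMatrix M = M.map f := fun _ => rfl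
  have hev : ∀ i, ∃ v : Fin m → L, v ≠ 0 ∧ (Δ.map f) *ᵥ v = μ i • v := by
    intro i
    have h1 := (mem_rootSet.1 (ε.symm i).2).2
    rw [aeval_def, ← eval_map, ← charpoly_map, eval_charpoly] at h1
    obtain ⟨v, hv, hv0⟩ := Matrix.exists_mulVec_eq_zero_iff.2 h1
    refine ⟨v, hv, ?_⟩
    rw [sub_mulVec, sub_eq_zero] at hv0
    rw [← hv0]
    ext j
    simp [Matrix.scalar_apply, mulVec_diagonal, μ]
  choose v hv0 hv using hev
  let P : Matrix (Fin m) (Fin m) L := (Matrix.of v)ᵀ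
  have hli : LinearIndependent L v := by
    refine Module.End.eigenvectors_linearIndependent' (Matrix.toLin' (Δ.map f)) μ hμ v fun i => ?_
    rw [Module.End.hasEigenvector_iff, Module.End.mem_eigenspace_iff]
    exact ⟨by simpa using hv i, hv0 i⟩
  have hP : IsUnit P.det := by
    rw [det_transpose, ← isUnit_iff_isUnit_det]
    exact Matrix.linearIndependent_rows_iff_isUnit.1 hli
  have hΔ : Δ.map f * P = P * diagonal μ := by
    ext a i
    have h := congrFun (hv i) a
    rw [mul_diagonal, mul_apply]
    simpa [P, mulVec, dotProduct, mul_comm] using h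
  have h0 := eq_zero_of_isotropic_of_diagonalization (e := e.map f) (x := f ∘ x) hμ
    (by
      rw [← hmap, ← RingHom.map_det]
      exact he.map f) hP
    (by
      rw [← hmap, ← hmap]
      have := congrArg f.mapMatrix hadj
      rwa [map_mul, map_mul] at this) hΔ
    (by
      intro k
      have h := congrArg f (hx k)
      rw [map_zero, RingHom.map_dotProduct] at h
      rw [← h, ← hmap, ← hmap, ← map_pow, ← map_mul]
      congr 1
      ext i
      rw [Function.comp_apply, RingHom.map_mulVec]
      rfl)
  ext i
  have := congrFun h0 i
  simpa [hf] using this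

end Matrix

namespace Polynomial

/-- A separable integral polynomial remains separable modulo almost all primes. -/
lemma exists_separable_map_zmod (χ : ℤ[X]) (h : (χ.map (Int.castRingHom ℚ)).Separable) :
    ∃ N : ℤ, N ≠ 0 ∧ ∀ (p : ℕ) [Fact p.Prime], ((N : ℤ) : ZMod p) ≠ 0 →
      (χ.map (Int.castRingHom (ZMod p))).Separable := by
  obtain ⟨u, v, huv⟩ := h
  obtain ⟨b, hb, hu⟩ := IsLocalization.integerNormalization_spec (nonZeroDivisors ℤ) u
  obtain ⟨b', hb', hv⟩ := IsLocalization.integerNormalization_spec (nonZeroDivisors ℤ) v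
  set U := IsLocalization.integerNormalization (nonZeroDivisors ℤ) u
  set V := IsLocalization.integerNormalization (nonZeroDivisors ℤ) v
  -- Bézout relation over ℚ with denominators b and b' cleared. It survives modulo every prime not
  -- dividing bb'.
  have key : C b' * U * χ + C b * V * derivative χ = C (b * b') := by
    apply Polynomial.map_injective (Int.castRingHom ℚ) Int.cast_injective
    have e : algebraMap ℤ ℚ = Int.castRingHom ℚ := rfl
    rw [e] at hu hv
    simp only [Polynomial.map_add, Polynomial.map_mul, hu, hv, map_C, ← derivative_map]
    rw [zsmul_eq_mul, zsmul_eq_mul, ← C_eq_intCast, ← C_eq_intCast]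
    simp only [eq_intCast, Int.cast_mul, C_mul]
    linear_combination (C (b : ℚ) * C (b' : ℚ)) * huv
  refine ⟨b * b', mul_ne_zero (nonZeroDivisors.ne_zero hb) (nonZeroDivisors.ne_zero hb'), ?_⟩
  intro p hp hN
  have h := congrArg (Polynomial.map (Int.castRingHom (ZMod p))) key
  simp only [Polynomial.map_add, Polynomial.map_mul, map_C, ← derivative_map] at h
  simp only [eq_intCast] at h
  set N : ZMod p := ((b * b' : ℤ) : ZMod p) with hNdef
  have hinv : C N⁻¹ * C N = 1 := by rw [← C_mul, inv_mul_cancel₀ hN, C_1]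
  refine ⟨C N⁻¹ * (C ((b' : ℤ) : ZMod p) * U.map (Int.castRingHom (ZMod p))),
    C N⁻¹ * (C ((b : ℤ) : ZMod p) * V.map (Int.castRingHom (ZMod p))), ?_⟩
  linear_combination C N⁻¹ * h + hinv

end Polynomial

/-! ### Invariant subspaces of the Weil representation -/

namespace IsWeilRepresentation

variable {q : ℕ} [NeZero q] {ρ : Representation ℂ (Sp8 (ZMod q)) (L2 q)}

/-- A scalar matrix, as an element of `GL₄`. -/
def scalarGL {S : Type*} [CommRing S] (t : Sˣ) : GL (Fin 4) S :=
  Units.map (algebraMap S (Matrix (Fin 4) (Fin 4) S) : S →* _) t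

lemma coe_scalarGL {S : Type*} [CommRing S] (t : Sˣ) :
    (scalarGL t : Matrix (Fin 4) (Fin 4) S) = (t : S) • 1 := by
  simp [scalarGL, Algebra.algebraMap_eq_smul_one]

lemma coe_scalarGL_inv {S : Type*} [CommRing S] (t : Sˣ) :
    ((scalarGL t)⁻¹ : GL (Fin 4) S).1 = ((t⁻¹ : Sˣ) : S) • 1 := by
  rw [scalarGL, ← map_inv]
  exact coe_scalarGL t⁻¹

lemma l_mul {S : Type*} [CommRing S] (W W' : Matrix (Fin 4) (Fin 4) S) (hW : W.IsSymm)
    (hW' : W'.IsSymm) : Sp8.l W hW * Sp8.l W' hW' = Sp8.l (W + W') (hW.add hW') := by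
  apply Subtype.ext
  rw [Submonoid.coe_mul]
  simp [Sp8.l, Matrix.fromBlocks_multiply]

/-- The operators `ρ (l(W))` are quadratic modulations, without a phase. -/
lemma apply_l (hρ : IsWeilRepresentation ρ) (h2 : IsUnit (2 : ZMod q)) (h3 : IsUnit (3 : ZMod q))
    (W : Matrix (Fin 4) (Fin 4) (ZMod q)) (hW : W.IsSymm) (f : L2 q) (x : Fin 4 → ZMod q) :
    ρ (Sp8.l W hW) f x = ZMod.stdAddChar (-(2⁻¹ * (x ⬝ᵥ (W *ᵥ x)))) * f x := by
  obtain ⟨ξ, hξ, hs, -, hl⟩ := hρ.formulas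
  obtain ⟨u2, hu2⟩ := h2
  obtain ⟨u3, hu3⟩ := h3
  have hξ0 : ∀ g, ξ g ≠ 0 := fun g h => by simpa [h] using hξ g
  -- The delta function at 0 is a common eigenvector of all ρ(l(W)) and of ρ(s(2)), with eigenvalue
  -- the phase. Hence ξ is multiplicative on the l(W).
  set δ : L2 q := Pi.single 0 1 with hδ
  have hδ0 : δ 0 = 1 := by simp [hδ]
  have hlδ : ∀ W (hW : W.IsSymm), ρ (Sp8.l W hW) δ = ξ (Sp8.l W hW) • δ := by
    intro W hW
    ext x
    rw [hl, Pi.smul_apply, smul_eq_mul]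
    by_cases hx : x = 0
    · subst hx; simp
    · simp [hδ, hx]
  have hsδ : ρ (Sp8.s (scalarGL u2)) δ = ξ (Sp8.s (scalarGL u2)) • δ := by
    ext x
    rw [hs, Pi.smul_apply, smul_eq_mul, coe_scalarGL_inv, smul_mulVec, one_mulVec]
    by_cases hx : x = 0
    · subst hx; simp
    · have : ((u2⁻¹ : (ZMod q)ˣ) : ZMod q) • x ≠ 0 := fun h => hx (by
        have h' := congrArg (fun y => (u2 : ZMod q) • y) h
        simpa [smul_smul] using h')
      simp [hδ, hx, this]
  have hmul : ∀ W W' (hW : W.IsSymm) (hW' : W'.IsSymm),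
      ξ (Sp8.l (W + W') (hW.add hW')) = ξ (Sp8.l W hW) * ξ (Sp8.l W' hW') := by
    intro W W' hW hW'
    have h := hlδ (W + W') (hW.add hW')
    rw [← l_mul W W' hW hW', map_mul, Module.End.mul_apply, hlδ W' hW', map_smul, hlδ W hW, smul_smul] at h
    have h1 := congrFun h 0
    rw [Pi.smul_apply, Pi.smul_apply, hδ0, smul_eq_mul, smul_eq_mul, mul_one, mul_one] at h1
    rw [← l_mul W W' hW hW', mul_comm, h1]
  -- Conjugation by s(2) carries l(4W) to l(W).
  have hconj : ∀ W (hW : W.IsSymm),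
      ξ (Sp8.l ((4 : ZMod q) • W) (hW.smul 4)) = ξ (Sp8.l W hW) := by
    intro W hW
    have e : Sp8.s (scalarGL u2) * Sp8.l ((4 : ZMod q) • W) (hW.smul 4) =
        Sp8.l W hW * Sp8.s (scalarGL u2) := by
      apply Subtype.ext
      rw [Submonoid.coe_mul, Submonoid.coe_mul]
      have h4 : 4 * ((u2⁻¹ : (ZMod q)ˣ) : ZMod q) = u2 := by
        rw [mul_comm, Units.inv_mul_eq_iff_eq_mul, hu2]; norm_num
      simp [-Matrix.coe_units_inv, Sp8.l, Sp8.s, Matrix.fromBlocks_multiply, coe_scalarGL, coe_scalarGL_inv, smul_smul, h4]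
    have h := congrArg (fun g => ρ g δ) e
    simp only [map_mul, Module.End.mul_apply, hlδ, hsδ, map_smul, smul_smul] at h
    have h1 := congrFun h 0
    rw [Pi.smul_apply, Pi.smul_apply, hδ0, smul_eq_mul, smul_eq_mul, mul_one, mul_one,
      mul_comm (ξ (Sp8.s _))] at h1
    exact mul_right_cancel₀ (hξ0 _) h1
  -- With W' = W/3 one has W + W' = 4W', so ξ(W)ξ(W') = ξ(4W') = ξ(W').
  have hone : ξ (Sp8.l W hW) = 1 := by
    set W' := ((u3⁻¹ : (ZMod q)ˣ) : ZMod q) • W with hW'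
    have hW's : W'.IsSymm := hW.smul _
    have h1 := hmul W W' hW hW's
    have e : W + W' = (4 : ZMod q) • W' := by
      have h4 : (4 : ZMod q) * ((u3⁻¹ : (ZMod q)ˣ) : ZMod q) = 1 + ((u3⁻¹ : (ZMod q)ˣ) : ZMod q) := by
        have : (u3 : ZMod q) * ((u3⁻¹ : (ZMod q)ˣ) : ZMod q) = 1 := by simp
        rw [hu3] at this
        linear_combination this
      rw [hW', smul_smul, h4, add_smul, one_smul]
    have h2 : ξ (Sp8.l (W + W') (hW.add hW's)) = ξ (Sp8.l W' hW's) := by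
      rw [← hconj W' hW's]
      congr 1
      apply Subtype.ext
      simp only [Sp8.l, e]
    rw [h2] at h1
    exact mul_right_cancel₀ (hξ0 (Sp8.l W' hW's)) (by rw [one_mul]; exact h1.symm)
  rw [hl, hone, one_mul]

end IsWeilRepresentation

/-! ### The quadratic forms attached to polynomials in Δ, and identities between elementary
matrices. -/

namespace SelfAdjAction

open Polynomial

variable {R S : Type*} [CommRing R] [CommRing S] [Algebra S R] (T : SelfAdjAction R S)

/-- The quadratic form `xᵀ e φ(β) x`. -/
def form (β : R) (x : Fin 4 → S) : S := x ⬝ᵥ ((T.e * T.φ β) *ᵥ x)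

lemma form_smul_left (t : S) (β : R) (x : Fin 4 → S) :
    T.form (algebraMap S R t * β) x = t * T.form β x := by
  rw [form, form, map_mul, AlgHom.commutes, Algebra.algebraMap_eq_smul_one, smul_one_mul,
    Matrix.mul_smul, smul_mulVec, dotProduct_smul, smul_eq_mul]

lemma form_smul_right (t : S) (β : R) (x : Fin 4 → S) :
    T.form β (t • x) = t ^ 2 * T.form β x := by
  rw [form, form, mulVec_smul, dotProduct_smul, smul_dotProduct, smul_eq_mul, smul_eq_mul]
  ring

lemma isSymm_mul (β : R) : (T.e * T.φ β).IsSymm := by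
  rw [Matrix.IsSymm, transpose_mul, T.e_symm, T.adj]

lemma isSymm_neg_mul (β : R) : (-(T.φ β * T.e')).IsSymm := by
  rw [Matrix.IsSymm, transpose_neg, transpose_mul, T.e'_symm, T.φ_transpose, ← Matrix.mul_assoc,
    ← Matrix.mul_assoc, T.e'_mul, Matrix.one_mul]

lemma hom_low (β : R) : T.hom (SL2.low β) = Sp8.l (T.e * T.φ β) (T.isSymm_mul β) :=
  Subtype.ext (T.coe_hom_low β)

/-- Conjugation by J, the Fourier transform, turns upper unipotents into lower ones and hence into
quadratic modulations. -/
lemma hom_upp_mul_J (β : R) : T.hom (SL2.upp β) * Sp8.J S =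
    Sp8.J S * Sp8.l (-(T.φ β * T.e')) (T.isSymm_neg_mul β) := by
  apply Subtype.ext
  rw [Submonoid.coe_mul, Submonoid.coe_mul, T.coe_hom_upp]
  simp [Sp8.J, Sp8.l, Matrix.fromBlocks_multiply]

end SelfAdjAction

namespace SL2

variable {R : Type*} [CommRing R]

lemma low_comm (a b : R) : low a * low b = low b * low a := by
  rw [low_mul, low_mul, add_comm]

lemma upp_mul_low_of_mul_eq_zero {a b : R} (h : a * b = 0) : upp a * low b = low b * upp a := by
  apply Subtype.ext
  have h' : b * a = 0 := by rw [mul_comm, h]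
  simp [coe_low, coe_upp, Matrix.SpecialLinearGroup.coe_mul, h, h']

/-- The word low ε · upp(-ε) · low ε is the Weyl element in the factor εR and trivial in (1 - ε)R.
Conjugation by it exchanges lower and upper unipotents of that factor. -/
lemma upp_neg_of_idempotent {ε : R} (hε : ε * ε = ε) (β : R) :
    upp (-(ε * β)) = low ε * upp (-ε) * low ε * low (ε * β) * (low (-ε) * upp ε * low (-ε)) := by
  have h1 : low ε * upp (-ε) * low ε * (low (-ε) * upp ε * low (-ε)) = (1 : Matrix.SpecialLinearGroup (Fin 2) R) := by
    have : low (-ε) = (low ε)⁻¹ := by rw [eq_inv_iff_mul_eq_one, low_mul, neg_add_cancel, low_zero]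
    have h2 : upp (-ε) = (upp ε)⁻¹ := by rw [eq_inv_iff_mul_eq_one, upp_mul, neg_add_cancel, upp_zero]
    rw [this, h2]; group
  have h2 : low ε * upp (-ε) * low ε * low (ε * β) = upp (-(ε * β)) * (low ε * upp (-ε) * low ε) := by
    apply Subtype.ext
    ext i j
    fin_cases i <;> fin_cases j <;>
      simp [coe_low, coe_upp, Matrix.SpecialLinearGroup.coe_mul, Matrix.mul_apply, Fin.sum_univ_two]
    all_goals grind
  rw [h2, mul_assoc, h1, mul_one]

/-- The diagonal matrix `(t 0; 0 t⁻¹)`. -/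
def torus (t : Rˣ) : Matrix.SpecialLinearGroup (Fin 2) R :=
  ⟨!![(t : R), 0; 0, ((t⁻¹ : Rˣ) : R)], by simp [Matrix.det_fin_two_of]⟩

/-- A product of two Weyl elements, (0 t; -t⁻¹ 0) and (0 -1; 1 0). Stability under elementary
matrices thus implies stability under scalar dilations. -/
lemma torus_eq (t : Rˣ) : torus t = upp (t : R) * low (-((t⁻¹ : Rˣ) : R)) * upp (t : R) *
    (upp (-1) * low 1 * upp (-1)) := by
  have ht : (t : R) * (t⁻¹ : Rˣ) = 1 := by simp
  apply Subtype.ext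
  ext i j
  fin_cases i <;> fin_cases j <;>
    simp [torus, coe_low, coe_upp, Matrix.SpecialLinearGroup.coe_mul, Matrix.mul_apply, Fin.sum_univ_two]

end SL2

namespace ZMod

lemma exists_idempotent {q : ℕ} (hq : Squarefree q) {p : ℕ} (hp : p.Prime) (hpq : p ∣ q) :
    ∃ ε : ZMod q, ε * ε = ε ∧ ZMod.castHom hpq (ZMod p) ε = 1 ∧
      ∀ p' (_ : p'.Prime) (hpq' : p' ∣ q), p' ≠ p → ZMod.castHom hpq' (ZMod p') ε = 0 := by
  have : NeZero q := ⟨hq.ne_zero⟩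
  obtain ⟨ε, hε⟩ := exists_castHom_eq (q := q) fun p' => if p' = p then (1 : ZMod p') else 0
  refine ⟨ε, eq_of_castHom_eq hq fun p' hp' hpq' => ?_, ?_, ?_⟩
  · rw [map_mul, hε p' hp' hpq']
    split_ifs <;> simp
  · simpa using hε p hp hpq
  · intro p' hp' hpq' hne
    simpa [hne] using hε p' hp' hpq'

end ZMod

/-! ### Restriction of functions to level sets of the quadratic forms. -/

namespace IsWeilRepresentation

open Polynomial

variable {q : ℕ} [NeZero q] {ρ : Representation ℂ (Sp8 (ZMod q)) (L2 q)}
  (T : SelfAdjAction (ZMod q)[X] (ZMod q))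

lemma apply_low (hρ : IsWeilRepresentation ρ) (h2 : IsUnit (2 : ZMod q))
    (h3 : IsUnit (3 : ZMod q)) (β : (ZMod q)[X]) (f : L2 q) (x : Fin 4 → ZMod q) :
    ρ (T.hom (SL2.low β)) f x = ZMod.stdAddChar (-(2⁻¹ * T.form β x)) * f x := by
  rw [T.hom_low, hρ.apply_l h2 h3]
  rfl

open Classical in
/-- A subspace which is stable under quadratic modulations is stable under restriction to a level
set of the quadratic forms. -/
lemma indicator_mem (hρ : IsWeilRepresentation ρ) (h2 : IsUnit (2 : ZMod q))
    (h3 : IsUnit (3 : ZMod q)) {V : Submodule ℂ (L2 q)}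
    (hV : ∀ β, ∀ f ∈ V, ρ (T.hom (SL2.low β)) f ∈ V) {f : L2 q} (hf : f ∈ V)
    (x₀ : Fin 4 → ZMod q) :
    (fun x => if ∀ β, T.form β x = T.form β x₀ then f x else 0) ∈ V := by
  have hq0 : (q : ℂ) ≠ 0 := NeZero.ne _
  have key : ∀ β, ∀ f ∈ V, (fun x => if T.form β x = T.form β x₀ then f x else 0) ∈ V := by
    intro β f hf
    -- Orthogonality of characters of ℤ/q writes the indicator of the level set as an average of
    -- modulations. The factor -2t cancels the -1/2 in the Weil formula.
    have e : (fun x => if T.form β x = T.form β x₀ then f x else 0) =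
        ∑ t : ZMod q, ((q : ℂ)⁻¹ * ZMod.stdAddChar (-(t * T.form β x₀))) •
          ρ (T.hom (SL2.low (algebraMap _ _ (-2 * t) * β))) f := by
      ext x
      have h := AddChar.sum_mulShift (T.form β x - T.form β x₀) (ZMod.isPrimitive_stdAddChar q)
      rw [Finset.sum_apply]
      have e1 : ∀ t : ZMod q, (((q : ℂ)⁻¹ * ZMod.stdAddChar (-(t * T.form β x₀))) •
          ρ (T.hom (SL2.low (algebraMap _ _ (-2 * t) * β))) f) x =
          (q : ℂ)⁻¹ * f x * ZMod.stdAddChar (t * (T.form β x - T.form β x₀)) := by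
        intro t
        rw [Pi.smul_apply, hρ.apply_low T h2 h3, T.form_smul_left, smul_eq_mul]
        have e2 : t * (T.form β x - T.form β x₀) =
            -(t * T.form β x₀) + -(2⁻¹ * (-2 * t * T.form β x)) := by
          linear_combination (-(t * T.form β x)) * ZMod.mul_inv_of_unit 2 h2
        rw [e2, AddChar.map_add_eq_mul]
        ring
      rw [Finset.sum_congr rfl fun t _ => e1 t, ← Finset.mul_sum, h]
      simp only [sub_eq_zero, ZMod.card]
      split_ifs
      · field_simp
      · simp
    rw [e]
    exact sum_mem fun t _ => V.smul_mem _ (hV _ _ hf)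
  -- Finitely many β suffice: for each y outside the joint level set, one that separates y from x₀.
  have hB : ∀ y, ∃ β, T.form β y = T.form β x₀ → ∀ β, T.form β y = T.form β x₀ := by
    intro y
    by_cases h : ∀ β, T.form β y = T.form β x₀
    · exact ⟨0, fun _ => h⟩
    · obtain ⟨β, hβ⟩ := not_forall.1 h
      exact ⟨β, fun h => absurd h hβ⟩
  choose B hB using hB
  have hfin : ∀ s : Finset (Fin 4 → ZMod q),
      (fun x => if ∀ y ∈ s, T.form (B y) x = T.form (B y) x₀ then f x else 0) ∈ V := by
    intro s
    induction s using Finset.induction_on with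
    | empty => simpa using hf
    | insert y s hy ih =>
      convert key (B y) _ ih using 1
      ext x
      simp only [Finset.forall_mem_insert, ite_and]
  have e : (fun x => if ∀ β, T.form β x = T.form β x₀ then f x else 0) = fun x =>
      if ∀ y ∈ Finset.univ, T.form (B y) x = T.form (B y) x₀ then f x else 0 := by
    ext x
    exact if_congr ⟨fun h y _ => h _, fun h => hB x (h x (Finset.mem_univ x))⟩ rfl rfl
  rw [e]
  exact hfin Finset.univ

end IsWeilRepresentation

/-! ### Finding a support vector whose forms are nonzero modulo every prime. -/

namespace IsWeilRepresentation

open Polynomial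

variable {q : ℕ} [NeZero q] {ρ : Representation ℂ (Sp8 (ZMod q)) (L2 q)}
  (T : SelfAdjAction (ZMod q)[X] (ZMod q))

/-- Modulations act pointwise and e_q is injective on ℤ/q, so an eigenvalue pins down the value of
the form on the whole support. -/
lemma form_eq_of_eigenvector (hρ : IsWeilRepresentation ρ) (h2 : IsUnit (2 : ZMod q))
    (h3 : IsUnit (3 : ZMod q)) {β : (ZMod q)[X]} {f : L2 q} {a : ZMod q}
    (h : ρ (T.hom (SL2.low β)) f = (ZMod.stdAddChar (-(2⁻¹ * a)) : ℂ) • f) {x : Fin 4 → ZMod q}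
    (hx : f x ≠ 0) : T.form β x = a := by
  have h1 := congrFun h x
  rw [hρ.apply_low T h2 h3, Pi.smul_apply, smul_eq_mul] at h1
  have h4 := ZMod.injective_stdAddChar (mul_right_cancel₀ hx h1)
  have h5 := ZMod.mul_inv_of_unit (2 : ZMod q) h2
  linear_combination (-2 : ZMod q) * h4 - (T.form β x - a) * h5

/-- There is no nonzero invariant subspace on which the elementary matrices act trivially modulo a
prime factor `p` of `q`. -/
lemma eq_zero_of_supported (hρ : IsWeilRepresentation ρ) (hq : Squarefree q)
    (h2 : IsUnit (2 : ZMod q)) (h3 : IsUnit (3 : ZMod q)) {p : ℕ} (hp : p.Prime) (hpq : p ∣ q)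
    (hT : ∀ x, (∀ β, ZMod.castHom hpq (ZMod p) (T.form β x) = 0) →
      ∀ i, ZMod.castHom hpq (ZMod p) (x i) = 0)
    {ε : ZMod q} (hε : ε * ε = ε) (hεp : ZMod.castHom hpq (ZMod p) ε = 1)
    (hεp' : ∀ p' (_ : p'.Prime) (hpq' : p' ∣ q), p' ≠ p → ZMod.castHom hpq' (ZMod p') ε = 0)
    {V : Submodule ℂ (L2 q)}
    (hlow : ∀ β, ∀ f ∈ V, ρ (T.hom (SL2.low (algebraMap _ _ ε * β))) f ∈ V)
    (hupp : ∀ β, ∀ f ∈ V, ρ (T.hom (SL2.upp (algebraMap _ _ ε * β))) f ∈ V)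
    (hsupp : ∀ f ∈ V, ∀ x, f x ≠ 0 → ∀ β, ZMod.castHom hpq (ZMod p) (T.form β x) = 0) :
    V = ⊥ := by
  have : Fact p.Prime := ⟨hp⟩
  have hε0 : ∀ a : ZMod q, ZMod.castHom hpq (ZMod p) a = 0 ↔ ε * a = 0 := by
    intro a
    constructor
    · intro h
      refine ZMod.eq_of_castHom_eq hq fun p' hp' hpq' => ?_
      rw [map_mul, map_zero]
      by_cases hpp : p' = p
      · subst hpp; rw [h, mul_zero]
      · rw [hεp' p' hp' hpq' hpp, zero_mul]
    · intro h
      have h' := congrArg (ZMod.castHom hpq (ZMod p)) h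
      rwa [map_mul, hεp, one_mul, map_zero] at h'
  set E : (ZMod q)[X] := algebraMap _ _ ε with hE
  have hEE : E * E = E := by rw [hE, ← map_mul, hε]
  have htriv : ∀ β, ∀ f ∈ V, ρ (T.hom (SL2.low (E * β))) f = f := by
    intro β f hf
    ext x
    rw [hρ.apply_low T h2 h3]
    by_cases hx : f x = 0
    · rw [hx, mul_zero]
    · rw [hE, T.form_smul_left, (hε0 _).1 (hsupp f hf x hx β)]
      simp
  have hl1 : ∀ f ∈ V, ρ (T.hom (SL2.low E)) f ∈ V := by simpa using hlow 1
  have hl2 : ∀ f ∈ V, ρ (T.hom (SL2.low (-E))) f ∈ V := by simpa using hlow (-1)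
  have hu1 : ∀ f ∈ V, ρ (T.hom (SL2.upp E)) f ∈ V := by simpa using hupp 1
  -- Triviality passes from lower to upper unipotents by Weyl conjugation in the p-component, under
  -- which V is stable. The case β = 0 of the identity says that the two Weyl words are inverse to
  -- each other.
  have htriv' : ∀ β, ∀ f ∈ V, ρ (T.hom (SL2.upp (E * β))) f = f := by
    intro β f hf
    have e : E * β = -(E * -β) := by ring
    have h1 : ∀ f, ρ (T.hom (SL2.low E * SL2.upp (-E) * SL2.low E)) (ρ (T.hom
        (SL2.low (-E) * SL2.upp E * SL2.low (-E))) f) = f := by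
      intro f
      rw [← Module.End.mul_apply, ← map_mul, ← map_mul]
      have h3 := SL2.upp_neg_of_idempotent hEE 0
      rw [mul_zero, neg_zero, SL2.upp_zero, SL2.low_zero, mul_one] at h3
      rw [← h3]
      simp
    have h4 : ρ (T.hom (SL2.low (-E) * SL2.upp E * SL2.low (-E))) f ∈ V := by
      simp only [map_mul, Module.End.mul_apply]
      exact hl2 _ (hu1 _ (hl2 _ hf))
    rw [e, SL2.upp_neg_of_idempotent hEE, map_mul, map_mul, Module.End.mul_apply]
    conv_lhs => rw [map_mul T.hom, map_mul ρ, Module.End.mul_apply, htriv _ _ h4, h1]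
  rw [Submodule.eq_bot_iff]
  intro f hf
  by_contra hf0
  obtain ⟨x, hx⟩ := Function.ne_iff.1 hf0
  -- The inverse Fourier transform g is fixed by the modulations attached to upper unipotents, so
  -- the same vanishing of forms, now at e⁻¹y, forces its support into vectors divisible by p.
  set g := ρ (Sp8.J (ZMod q))⁻¹ f with hg
  have hgf : ρ (Sp8.J (ZMod q)) g = f := by
    rw [hg, ← Module.End.mul_apply, ← map_mul, mul_inv_cancel, map_one, Module.End.one_apply]
  have hgl : ∀ β, ρ (Sp8.l _ (T.isSymm_neg_mul (E * β))) g = g := by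
    intro β
    have h1 := congrArg (fun γ => ρ γ g) (T.hom_upp_mul_J (E * β))
    simp only [map_mul ρ, Module.End.mul_apply, hgf] at h1
    rw [htriv' β f hf] at h1
    have h5 := congrArg (ρ (Sp8.J (ZMod q))⁻¹) h1
    rw [← Module.End.mul_apply, ← map_mul, inv_mul_cancel, map_one, Module.End.one_apply] at h5
    exact h5.symm
  have hgsupp : ∀ y, g y ≠ 0 → ∀ i, ZMod.castHom hpq (ZMod p) (y i) = 0 := by
    intro y hy
    have hy1 : T.e *ᵥ (T.e' *ᵥ y) = y := by
      rw [mulVec_mulVec, T.mul_e', one_mulVec]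
    have h1 : ∀ i, ZMod.castHom hpq (ZMod p) ((T.e' *ᵥ y) i) = 0 := by
      refine hT _ fun β => (hε0 _).2 ?_
      have h6 := congrFun (hgl β) y
      rw [hρ.apply_l h2 h3] at h6
      have h7 := ZMod.injective_stdAddChar (a₂ := 0) (mul_right_cancel₀ hy (by
        rw [h6, AddChar.map_zero_eq_one, one_mul]))
      have h8 : y ⬝ᵥ ((-(T.φ (E * β) * T.e')) *ᵥ y) = -(ε * T.form β (T.e' *ᵥ y)) := by
        rw [← T.form_smul_left, SelfAdjAction.form, neg_mulVec, dotProduct_neg]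
        congr 1
        rw [← mulVec_mulVec, ← mulVec_mulVec, dotProduct_mulVec (T.e' *ᵥ y), ← mulVec_transpose,
          T.e_symm, hy1]
      rw [h8] at h7
      have h5 := ZMod.mul_inv_of_unit (2 : ZMod q) h2
      linear_combination (2 : ZMod q) * h7 - (ε * T.form β (T.e' *ᵥ y)) * h5
    intro i
    rw [← hy1, mulVec, dotProduct, map_sum]
    exact Finset.sum_eq_zero fun j _ => by rw [map_mul, h1, mul_zero]
  obtain ⟨ξ, hξ, -, hJ, -⟩ := hρ.formulas
  -- Since g lives on y ≡ 0 mod p, f is invariant under translation by ε in the first coordinate.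
  -- But f itself lives on x ≡ 0 mod p, and ε ≡ 1 there.
  have hinv : f (x + Pi.single 0 ε) = f x := by
    rw [← hgf, hJ, hJ]
    congr 2
    refine Finset.expect_congr rfl fun y _ => ?_
    by_cases hy : g y = 0
    · rw [hy, zero_mul, zero_mul]
    · rw [add_dotProduct, single_dotProduct, (hε0 _).1 (hgsupp y hy 0), add_zero]
  have hz : ∀ x, f x ≠ 0 → ZMod.castHom hpq (ZMod p) (x 0) = 0 := fun x hx =>
    hT x (hsupp f hf x hx) 0
  have h9 := hz (x + Pi.single 0 ε) (by rw [hinv]; exact hx)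
  rw [Pi.add_apply, map_add, hz x hx, Pi.single_eq_same, hεp, zero_add] at h9
  exact one_ne_zero h9

/-- A nonzero invariant subspace contains a function whose support contains a vector at which the
quadratic forms do not all vanish modulo any prime factor of `q`. -/
lemma exists_form_ne_zero (hρ : IsWeilRepresentation ρ) (hq : Squarefree q)
    (h2 : IsUnit (2 : ZMod q)) (h3 : IsUnit (3 : ZMod q))
    (hT : ∀ p (_ : p.Prime) (hpq : p ∣ q) x, (∀ β, ZMod.castHom hpq (ZMod p) (T.form β x) = 0) →
      ∀ i, ZMod.castHom hpq (ZMod p) (x i) = 0)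
    {V : Submodule ℂ (L2 q)} (hV : V ≠ ⊥)
    (hlow : ∀ β, ∀ f ∈ V, ρ (T.hom (SL2.low β)) f ∈ V)
    (hupp : ∀ β, ∀ f ∈ V, ρ (T.hom (SL2.upp β)) f ∈ V) :
    ∃ f ∈ V, ∃ x, f x ≠ 0 ∧
      ∀ p (_ : p.Prime) (hpq : p ∣ q), ∃ β, ZMod.castHom hpq (ZMod p) (T.form β x) ≠ 0 := by
  classical
  let good : (Fin 4 → ZMod q) → Finset ℕ := fun x =>
    q.primeFactors.filter fun p => ∃ hpq : p ∣ q, ∃ β, ZMod.castHom hpq (ZMod p) (T.form β x) ≠ 0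
  obtain ⟨f₀, hf₀, hne⟩ := V.ne_bot_iff.1 hV
  obtain ⟨y₀, hy₀⟩ := Function.ne_iff.1 hne
  -- Among all support points of functions in V, x₀ has the most primes modulo which some form is
  -- nonzero. A missing prime p will contradict maximality.
  obtain ⟨x₀, ⟨f, hf, hx₀⟩, hmax⟩ := Set.exists_max_image {x | ∃ f ∈ V, f x ≠ 0}
    (fun x => (good x).card) (Set.toFinite _) ⟨y₀, f₀, hf₀, hy₀⟩
  refine ⟨f, hf, x₀, hx₀, fun p hp hpq => ?_⟩
  by_contra! hbad
  obtain ⟨ε, hε, hεp, hεp'⟩ := ZMod.exists_idempotent hq hp hpq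
  set E : (ZMod q)[X] := algebraMap _ _ ε with hE
  set E' : (ZMod q)[X] := algebraMap _ _ (1 - ε) with hE'
  have hEE' : E * E' = 0 := by
    rw [hE, hE', ← map_mul, mul_sub, hε, mul_one, sub_self, map_zero]
  -- Functions of V on which the forms agree with their values at x₀ away from p. The unipotents of
  -- the p-component commute with the conditions, so they preserve V'.
  let V' : Submodule ℂ (L2 q) :=
    { carrier := {f | f ∈ V ∧ ∀ β, ρ (T.hom (SL2.low (E' * β))) f =
        (ZMod.stdAddChar (-(2⁻¹ * T.form (E' * β) x₀)) : ℂ) • f}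
      zero_mem' := ⟨V.zero_mem, fun β => by simp⟩
      add_mem' := fun {f g} hf hg => ⟨V.add_mem hf.1 hg.1, fun β => by
        rw [map_add, hf.2, hg.2, smul_add]⟩
      smul_mem' := fun c f hf => ⟨V.smul_mem c hf.1, fun β => by
        rw [map_smul, hf.2, smul_comm]⟩ }
  have hV'V : ∀ f ∈ V', f ∈ V := fun f hf => hf.1
  have hV'e : ∀ f ∈ V', ∀ β, ρ (T.hom (SL2.low (E' * β))) f =
        (ZMod.stdAddChar (-(2⁻¹ * T.form (E' * β) x₀)) : ℂ) • f := fun f hf => hf.2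
  have hV'mem : ∀ f ∈ V, (∀ β, ρ (T.hom (SL2.low (E' * β))) f =
        (ZMod.stdAddChar (-(2⁻¹ * T.form (E' * β) x₀)) : ℂ) • f) → f ∈ V' := fun f h h' => ⟨h, h'⟩
  have hV'0 : V' ≠ ⊥ := by
    rw [Submodule.ne_bot_iff]
    refine ⟨_, hV'mem _ (hρ.indicator_mem T h2 h3 hlow hf x₀) ?_, ?_⟩
    · intro β
      ext x
      rw [hρ.apply_low T h2 h3, Pi.smul_apply, smul_eq_mul]
      split_ifs with h
      · rw [h]
      · simp
    · intro h
      have h1 := congrFun h x₀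
      simp only [implies_true, if_true] at h1
      exact hx₀ h1
  refine hV'0 (hρ.eq_zero_of_supported T hq h2 h3 hp hpq (hT p hp hpq) hε hεp hεp' ?_ ?_ ?_)
  · intro β f hf
    refine hV'mem _ (hlow _ _ (hV'V f hf)) fun γ => ?_
    rw [← Module.End.mul_apply, ← map_mul, ← map_mul, SL2.low_comm, map_mul, map_mul,
      Module.End.mul_apply, hV'e f hf, map_smul]
  · intro β f hf
    refine hV'mem _ (hupp _ _ (hV'V f hf)) fun γ => ?_
    rw [← Module.End.mul_apply, ← map_mul, ← map_mul, ← SL2.upp_mul_low_of_mul_eq_zero (by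
      rw [mul_mul_mul_comm, ← hE, hEE', zero_mul]), map_mul, map_mul,
      Module.End.mul_apply, hV'e f hf, map_smul]
  · intro f hf x hx
    by_contra! hβ
    have hform : ∀ β, (1 - ε) * T.form β x = (1 - ε) * T.form β x₀ := by
      intro β
      have h := hρ.form_eq_of_eigenvector T h2 h3 (hV'e f hf β) hx
      rwa [hE', T.form_smul_left, T.form_smul_left] at h
    -- A support point of V' with a form nonzero mod p keeps all good primes of x₀ and gains p.
    have hlt : (good x₀).card < (good x).card := by
      refine Finset.card_lt_card ⟨fun p' hp' => ?_, fun h => ?_⟩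
      · obtain ⟨hp'1, hpq', β, hβ'⟩ := Finset.mem_filter.1 hp'
        have hne : p' ≠ p := by
          rintro rfl
          exact hβ' (hbad β)
        refine Finset.mem_filter.2 ⟨hp'1, hpq', β, ?_⟩
        have h := congrArg (ZMod.castHom hpq' (ZMod p')) (hform β)
        rw [map_mul, map_mul, map_sub, hεp' p' (Nat.prime_of_mem_primeFactors hp'1) hpq' hne,
          map_one, sub_zero, one_mul, one_mul] at h
        rwa [h]
      · have hpx : p ∈ good x := Finset.mem_filter.2
          ⟨Nat.mem_primeFactors.2 ⟨hp, hpq, hq.ne_zero⟩, hpq, hβ⟩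
        obtain ⟨-, hpq', β, hβ'⟩ := Finset.mem_filter.1 (h hpx)
        exact hβ' (hbad β)
    exact absurd (hmax x ⟨f, hV'V f hf, hx⟩) (not_le.2 hlt)

end IsWeilRepresentation

/-! ### Scalar dilations and the lower bound for the dimension. -/

namespace SelfAdjAction

variable {R S : Type*} [CommRing R] [CommRing S] [Algebra S R] (T : SelfAdjAction R S)

lemma hom_torus (t : Sˣ) : T.hom (SL2.torus (Units.map (algebraMap S R : S →* R) t)) =
    Sp8.s (IsWeilRepresentation.scalarGL t) := by
  have hφ : ∀ s, T.φ (algebraMap S R s) = s • 1 := fun s => by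
    rw [AlgHom.commutes, Algebra.algebraMap_eq_smul_one]
  apply Subtype.ext
  rw [T.coe_hom]
  simp only [Sp8.s, SL2.torus, Matrix.of_apply, Matrix.cons_val', Matrix.cons_val_zero,
    Matrix.cons_val_one, Matrix.cons_val_fin_one, map_zero, Matrix.zero_mul, Matrix.mul_zero,
    Units.coe_map, MonoidHom.coe_coe, ← map_inv, hφ, IsWeilRepresentation.coe_scalarGL,
    IsWeilRepresentation.coe_scalarGL_inv, Matrix.mul_smul, Matrix.smul_mul, Matrix.mul_one,
    T.mul_e', transpose_smul, transpose_one]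

open Polynomial in
lemma torus_mem {q : ℕ} {ρ : Representation ℂ (Sp8 (ZMod q)) (L2 q)}
    (T : SelfAdjAction (ZMod q)[X] (ZMod q)) {V : Submodule ℂ (L2 q)}
    (hlow : ∀ β, ∀ f ∈ V, ρ (T.hom (SL2.low β)) f ∈ V)
    (hupp : ∀ β, ∀ f ∈ V, ρ (T.hom (SL2.upp β)) f ∈ V) (t : (ZMod q)ˣ) {f : L2 q} (hf : f ∈ V) :
    ρ (Sp8.s (IsWeilRepresentation.scalarGL t)) f ∈ V := by
  rw [← T.hom_torus, SL2.torus_eq]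
  simp only [map_mul T.hom, map_mul ρ, Module.End.mul_apply]
  exact hupp _ _ (hlow _ _ (hupp _ _ (hupp _ _ (hlow _ _ (hupp _ _ hf)))))

end SelfAdjAction

namespace ZMod

/-- The integers 1, …, (p - 1)/2 represent the nonzero classes up to sign: the sum of two of them is
less than p. -/
lemma eq_of_sq_eq_sq {p : ℕ} [Fact p.Prime] {a b : ℕ} (ha : a < (p - 1) / 2)
    (hb : b < (p - 1) / 2) (h : ((a + 1 : ℕ) : ZMod p) ^ 2 = ((b + 1 : ℕ) : ZMod p) ^ 2) :
    a = b := by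
  have hp : 1 < p := (Fact.out : p.Prime).one_lt
  rcases sq_eq_sq_iff_eq_or_eq_neg.1 h with h | h
  · rw [ZMod.natCast_eq_natCast_iff', Nat.mod_eq_of_lt (by omega), Nat.mod_eq_of_lt (by omega)] at h
    omega
  · rw [← add_eq_zero_iff_eq_neg, ← Nat.cast_add, ZMod.natCast_eq_zero_iff] at h
    have := Nat.le_of_dvd (by omega) h
    omega

/-- Units modulo `q` whose squares are pairwise different modulo some prime factor of `q`. -/
lemma exists_units {q : ℕ} (hq : Squarefree q) :
    ∃ u : (∀ p : q.primeFactors, Fin (((p : ℕ) - 1) / 2)) → (ZMod q)ˣ, ∀ a b,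
      (∀ p (_ : p.Prime) (hpq : p ∣ q), ZMod.castHom hpq (ZMod p) (u a) ^ 2 =
        ZMod.castHom hpq (ZMod p) (u b) ^ 2) → a = b := by
  have h : ∀ a : (∀ p : q.primeFactors, Fin (((p : ℕ) - 1) / 2)), ∃ u : (ZMod q)ˣ,
      ∀ p (hp : p ∈ q.primeFactors), ZMod.castHom (Nat.dvd_of_mem_primeFactors hp) (ZMod p) u =
        ((a ⟨p, hp⟩ + 1 : ℕ) : ZMod p) := by
    intro a
    have hu : ∀ p : ℕ, ∃ v : (ZMod p)ˣ, ∀ hp : p ∈ q.primeFactors,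
        (v : ZMod p) = ((a ⟨p, hp⟩ + 1 : ℕ) : ZMod p) := by
      intro p
      by_cases hp : p ∈ q.primeFactors
      · have hpp := Nat.prime_of_mem_primeFactors hp
        have : Fact p.Prime := ⟨hpp⟩
        have hlt : (a ⟨p, hp⟩ : ℕ) < (p - 1) / 2 := (a ⟨p, hp⟩).2
        refine ⟨Units.mk0 ((a ⟨p, hp⟩ + 1 : ℕ) : ZMod p) ?_, fun _ => rfl⟩
        rw [Ne, ZMod.natCast_eq_zero_iff]
        exact fun h => absurd (Nat.le_of_dvd (by omega) h) (by omega)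
      · exact ⟨1, fun h => absurd h hp⟩
    choose v hv using hu
    obtain ⟨u, hu⟩ := exists_unit_castHom_eq hq v
    refine ⟨u, fun p hp => ?_⟩
    rw [← hv p hp, ← hu p (Nat.prime_of_mem_primeFactors hp) (Nat.dvd_of_mem_primeFactors hp)]
    rfl
  choose u hu using h
  refine ⟨u, fun a b hab => ?_⟩
  funext ⟨p, hp⟩
  have : Fact p.Prime := ⟨Nat.prime_of_mem_primeFactors hp⟩
  have h1 := hab p (Nat.prime_of_mem_primeFactors hp) (Nat.dvd_of_mem_primeFactors hp)
  rw [hu a p hp, hu b p hp] at h1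
  exact Fin.ext (eq_of_sq_eq_sq (a ⟨p, hp⟩).2 (b ⟨p, hp⟩).2 h1)

end ZMod

namespace IsWeilRepresentation

open Polynomial

variable {q : ℕ} [NeZero q] {ρ : Representation ℂ (Sp8 (ZMod q)) (L2 q)}
  (T : SelfAdjAction (ZMod q)[X] (ZMod q))

/-- The dimension of a nonzero subspace which is invariant under the elementary matrices. -/
theorem prod_le_finrank (hρ : IsWeilRepresentation ρ) (hq : Squarefree q)
    (h2 : IsUnit (2 : ZMod q)) (h3 : IsUnit (3 : ZMod q))
    (hT : ∀ p (_ : p.Prime) (hpq : p ∣ q) x, (∀ β, ZMod.castHom hpq (ZMod p) (T.form β x) = 0) →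
      ∀ i, ZMod.castHom hpq (ZMod p) (x i) = 0)
    {V : Submodule ℂ (L2 q)} (hV : V ≠ ⊥)
    (hlow : ∀ β, ∀ f ∈ V, ρ (T.hom (SL2.low β)) f ∈ V)
    (hupp : ∀ β, ∀ f ∈ V, ρ (T.hom (SL2.upp β)) f ∈ V) :
    ∏ p ∈ q.primeFactors, (p - 1) / 2 ≤ Module.finrank ℂ V := by
  classical
  obtain ⟨f₀, hf₀, x₀, hx₀, hx⟩ := hρ.exists_form_ne_zero T hq h2 h3 hT hV hlow hupp
  obtain ⟨f, hf, hfx, hfsupp⟩ : ∃ f ∈ V, f x₀ ≠ 0 ∧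
      ∀ x, f x ≠ 0 → ∀ β, T.form β x = T.form β x₀ := by
    refine ⟨_, hρ.indicator_mem T h2 h3 hlow hf₀ x₀, ?_, fun x hx => ?_⟩
    · simpa using hx₀
    · by_contra h
      exact hx (if_neg h)
  obtain ⟨u, hu⟩ := ZMod.exists_units hq
  obtain ⟨ξ, hξ, hs, -, -⟩ := hρ.formulas
  have hs' : ∀ (t : (ZMod q)ˣ) (x : Fin 4 → ZMod q), ρ (Sp8.s (scalarGL t)) f x =
      ξ (Sp8.s (scalarGL t)) * f (((t⁻¹ : (ZMod q)ˣ) : ZMod q) • x) := by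
    intro t x
    rw [hs, coe_scalarGL_inv, smul_mulVec, one_mulVec]
  have hne : ∀ a, ρ (Sp8.s (scalarGL (u a))) f ((u a : ZMod q) • x₀) ≠ 0 := by
    intro a
    rw [hs', smul_smul, Units.inv_mul, one_smul]
    exact mul_ne_zero (fun h => by simpa [h] using hξ (Sp8.s (scalarGL (u a)))) hfx
  -- If the dilate by uₐ were nonzero at u_b x₀, comparing forms would give u_b² = uₐ² times a
  -- factor that some β makes nonzero modulo each p, so the squares would agree modulo every p.
  have hzero : ∀ a b, a ≠ b → ρ (Sp8.s (scalarGL (u a))) f ((u b : ZMod q) • x₀) = 0 := by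
    intro a b hab
    by_contra h
    rw [hs'] at h
    have h1 := hfsupp _ (right_ne_zero_of_mul h)
    refine hab (hu a b fun p hp hpq => ?_)
    have : Fact p.Prime := ⟨hp⟩
    obtain ⟨β, hβ⟩ := hx p hp hpq
    have h5 : ((u a : ZMod q)) * (((u a)⁻¹ : (ZMod q)ˣ) : ZMod q) = 1 := Units.mul_inv _
    have h4 := h1 β
    rw [T.form_smul_right, T.form_smul_right] at h4
    have h6 : (u b : ZMod q) ^ 2 * T.form β x₀ = (u a : ZMod q) ^ 2 * T.form β x₀ := by
      linear_combination (u a : ZMod q) ^ 2 * h4 - (u b : ZMod q) ^ 2 * T.form β x₀ *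
        ((u a : ZMod q) * (((u a)⁻¹ : (ZMod q)ˣ) : ZMod q) + 1) * h5
    have h7 := congrArg (ZMod.castHom hpq (ZMod p)) h6
    rw [map_mul, map_mul, map_pow, map_pow] at h7
    exact (mul_right_cancel₀ hβ h7).symm
  let v : (∀ p : q.primeFactors, Fin (((p : ℕ) - 1) / 2)) → V := fun a =>
    ⟨ρ (Sp8.s (scalarGL (u a))) f, T.torus_mem hlow hupp (u a) hf⟩
  have hli : LinearIndependent ℂ v := by
    rw [Fintype.linearIndependent_iff]
    intro c hc b
    have h := congrFun (congrArg Subtype.val hc) ((u b : ZMod q) • x₀)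
    rw [AddSubmonoidClass.coe_finsetSum, Finset.sum_apply, Finset.sum_eq_single b] at h
    · exact (mul_eq_zero.1 h).resolve_right (hne b)
    · intro a _ hab
      exact mul_eq_zero_of_right _ (hzero a b hab)
    · simp
  have hcard := hli.fintype_card_le_finrank
  rw [Fintype.card_pi] at hcard
  simp only [Fintype.card_fin] at hcard
  rwa [Finset.prod_coe_sort q.primeFactors fun p => (p - 1) / 2] at hcard

end IsWeilRepresentation

/-! ### The number of prime factors -/

namespace Nat

/-- For every `M`, the number of prime factors of `q` is at most `M + log q / log M`. -/
lemma card_primeFactors_mul_log_le {M q : ℕ} (hM : 1 ≤ M) (hq : q ≠ 0) :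
    (q.primeFactors.card : ℝ) * Real.log M ≤ M * Real.log M + Real.log q := by
  -- There are at most M prime factors below M. The others are at least M and have product at most
  -- q.
  have hsplit : q.primeFactors.card ≤ M + (q.primeFactors.filter (M ≤ ·)).card := by
    rw [← Finset.card_filter_add_card_filter_not (s := q.primeFactors) (M ≤ ·), add_comm]
    refine Nat.add_le_add_right ?_ _
    calc (q.primeFactors.filter (¬ M ≤ ·)).card ≤ (Finset.range M).card :=
          Finset.card_le_card fun p hp => by simpa using (Finset.mem_filter.1 hp).2
      _ = M := Finset.card_range M
  have hpow : M ^ (q.primeFactors.filter (M ≤ ·)).card ≤ q := by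
    calc M ^ (q.primeFactors.filter (M ≤ ·)).card
        ≤ ∏ p ∈ q.primeFactors.filter (M ≤ ·), p :=
          Finset.pow_card_le_prod _ _ _ fun p hp => (Finset.mem_filter.1 hp).2
      _ ≤ ∏ p ∈ q.primeFactors, p :=
          Finset.prod_le_prod_of_subset_of_one_le' (Finset.filter_subset _ _) fun p hp _ =>
            (Nat.prime_of_mem_primeFactors hp).one_le
      _ ≤ q := Nat.le_of_dvd (Nat.pos_of_ne_zero hq) (Nat.prod_primeFactors_dvd q)
  have hlog : ((q.primeFactors.filter (M ≤ ·)).card : ℝ) * Real.log M ≤ Real.log q := by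
    rw [← Real.log_pow]
    exact Real.log_le_log (by positivity) (by exact_mod_cast hpow)
  have hM0 : 0 ≤ Real.log M := Real.log_nonneg (by exact_mod_cast hM)
  calc (q.primeFactors.card : ℝ) * Real.log M
      ≤ (M + (q.primeFactors.filter (M ≤ ·)).card : ℝ) * Real.log M :=
        mul_le_mul_of_nonneg_right (by exact_mod_cast hsplit) hM0
    _ ≤ M * Real.log M + Real.log q := by rw [add_mul]; gcongr

/-- The number of prime factors of `q` is `o(log q)`. -/
theorem tendsto_card_primeFactors_div_log (c : ℝ) (hc : 0 < c) :
    Tendsto (fun q : ℕ => (q.primeFactors.card : ℝ) * c / Real.log q) atTop (𝓝 0) := by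
  have hlog : Tendsto (fun q : ℕ => Real.log q) atTop atTop :=
    Real.tendsto_log_atTop.comp tendsto_natCast_atTop_atTop
  rw [Metric.tendsto_atTop]
  intro ε hε
  -- With this M, and log q > 2Mc/ε below, each of the two terms of the bound takes at most half of
  -- ε.
  obtain ⟨M, hM⟩ := (hlog.eventually_gt_atTop (2 * c / ε)).exists
  have hMl : 0 < Real.log M := lt_trans (by positivity) hM
  have hM1 : 1 ≤ M := by
    by_contra h
    have : M = 0 := by omega
    simp [this] at hMl
  obtain ⟨N, hN⟩ := eventually_atTop.1 (hlog.eventually_gt_atTop (2 * (M * c) / ε))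
  refine ⟨max N 2, fun q hq => ?_⟩
  have hq2 : 2 ≤ q := (le_max_right _ _).trans hq
  have hql : 0 < Real.log q := Real.log_pos (by exact_mod_cast hq2)
  have h1 := card_primeFactors_mul_log_le hM1 (q := q) (by omega)
  have h2 := hN q ((le_max_left _ _).trans hq)
  rw [div_lt_iff₀ hε] at hM h2
  rw [Real.dist_eq, sub_zero, abs_of_nonneg (by positivity), div_lt_iff₀ hql]
  have h3 : (q.primeFactors.card : ℝ) * c * (2 * Real.log M) < ε * Real.log q * (2 * Real.log M) := by
    nlinarith [mul_lt_mul_of_pos_right h2 hMl, mul_lt_mul_of_pos_right hM hql,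
      mul_le_mul_of_nonneg_left h1 hc.le]
  exact lt_of_mul_lt_mul_right h3 (by positivity)

/-- For p ≥ 3 the rounded quotient (p - 1)/2 is at least p/4, so the product is at least q / 4^ω,
and 4^ω = q^(ω log 4 / log q). -/
lemma rpow_le_prod_half {q : ℕ} (hq : Squarefree q) (hp : ∀ p, p.Prime → p ∣ q → 2 < p) :
    (q : ℝ) ^ (1 - (q.primeFactors.card : ℝ) * Real.log 4 / Real.log q) ≤
      ((∏ p ∈ q.primeFactors, (p - 1) / 2 : ℕ) : ℝ) := by
  have hq0 : 0 < q := Nat.pos_of_ne_zero hq.ne_zero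
  have h4 : q ≤ 4 ^ q.primeFactors.card * ∏ p ∈ q.primeFactors, (p - 1) / 2 := by
    rw [← Finset.prod_const, ← Finset.prod_mul_distrib]
    conv_lhs => rw [← Nat.prod_primeFactors_of_squarefree hq]
    refine Finset.prod_le_prod' fun p hp' => ?_
    have := hp p (Nat.prime_of_mem_primeFactors hp') (Nat.dvd_of_mem_primeFactors hp')
    omega
  rcases Nat.eq_or_lt_of_le (show 1 ≤ q from hq0) with h1 | h1
  · subst h1; simp
  · have hql : 0 < Real.log q := Real.log_pos (by exact_mod_cast h1)
    have e : (q : ℝ) ^ ((q.primeFactors.card : ℝ) * Real.log 4 / Real.log q) =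
        4 ^ q.primeFactors.card := by
      rw [Real.rpow_def_of_pos (by exact_mod_cast hq0), mul_div_cancel₀ _ hql.ne', ← Real.log_pow,
        Real.exp_log (by positivity)]
    rw [Real.rpow_sub (by exact_mod_cast hq0), Real.rpow_one, e, div_le_iff₀ (by positivity),
      mul_comm]
    exact_mod_cast h4

end Nat

/-! ### Decomposition into irreducible subrepresentations -/

namespace Subrepresentation

open scoped MonoidAlgebra

variable {k G V : Type*} [Field k] [Group G] [AddCommGroup V] [Module k V]
  {ρ : Representation k G V}

lemma isIrreducible_of_isAtom {σ : Subrepresentation ρ} (h : IsAtom σ) :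
    σ.toRepresentation.IsIrreducible := by
  have hne : σ.toSubmodule ≠ ⊥ := fun h' => h.1 (toSubmodule_injective h')
  obtain ⟨v, hv, hv0⟩ := σ.toSubmodule.ne_bot_iff.1 hne
  have hnt : Nontrivial (Subrepresentation σ.toRepresentation) := by
    refine ⟨⊥, ⊤, fun h' => hv0 ?_⟩
    have h1 : (⟨v, hv⟩ : σ.toSubmodule) ∈
        (⊥ : Subrepresentation σ.toRepresentation).toSubmodule := by
      rw [h']; exact Submodule.mem_top
    exact congrArg Subtype.val ((Submodule.mem_bot k).1 h1)
  refine { eq_bot_or_eq_top := fun τ => ?_ }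
  let τ' : Subrepresentation ρ := ⟨τ.toSubmodule.map σ.toSubmodule.subtype, by
    rintro g _ ⟨x, hx, rfl⟩
    exact ⟨σ.toRepresentation g x, τ.apply_mem_toSubmodule g hx, rfl⟩⟩
  have hle : τ' ≤ σ := by
    rintro _ ⟨x, -, rfl⟩
    exact x.2
  rcases h.le_iff.1 hle with h' | h'
  · left
    apply toSubmodule_injective
    change τ.toSubmodule = ⊥
    have h1 : τ.toSubmodule.map σ.toSubmodule.subtype = ⊥ := congrArg toSubmodule h'
    apply Submodule.map_injective_of_injective σ.toSubmodule.subtype_injective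
    rw [h1, Submodule.map_bot]
  · right
    apply toSubmodule_injective
    change τ.toSubmodule = ⊤
    have h1 : τ.toSubmodule.map σ.toSubmodule.subtype = σ.toSubmodule := congrArg toSubmodule h'
    apply Submodule.map_injective_of_injective σ.toSubmodule.subtype_injective
    rw [h1, Submodule.map_subtype_top]

/-- A finite-dimensional semisimple representation is a finite direct sum of irreducible
subrepresentations. -/
theorem exists_isInternal_isIrreducible (ρ : Representation k G V) [FiniteDimensional k V]
    [ρ.IsSemisimpleRepresentation] :
    ∃ (n : ℕ) (σ : Fin n → Subrepresentation ρ),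
      DirectSum.IsInternal (fun i => (σ i).toSubmodule) ∧
        ∀ i, (σ i).toRepresentation.IsIrreducible := by
  have : IsSemisimpleModule k[G] ρ.asModule :=
    (Representation.isSemisimpleRepresentation_iff_isSemisimpleModule_asModule ρ).1 inferInstance
  obtain ⟨s, hs1, hs2, hs3⟩ := IsSemisimpleModule.exists_sSupIndep_sSup_simples_eq_top k[G]
    ρ.asModule
  -- Finite dimension gives the ascending chain condition, which makes the independent family of
  -- simple submodules finite.
  have hwf : WellFoundedGT (Subrepresentation ρ) :=
    ⟨InvImage.wf (fun σ : Subrepresentation ρ => σ.toSubmodule) (wellFounded_gt (α := Submodule k V))⟩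
  have hwf' : WellFoundedGT (Submodule k[G] ρ.asModule) :=
    ⟨InvImage.wf (fun N => ofSubmodule' N) hwf.wf⟩
  have hfin : s.Finite := WellFoundedGT.finite_of_sSupIndep hs1
  have : Finite s := hfin
  let eqv := (Finite.equivFin s).symm
  refine ⟨Nat.card s, fun i => ofSubmodule' (eqv i).1, ?_, fun i => ?_⟩
  · have h1 : iSupIndep fun i => (eqv i).1 := ((sSupIndep_iff s).1 hs1).comp eqv.injective
    have h2 : ⨆ i, (eqv i).1 = ⊤ := by
      rw [← hs2, sSup_eq_iSup', eqv.iSup_comp (g := fun x : s => x.1)]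
    have h3 := DirectSum.isInternal_submodule_of_iSupIndep_of_iSup_eq_top h1 h2
    exact h3
  · apply isIrreducible_of_isAtom
    have h1 : IsAtom (eqv i).1 := isSimpleModule_iff_isAtom.1 (hs3 _ (eqv i).2)
    exact (subrepresentationSubmoduleOrderIso (ρ := ρ)).symm.isAtom_iff _ |>.2 h1

end Subrepresentation

/-! ### The exceptional primes of a generic form -/

/-- Distinct roots give pairwise coprime linear factors, and n of them exhaust a monic polynomial of
degree n. -/
lemma Matrix.charpoly_eq_prod_of_injective {K : Type*} [Field K] {n : ℕ}
    {A : Matrix (Fin n) (Fin n) K} {ν : Fin n → K} (hν : Function.Injective ν)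
    (hroot : ∀ i, A.charpoly.IsRoot (ν i)) :
    A.charpoly = ∏ i, (Polynomial.X - Polynomial.C (ν i)) := by
  refine Polynomial.eq_of_monic_of_dvd_of_natDegree_le
    (Polynomial.monic_prod_of_monic _ _ fun i _ => Polynomial.monic_X_sub_C _)
    (Matrix.charpoly_monic A)
    (Finset.prod_dvd_of_coprime (fun i _ j _ hij => Polynomial.pairwise_coprime_X_sub_C hν hij)
      fun i _ => Polynomial.dvd_iff_isRoot.2 (hroot i)) ?_
  rw [Matrix.charpoly_natDegree_eq_dim, Polynomial.natDegree_prod_of_monic _ _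
    fun i _ => Polynomial.monic_X_sub_C _]
  simp

lemma ZMod.isUnit_intCast_of_forall_prime {q : ℕ} {K : ℤ} (hK : K ≠ 0)
    (h : ∀ p : ℕ, p.Prime → p ∣ q → K.natAbs < p) : IsUnit ((K : ℤ) : ZMod q) := by
  have hcop : Nat.Coprime K.natAbs q := by
    by_contra hc
    obtain ⟨p, hp, hpK, hpq⟩ := Nat.Prime.not_coprime_iff_dvd.1 hc
    exact absurd (Nat.le_of_dvd (Int.natAbs_pos.2 hK) hpK) (not_le.2 (h p hp hpq))
  obtain ⟨u, v, huv⟩ := Int.isCoprime_iff_gcd_eq_one.2 (show Int.gcd K q = 1 from hcop)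
  have h1 := congrArg (Int.cast : ℤ → ZMod q) huv
  push_cast at h1
  rw [ZMod.natCast_self, mul_zero, add_zero] at h1
  exact IsUnit.of_mul_eq_one_right _ h1

namespace QuadForm8

open Polynomial

variable (Q : QuadForm8)

/-- The integral matrix `(det b)² Δ`. -/
def intDisc : Matrix (Fin 4) (Fin 4) ℤ :=
  (4 : ℤ) • (Q.b.adjugate * Q.a * Q.b.adjugateᵀ * Q.c) - (Q.b.det ^ 2) • 1

variable {Q}

/-- Clearing denominators through adj b = det b · b⁻¹ gives an integral matrix, whose characteristic
polynomial can be reduced modulo every prime. -/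
lemma map_intDisc {S : Type*} [CommRing S] (hb : IsUnit ((Q.b.det : ℤ) : S)) :
    Q.intDisc.map (Int.cast : ℤ → S) = ((Q.b.det : ℤ) : S) ^ 2 • Q.discOver S := by
  have hadj : (Q.bOver S).adjugate = ((Q.b.det : ℤ) : S) • (Q.bOver S)⁻¹ := by
    rw [Matrix.inv_def, det_bOver, smul_smul, Ring.mul_inverse_cancel _ hb, one_smul]
  have hadj' : (Int.castRingHom S).mapMatrix Q.b.adjugate = (Q.bOver S).adjugate :=
    RingHom.map_adjugate _ _
  change (Int.castRingHom S).mapMatrix Q.intDisc = _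
  have ht : (Int.castRingHom S).mapMatrix Q.b.adjugateᵀ = ((Q.bOver S).adjugate)ᵀ := by
    rw [← hadj', ← mapMatrix_transpose]
  rw [intDisc, map_sub, mapMatrix_smul, mapMatrix_smul, map_mul, map_mul, map_mul, ht, hadj', hadj,
    discOver, map_one, smul_sub]
  have ha : (Int.castRingHom S).mapMatrix Q.a = Q.aOver S := rfl
  have hc : (Int.castRingHom S).mapMatrix Q.c = Q.cOver S := rfl
  have h4 : Int.castRingHom S 4 = 4 := by simp
  rw [ha, hc, h4, map_pow]
  simp only [transpose_smul, Matrix.smul_mul, Matrix.mul_smul, smul_smul, eq_intCast]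
  congr 2
  ring

lemma map_intDisc_add {S : Type*} [CommRing S] (hb : IsUnit ((Q.b.det : ℤ) : S)) :
    (Q.intDisc + (Q.b.det ^ 2) • 1).map (Int.cast : ℤ → S) =
      ((Q.b.det : ℤ) : S) ^ 2 • (Q.discOver S + 1) := by
  have h1 := map_intDisc hb
  change (Int.castRingHom S).mapMatrix _ = _ at h1 ⊢
  rw [map_add, h1, mapMatrix_smul, map_one, smul_add, map_pow, eq_intCast]

lemma det_map_intCast {S : Type*} [CommRing S] (M : Matrix (Fin 4) (Fin 4) ℤ) :
    (M.map (Int.cast : ℤ → S)).det = ((M.det : ℤ) : S) := by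
  simpa using ((Int.castRingHom S).map_det M).symm

namespace IsGeneric

lemma det_b_ne_zero (hQ : Q.IsGeneric) : Q.b.det ≠ 0 := by
  have h := hQ.1
  rw [Matrix.det_mul] at h
  exact right_ne_zero_of_mul h

/-- The characteristic polynomial of the discriminant matrix over the algebraic closure. -/
lemma exists_charpoly_eq_prod (hQ : Q.IsGeneric) :
    ∃ ν : Fin 4 → AlgebraicClosure ℚ, Function.Injective ν ∧
      (∀ i, ν i ≠ 0 ∧ ν i ≠ -((Q.b.det : ℤ) : AlgebraicClosure ℚ) ^ 2) ∧
      (Q.intDisc.map (Int.cast : ℤ → AlgebraicClosure ℚ)).charpoly = ∏ i, (X - C (ν i)) := by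
  let K := AlgebraicClosure ℚ
  obtain ⟨μ, hμ, h⟩ : ∃ μ : Fin 4 → K, Function.Injective μ ∧ ∀ i, Module.End.HasEigenvalue
    (Matrix.toLin' (Q.disc.map (algebraMap ℚ K))) (μ i) ∧ μ i ≠ 0 ∧ μ i ≠ -1 := hQ.2
  have hd : ((Q.b.det : ℤ) : K) ≠ 0 := Int.cast_ne_zero.2 hQ.det_b_ne_zero
  have hd2 : ((Q.b.det : ℤ) : K) ^ 2 ≠ 0 := pow_ne_zero 2 hd
  have hb : IsUnit ((Q.b.det : ℤ) : K) := isUnit_iff_ne_zero.2 hd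
  have hbQ : IsUnit ((Q.b.det : ℤ) : ℚ) :=
    isUnit_iff_ne_zero.2 (Int.cast_ne_zero.2 hQ.det_b_ne_zero)
  have hdisc : Q.disc.map (algebraMap ℚ K) = Q.discOver K := mapMatrix_discOver _ hbQ
  refine ⟨fun i => ((Q.b.det : ℤ) : K) ^ 2 * μ i, fun i j hij => hμ (mul_left_cancel₀ hd2 hij),
    fun i => ⟨mul_ne_zero hd2 (h i).2.1, fun h' => (h i).2.2 (mul_left_cancel₀ hd2 ?_)⟩, ?_⟩
  · rw [mul_neg, mul_one]
    exact h'
  · refine Matrix.charpoly_eq_prod_of_injective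
      (fun i j hij => hμ (mul_left_cancel₀ hd2 hij)) fun i => ?_
    have h1 := (Module.End.hasEigenvalue_iff_isRoot_charpoly _ _).1 (h i).1
    rw [Matrix.charpoly_toLin', hdisc, IsRoot, Matrix.eval_charpoly] at h1
    have e : Matrix.scalar (Fin 4) (((Q.b.det : ℤ) : K) ^ 2 * μ i) -
        ((Q.b.det : ℤ) : K) ^ 2 • Q.discOver K =
        ((Q.b.det : ℤ) : K) ^ 2 • (Matrix.scalar (Fin 4) (μ i) - Q.discOver K) := by
      rw [smul_sub, map_mul]
      congr 1
      rw [Matrix.scalar_apply, Matrix.scalar_apply, ← Matrix.smul_one_eq_diagonal, smul_one_mul]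
    rw [map_intDisc hb, IsRoot, Matrix.eval_charpoly, e, Matrix.det_smul, h1, mul_zero]

lemma separable (hQ : Q.IsGeneric) :
    (Q.intDisc.charpoly.map (Int.castRingHom ℚ)).Separable := by
  obtain ⟨ν, hν, -, h⟩ := hQ.exists_charpoly_eq_prod
  rw [← Polynomial.separable_map (algebraMap ℚ (AlgebraicClosure ℚ)), Polynomial.map_map,
    RingHom.ext_int ((algebraMap ℚ (AlgebraicClosure ℚ)).comp (Int.castRingHom ℚ))
      (Int.castRingHom _), ← Matrix.charpoly_map]
  change (Q.intDisc.map (Int.cast : ℤ → AlgebraicClosure ℚ)).charpoly.Separable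
  rw [h]
  exact separable_prod_X_sub_C_iff.2 hν

/-- Up to sign these determinants are the values of the characteristic polynomial at 0 and -(det
b)², neither of which is a root because 0 and -1 are not eigenvalues of Δ. -/
lemma det_intDisc_ne_zero (hQ : Q.IsGeneric) :
    Q.intDisc.det ≠ 0 ∧ (Q.intDisc + (Q.b.det ^ 2) • 1).det ≠ 0 := by
  obtain ⟨ν, -, hν, h⟩ := hQ.exists_charpoly_eq_prod
  have hd : ∀ M : Matrix (Fin 4) (Fin 4) ℤ,
      (M.map (Int.cast : ℤ → AlgebraicClosure ℚ)).det ≠ 0 → M.det ≠ 0 := fun M hM h0 => by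
    rw [det_map_intCast, h0, Int.cast_zero] at hM
    exact hM rfl
  constructor
  · apply hd
    have h1 := congrArg (Polynomial.eval 0) h
    rw [Matrix.eval_charpoly, Polynomial.eval_prod, map_zero, zero_sub, Matrix.det_neg] at h1
    simp only [Polynomial.eval_sub, eval_X, eval_C, zero_sub] at h1
    intro h0
    rw [h0, mul_zero, eq_comm, Finset.prod_eq_zero_iff] at h1
    obtain ⟨i, -, hi⟩ := h1
    exact (hν i).1 (neg_eq_zero.1 hi)
  · apply hd
    have h1 := congrArg (Polynomial.eval (-((Q.b.det : ℤ) : AlgebraicClosure ℚ) ^ 2)) h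
    rw [Matrix.eval_charpoly, Polynomial.eval_prod] at h1
    simp only [Polynomial.eval_sub, eval_X, eval_C] at h1
    intro h0
    have e : Matrix.scalar (Fin 4) (-((Q.b.det : ℤ) : AlgebraicClosure ℚ) ^ 2) -
        Q.intDisc.map (Int.cast : ℤ → AlgebraicClosure ℚ) =
        -((Q.intDisc + (Q.b.det ^ 2) • 1).map (Int.cast : ℤ → AlgebraicClosure ℚ)) := by
      change _ - (Int.castRingHom _).mapMatrix _ = -(Int.castRingHom _).mapMatrix _
      rw [map_add, mapMatrix_smul, map_one, map_pow, eq_intCast, Matrix.scalar_apply,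
        ← Matrix.smul_one_eq_diagonal, neg_smul]
      abel
    rw [e, Matrix.det_neg, h0, mul_zero, eq_comm, Finset.prod_eq_zero_iff] at h1
    obtain ⟨i, -, hi⟩ := h1
    exact (hν i).2 (sub_eq_zero.1 hi).symm

/-- The matrix (det b)²(Δ + 1) has c as a factor, so -1 not being an eigenvalue makes c invertible.
-/
lemma det_c_ne_zero (hQ : Q.IsGeneric) : Q.c.det ≠ 0 := by
  have h := hQ.det_intDisc_ne_zero.2
  rw [intDisc, sub_add_cancel, Matrix.det_smul, Matrix.det_mul] at h
  exact right_ne_zero_of_mul (right_ne_zero_of_mul h)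

/-- For all but finitely many primes, the discriminant matrix has separable characteristic
polynomial, and neither `0` nor `-1` is an eigenvalue. -/
lemma exists_exceptional (hQ : Q.IsGeneric) : ∃ K : ℤ, K ≠ 0 ∧ Q.b.det ∣ K ∧ Q.c.det ∣ K ∧
    ∀ (p : ℕ) [Fact p.Prime], ((K : ℤ) : ZMod p) ≠ 0 →
      (Q.intDisc.map (Int.cast : ℤ → ZMod p)).charpoly.Separable ∧
      (Q.discOver (ZMod p)).det ≠ 0 ∧ (Q.discOver (ZMod p) + 1).det ≠ 0 := by
  obtain ⟨N, hN, hsep⟩ := Polynomial.exists_separable_map_zmod _ hQ.separable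
  obtain ⟨h0, h1⟩ := hQ.det_intDisc_ne_zero
  refine ⟨Q.b.det * Q.c.det * Q.intDisc.det * (Q.intDisc + (Q.b.det ^ 2) • 1).det * N,
    mul_ne_zero (mul_ne_zero (mul_ne_zero (mul_ne_zero hQ.det_b_ne_zero hQ.det_c_ne_zero) h0) h1) hN,
    ⟨Q.c.det * Q.intDisc.det * (Q.intDisc + (Q.b.det ^ 2) • 1).det * N, by ring⟩,
    ⟨Q.b.det * Q.intDisc.det * (Q.intDisc + (Q.b.det ^ 2) • 1).det * N, by ring⟩, ?_⟩
  intro p _ hK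
  rw [Int.cast_mul, Int.cast_mul, Int.cast_mul, Int.cast_mul] at hK
  have hKN := right_ne_zero_of_mul hK
  have hK1 := right_ne_zero_of_mul (left_ne_zero_of_mul hK)
  have hK0 := right_ne_zero_of_mul (left_ne_zero_of_mul (left_ne_zero_of_mul hK))
  have hKb := left_ne_zero_of_mul (left_ne_zero_of_mul (left_ne_zero_of_mul
    (left_ne_zero_of_mul hK)))
  have hb : IsUnit ((Q.b.det : ℤ) : ZMod p) := isUnit_iff_ne_zero.2 hKb
  refine ⟨?_, ?_, ?_⟩
  · have h := hsep p hKN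
    rw [← Matrix.charpoly_map] at h
    exact h
  · rw [← det_map_intCast, map_intDisc hb, Matrix.det_smul] at hK0
    exact right_ne_zero_of_mul hK0
  · rw [← det_map_intCast, map_intDisc_add hb, Matrix.det_smul] at hK1
    exact right_ne_zero_of_mul hK1

end IsGeneric

/-- The quadratic forms `xᵀ (2c) Δᵏ x` have no common nontrivial zero modulo a good prime. -/
lemma castHom_eq_zero_of_form {q p : ℕ} [Fact p.Prime] (hpq : p ∣ q)
    (hb : IsUnit ((Q.b.det : ℤ) : ZMod q))
    (hc : IsUnit ((2 : ZMod q) • Q.cOver (ZMod q)).det)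
    (hsep : (Q.intDisc.map (Int.cast : ℤ → ZMod p)).charpoly.Separable) (x : Fin 4 → ZMod q)
    (hx : ∀ β, ZMod.castHom hpq (ZMod p) ((Q.polyAction hc).form β x) = 0) (i : Fin 4) :
    ZMod.castHom hpq (ZMod p) (x i) = 0 := by
  have hbp : IsUnit ((Q.b.det : ℤ) : ZMod p) := isUnit_cast hpq hb
  have he : (ZMod.castHom hpq (ZMod p)).mapMatrix ((2 : ZMod q) • Q.cOver (ZMod q)) =
      (2 : ZMod p) • Q.cOver (ZMod p) := by
    rw [mapMatrix_smul, mapMatrix_cast, map_ofNat]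
  have hcp : IsUnit ((2 : ZMod p) • Q.cOver (ZMod p)).det := by
    rw [← he, ← RingHom.map_det]
    exact hc.map _
  -- Separability is known for (det b)²Δ. Passing from Δ to this multiple only scales the forms.
  have key := Matrix.eq_zero_of_isotropic hcp (Δ := Q.intDisc.map (Int.cast : ℤ → ZMod p))
    (by rw [map_intDisc hbp, transpose_smul, Matrix.smul_mul, discOver_transpose_mul,
      Matrix.mul_smul _ (_ ^ 2)]) hsep (ZMod.castHom hpq (ZMod p) ∘ x) (fun k => by
      rw [map_intDisc hbp, _root_.smul_pow, Matrix.mul_smul _ (_ ^ k), smul_mulVec, dotProduct_smul]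
      have h := hx (X ^ k)
      have e1 : (Q.polyAction hc).form (X ^ k) x = x ⬝ᵥ ((((2 : ZMod q) • Q.cOver (ZMod q)) *
          aeval (Q.discOver (ZMod q)) (X ^ k : (ZMod q)[X])) *ᵥ x) := rfl
      have e2 : (ZMod.castHom hpq (ZMod p)).mapMatrix (((2 : ZMod q) • Q.cOver (ZMod q)) *
          aeval (Q.discOver (ZMod q)) (X ^ k : (ZMod q)[X])) =
          ((2 : ZMod p) • Q.cOver (ZMod p)) * Q.discOver (ZMod p) ^ k := by
        rw [map_mul, he, mapMatrix_aeval_discOver _ hb, Polynomial.map_pow, map_X, aeval_X_pow]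
      rw [e1, RingHom.map_dotProduct] at h
      rw [← e2, smul_eq_mul]
      refine mul_eq_zero_of_right _ (Eq.trans ?_ h)
      congr 1
      ext j
      rw [Function.comp_apply, RingHom.map_mulVec]
      rfl)
  exact congrFun key i

end QuadForm8

theorem proposition8p5 (Q : QuadForm8) (hQ : Q.IsGeneric) :
    ∃ (p₀ : ℕ) (η : ℕ → ℝ), Tendsto η atTop (𝓝 0) ∧
      ∀ (q : ℕ) [NeZero q], Squarefree q → (∀ p : ℕ, p.Prime → p ∣ q → p₀ < p) →
        Odd q ∧ ∃ hb : IsUnit ((Q.b.det : ℤ) : ZMod q),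
          ∀ ρ : Representation ℂ (Sp8 (ZMod q)) (L2 q), IsWeilRepresentation ρ →
            (∃ (n : ℕ) (σ : Fin n → Subrepresentation
                (ρ.comp (Q.Gam q hb).subtype : Representation ℂ (Q.Gam q hb) (L2 q))),
              DirectSum.IsInternal (fun i => (σ i).toSubmodule) ∧
                ∀ i, (σ i).toRepresentation.IsIrreducible) ∧
            ∀ σ : Subrepresentation
                (ρ.comp (Q.Gam q hb).subtype : Representation ℂ (Q.Gam q hb) (L2 q)),
              σ.toRepresentation.IsIrreducible →
                (q : ℝ) ^ (1 - η q) ≤ (Module.finrank ℂ σ.toSubmodule : ℝ) := by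
  obtain ⟨K, hK, hbK, hcK, hgood⟩ := hQ.exists_exceptional
  -- Primes above 26^13 make the index argument work, and primes above |K| avoid the exceptional
  -- ones. The exponent loss η comes from the factor 4^ω(q).
  refine ⟨26 ^ 13 + K.natAbs, fun q => (q.primeFactors.card : ℝ) * Real.log 4 / Real.log q,
    Nat.tendsto_card_primeFactors_div_log _ (Real.log_pos (by norm_num)), ?_⟩
  intro q _ hq hlarge
  have hbig : ∀ p : ℕ, p.Prime → p ∣ q → 26 ^ 13 < p := fun p hp hpq =>
    (Nat.le_add_right _ _).trans_lt (hlarge p hp hpq)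
  have hsmall : ∀ n : ℤ, n ≠ 0 → n.natAbs ≤ 26 ^ 13 → IsUnit ((n : ℤ) : ZMod q) := fun n hn h =>
    ZMod.isUnit_intCast_of_forall_prime hn fun p hp hpq => h.trans_lt (hbig p hp hpq)
  have hKp : ∀ p : ℕ, p.Prime → p ∣ q → K.natAbs < p := fun p hp hpq =>
    (Nat.le_add_left _ _).trans_lt (hlarge p hp hpq)
  have hKu := ZMod.isUnit_intCast_of_forall_prime hK hKp
  have h2 : IsUnit (2 : ZMod q) := by
    exact_mod_cast hsmall 2 (by norm_num) (by norm_num)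
  have h3 : IsUnit (3 : ZMod q) := by
    exact_mod_cast hsmall 3 (by norm_num) (by norm_num)
  have hb : IsUnit ((Q.b.det : ℤ) : ZMod q) :=
    isUnit_of_dvd_unit (map_dvd (Int.castRingHom (ZMod q)) hbK) hKu
  have hcu : IsUnit ((Q.c.det : ℤ) : ZMod q) :=
    isUnit_of_dvd_unit (map_dvd (Int.castRingHom (ZMod q)) hcK) hKu
  have hc : IsUnit ((2 : ZMod q) • Q.cOver (ZMod q)).det := by
    rw [Matrix.det_smul, QuadForm8.det_map_intCast]
    exact (h2.pow _).mul hcu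
  have hodd : Odd q := by
    rw [← Nat.not_even_iff_odd, even_iff_two_dvd]
    exact fun h => absurd (hbig 2 Nat.prime_two h) (by norm_num)
  -- Complete reducibility is Maschke's theorem for the finite group Γ_q over ℂ.
  refine ⟨hodd, hb, fun ρ hρ => ⟨Subrepresentation.exists_isInternal_isIrreducible _, ?_⟩⟩
  intro σ hσ
  have hgood' : ∀ p : ℕ, p.Prime → p ∣ q →
      (Q.intDisc.map (Int.cast : ℤ → ZMod p)).charpoly.Separable ∧
      (Q.discOver (ZMod p)).det ≠ 0 ∧ (Q.discOver (ZMod p) + 1).det ≠ 0 := fun p hp hpq => by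
    have : Fact p.Prime := ⟨hp⟩
    refine hgood p fun h => ?_
    have h' := QuadForm8.isUnit_cast hpq hKu
    rw [h] at h'
    exact not_isUnit_zero h'
  have hmem := QuadForm8.low_upp_mem_Gam_of_squarefree hq hb hc hbig
    (fun p hp hpq => (hgood' p hp hpq).2.1) (fun p hp hpq => (hgood' p hp hpq).2.2)
  have hne : σ.toSubmodule ≠ ⊥ := by
    intro h
    obtain ⟨τ, τ', hτ⟩ := hσ.toNontrivial
    refine hτ (Subrepresentation.toSubmodule_injective ?_)
    have : Subsingleton σ.toSubmodule := by rw [h]; infer_instance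
    exact Subsingleton.elim _ _
  have hdim := hρ.prod_le_finrank (Q.polyAction hc) hq h2 h3
    (fun p hp hpq x hx => by
      have : Fact p.Prime := ⟨hp⟩
      exact QuadForm8.castHom_eq_zero_of_form hpq hb hc (hgood' p hp hpq).1 x hx) hne
    (fun β f hf => σ.apply_mem_toSubmodule ⟨_, (hmem β).1⟩ hf)
    (fun β f hf => σ.apply_mem_toSubmodule ⟨_, (hmem β).2⟩ hf)
  exact (Nat.rpow_le_prod_half hq fun p hp hpq =>
    lt_trans (by norm_num) (hbig p hp hpq)).trans (by exact_mod_cast hdim)
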